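/- Let $\mathbb K=\mathbb R$ or $\mathbb C$, let $n\ge 1$, and assume $n\geq 2$ if $\mathbb K=\mathbb R$. All objects are germs at the origin. **Definitions.** Let $w=(w_1,\dots,w_n)$ be positive rational weights. A polynomial is weighted homogeneous of degree $d$ if each of its monomials $x^\beta$ has weight $\sum_i\beta_iw_i=d$. The germ of $X\subseteq\mathbb K^n$ at $0$ is *weighted homogeneous* if it is the zero set of finitely many weighted homogeneous polynomials of positive degrees. $\Theta_X$ is the module of analytic vector field germs that map the ideal of analytic germs vanishing on $(X,0)$ into itself. An analytic germ $f$ is *$\mathscr R_X$-finitely determined* if for some $k$ every analytic germ $g$ with the same $k$-jet at $0$ is of the form $g=f\circ\phi$ with $\phi:(\mathbb K^n,0)\to(\mathbb K^n,0)$ a bi-analytic germ that preserves $(X,0)$. The *filtration* of a germ is the smallest weight of a monomial with nonzero coefficient in its Taylor series at $0$ ($+\infty$ for the zero germ). A *deformation of $f_0$ by terms of filtration at least $D$* is an analytic germ $F(x,t)$ at $(0,0)\in\mathbb K^n\times\mathbb K$ with $F(x,0)=f_0(x)$ such that $F(\cdot,t)-f_0$ has filtration at least $D$ for all $t$ near $0$.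 A *control function* is a real analytic function $\rho:\mathbb K^n\to\mathbb R$ with $\rho\ge 0$ and $\rho(x)=0$ if and only if $x=0$, which is irreducible in the ring of germs at $0$ of real analytic functions. $F$ is *strongly rational $\mathscr R_X$-bi-Lipschitz trivial* if there are a control function $\rho$ and a family of real analytic vector fields $v_t(x)=\sum_{j=1}^r\alpha_j(x,t)\,\eta_j(x)$, with $\eta_j\in\Theta_X$ and $\mathbb K$-valued functions $\alpha_j$ real analytic near $(0,0)$, such that the components of $V_t=v_t/\rho$, with $V_t(0)=0$, are Lipschitz on a neighbourhood of $0$, the neighbourhood and the Lipschitz constant being independent of $t$ near $0$, and $$\frac{\partial F}{\partial t}(x,t)=d(F(\cdot,t))_x\big(V_t(x)\big)\qquad\text{for }(x,t)\text{ near }(0,0).$$ **Statement.** (1) Let $w_1\ge\dots\ge w_n>0$ be rational weights, let $(X,0)$ be weighted homogeneous with weights $w$, and let $f_0$ be weighted homogeneous with the same weights, of degree $d>0$, and $\mathscr R_X$-finitely determined. Then every deformation of $f_0$ by terms of filtration at least $d+w_1-w_n$ is strongly rational $\mathscr R_X$-bi-Lipschitz trivial. (2) In particular, if $(X,0)$ is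 the zero set of finitely many homogeneous polynomials of positive degrees and $f_0$ is homogeneous of degree $d\ge1$ and $\mathscr R_X$-finitely determined, then every deformation of $f_0$ by terms of (ordinary) degree at least $d$ is strongly rational $\mathscr R_X$-bi-Lipschitz trivial. -/

import Mathlib

open Filter Topology
open scoped NNReal

namespace BiLipRX

variable {𝕜 : Type*} [RCLike 𝕜] {n : ℕ}

/-- The germ at `0` of `X ⊆ 𝕜ⁿ` is weighted homogeneous with weights `w`: it is the zero set of
finitely many weighted homogeneous polynomials of positive weighted degrees.  (For positive weights
the weighted homogeneous analytic germs are exactly the weighted homogeneous polynomials; a positive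
degree says that the germ vanishes at the origin.) -/
def IsWeightedHomogeneousGerm (w : Fin n → ℚ) (X : Set (Fin n → 𝕜)) : Prop :=
  ∃ (p : ℕ) (φ : Fin p → MvPolynomial (Fin n) 𝕜) (D : Fin p → ℚ),
    (∀ j, 0 < D j) ∧ (∀ j, MvPolynomial.IsWeightedHomogeneous w (φ j) (D j)) ∧
      ∀ᶠ x in 𝓝 (0 : Fin n → 𝕜), x ∈ X ↔ ∀ j, MvPolynomial.eval x (φ j) = 0

/-- The germ at `0` of `X ⊆ 𝕜ⁿ` is homogeneous: it is the zero set of finitely many homogeneous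
polynomials of positive degrees. -/
def IsHomogeneousGerm (X : Set (Fin n → 𝕜)) : Prop :=
  ∃ (p : ℕ) (φ : Fin p → MvPolynomial (Fin n) 𝕜) (D : Fin p → ℕ),
    (∀ j, 0 < D j) ∧ (∀ j, (φ j).IsHomogeneous (D j)) ∧
      ∀ᶠ x in 𝓝 (0 : Fin n → 𝕜), x ∈ X ↔ ∀ j, MvPolynomial.eval x (φ j) = 0

/-- The germ `g` at `0` belongs to the ideal of analytic germs vanishing on `(X, 0)`. -/
def VanishesOn (X : Set (Fin n → 𝕜)) (g : (Fin n → 𝕜) → 𝕜) : Prop :=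
  AnalyticAt 𝕜 g 0 ∧ ∀ᶠ x in 𝓝 (0 : Fin n → 𝕜), x ∈ X → g x = 0

/-- `η ∈ Θ_X`: an analytic vector field germ which, as a derivation, maps the ideal of `(X, 0)`
into itself. -/
def IsTangentField (X : Set (Fin n → 𝕜)) (η : (Fin n → 𝕜) → (Fin n → 𝕜)) : Prop :=
  AnalyticAt 𝕜 η 0 ∧
    ∀ g : (Fin n → 𝕜) → 𝕜, VanishesOn X g → VanishesOn X (fun x => fderiv 𝕜 g x (η x))

/-- `f` and `g` are `𝓡_X`-equivalent: `g = f ∘ φ` for a bi-analytic germ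
`φ : (𝕜ⁿ, 0) → (𝕜ⁿ, 0)` which preserves `(X, 0)`. -/
def RXEquivalent (X : Set (Fin n → 𝕜)) (f g : (Fin n → 𝕜) → 𝕜) : Prop :=
  ∃ φ ψ : (Fin n → 𝕜) → (Fin n → 𝕜),
    AnalyticAt 𝕜 φ 0 ∧ AnalyticAt 𝕜 ψ 0 ∧ φ 0 = 0 ∧ ψ 0 = 0 ∧
    (∀ᶠ x in 𝓝 (0 : Fin n → 𝕜), ψ (φ x) = x) ∧ (∀ᶠ x in 𝓝 (0 : Fin n → 𝕜), φ (ψ x) = x) ∧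
    (∀ᶠ x in 𝓝 (0 : Fin n → 𝕜), x ∈ X ↔ φ x ∈ X) ∧
    ∀ᶠ x in 𝓝 (0 : Fin n → 𝕜), g x = f (φ x)

/-- `f` is `𝓡_X`-finitely determined: for some `k`, every analytic germ with the same `k`-jet at `0`
as `f` is `𝓡_X`-equivalent to `f`. -/
def RXFinitelyDetermined (X : Set (Fin n → 𝕜)) (f : (Fin n → 𝕜) → 𝕜) : Prop :=
  ∃ k : ℕ, ∀ g : (Fin n → 𝕜) → 𝕜, AnalyticAt 𝕜 g 0 →
    (∀ m ≤ k, iteratedFDeriv 𝕜 m g 0 = iteratedFDeriv 𝕜 m f 0) → RXEquivalent X f g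

/-- The filtration of the germ of `g` at `0` with respect to the weights `w`: the infimum of the
weights of the monomials `x_{s 0} ⋯ x_{s (m-1)}` whose corresponding partial derivative of `g` at
`0` is nonzero (`⊤` if there is none). -/
noncomputable def filtration (w : Fin n → ℚ) (g : (Fin n → 𝕜) → 𝕜) : EReal :=
  sInf {r : EReal | ∃ (m : ℕ) (s : Fin m → Fin n),
    iteratedFDeriv 𝕜 m g 0 (fun l => Pi.single (s l) (1 : 𝕜)) ≠ 0 ∧
      r = (((∑ l, w (s l) : ℚ) : ℝ) : EReal)}

/-- `F(x, t)` is a (germ at `(0, 0)` of an) analytic one-parameter deformation of `f`, with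
`F(x, 0) = f(x)`, by terms of filtration at least `D`. -/
def IsDeformationOfFiltrationGE (w : Fin n → ℚ) (D : ℚ) (f : (Fin n → 𝕜) → 𝕜)
    (F : (Fin n → 𝕜) × 𝕜 → 𝕜) : Prop :=
  AnalyticAt 𝕜 F 0 ∧ (∀ᶠ x in 𝓝 (0 : Fin n → 𝕜), F (x, 0) = f x) ∧
    ∀ᶠ t in 𝓝 (0 : 𝕜), ((D : ℝ) : EReal) ≤ filtration w (fun x => F (x, t) - f x)

/-- A control function `ρ : 𝕜ⁿ → ℝ`: real analytic, nonnegative, zero exactly at the origin, and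
irreducible in the ring of germs at `0` of real analytic functions (where the units are the germs
that do not vanish at `0`). -/
structure IsControlFunction (ρ : (Fin n → 𝕜) → ℝ) : Prop where
  analytic : ∀ x, AnalyticAt ℝ ρ x
  nonneg : ∀ x, 0 ≤ ρ x
  eq_zero_iff : ∀ x, ρ x = 0 ↔ x = 0
  irreducible : ∀ g h : (Fin n → 𝕜) → ℝ, AnalyticAt ℝ g 0 → AnalyticAt ℝ h 0 →
    (∀ᶠ x in 𝓝 (0 : Fin n → 𝕜), ρ x = g x * h x) → g 0 ≠ 0 ∨ h 0 ≠ 0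

/-- `v(x, t) = v_t(x)` is a family of real analytic vector fields tangent to `X`:
`v_t = ∑ⱼ αⱼ(x, t) ηⱼ` with `αⱼ` real analytic (and `𝕜`-valued) near `(0, 0)` and `ηⱼ ∈ Θ_X`. -/
def IsTangentFamily (X : Set (Fin n → 𝕜)) (v : (Fin n → 𝕜) × 𝕜 → (Fin n → 𝕜)) : Prop :=
  ∃ (r : ℕ) (η : Fin r → (Fin n → 𝕜) → (Fin n → 𝕜)) (α : Fin r → (Fin n → 𝕜) × 𝕜 → 𝕜),
    (∀ j, IsTangentField X (η j)) ∧ (∀ j, AnalyticAt ℝ (α j) 0) ∧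
      ∀ᶠ q in 𝓝 (0 : (Fin n → 𝕜) × 𝕜), v q = ∑ j, α j q • η j q.1

/-- `F` is strongly rational `𝓡_X`-bi-Lipschitz trivial: there are a control function `ρ` and a
family `v_t` of real analytic vector fields tangent to `X` such that the components of
`V_t = v_t / ρ` (with `V_t(0) = 0`) are Lipschitz near `0`, with a constant and a neighbourhood
that do not depend on `t` near `0`, and `∂F/∂t = dF_t(V_t)` near `(0, 0)`. -/
def StronglyRationalBiLipschitzTrivial (X : Set (Fin n → 𝕜)) (F : (Fin n → 𝕜) × 𝕜 → 𝕜) : Prop :=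
  ∃ (ρ : (Fin n → 𝕜) → ℝ) (v V : (Fin n → 𝕜) × 𝕜 → (Fin n → 𝕜)),
    IsControlFunction ρ ∧ IsTangentFamily X v ∧
    (∀ᶠ q in 𝓝 (0 : (Fin n → 𝕜) × 𝕜), ρ q.1 • V q = v q) ∧
    (∀ᶠ t in 𝓝 (0 : 𝕜), V (0, t) = 0) ∧
    (∃ C : ℝ≥0, ∃ U ∈ 𝓝 (0 : Fin n → 𝕜), ∀ᶠ t in 𝓝 (0 : 𝕜),
      ∀ i, LipschitzOnWith C (fun x => V (x, t) i) U) ∧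
    ∀ᶠ q in 𝓝 (0 : (Fin n → 𝕜) × 𝕜),
      deriv (fun s => F (q.1, s)) q.2 = fderiv 𝕜 (fun y => F (y, q.2)) q.1 (V q)

end BiLipRX

/-!
The rational weights are multiplied by a common denominator, so all weights `W` below are positive
natural numbers; `w₁` and `w₂` denote the largest and the smallest one.  A homogeneous germ has all
weights equal to one, and then the bound `d + w₁ - wₙ` is `d`, so (2) is a case of (1).

**Finite determinacy becomes infinitesimal.**  If `f` is weighted homogeneous of degree `d` and
finitely determined, then every monomial `x ^ β` of sufficiently high degree is `df(η)` for a weighted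
homogeneous polynomial field `η` tangent to `X`
(`RXFinitelyDetermined.exists_homogeneous_tangentField`).  Finite determinacy provides a
diffeomorphism `φ` with `f ∘ φ = f + h` for each `h` of high order, but nothing is known about the
dependence of `φ` on `h`, so `φ` cannot be differentiated along a family of perturbations.  On the
level of jets the pairs `(h, φ)` are the points of an algebraic set which projects onto all `h`.  It
therefore has a generic point, with coordinates in an extension field `K`, whose coordinates `s_β`, the
coefficients of `h`, are algebraically independent (`exists_generic_point`).  In characteristic zero
the derivations `∂/∂s_β` extend to `K`; applied to the coefficients of `f ∘ φ = f + h` they give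
`df(ξ) = x ^ β` after a composition with the inverse of `φ`, and a linear functional on `K` takes `ξ`
back to the ground field (`exists_infinitesimal_of_jets`).  As the polynomials vanishing on `X` form a
weighted homogeneous ideal, the component of `ξ` of the right weight satisfies the equation exactly
(`exists_homogeneous_field`).  It preserves all germs that vanish on `X`: such a germ agrees to any
order with a polynomial vanishing on `X`, so its derivative along `ξ` is flat at the origin on each
orbit of the weighted scaling in `X`, and hence zero there by analyticity
(`isTangentField_of_polynomial`).

**The vector field.**  Put `D = d + w₁ - w₂`.  By Hadamard's lemma `F - f` is a finite combination of
monomials of weight at least `D` with analytic coefficients (`exists_deformation_expansion`).  Fix a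
large number `c` and let `Γ` be a finite set of monomials of weight at least `c` such that each monomial
of weight at least `c` is divisible by one of them; choose fields `η_γ` with `df(η_γ) = x ^ γ` for
`γ ∈ Γ`.  The derivatives `dF_t(η_γ)` are again the monomials of `Γ`, up to a matrix which is analytic and invertible at the
origin (`exists_matrix_of_deformation`).  Suppose that `ρ` is a control function of order `2c`,
bounded below by a multiple of the weighted norm to the power `2c`, and of the form `∑ r_γ x ^ γ` with
`r_γ` of order `c`.  Then `ρ ∂F/∂t = dF_t(v)` with `v = ∑ b_γ η_γ` and `b_γ` of order `c + D`.  The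
component `j` of `η_γ` has order at least `c - d + W_j`, so `V = v / ρ` has order at least
`D - d + W_j ≥ w₁`, and its first derivatives are bounded: `V` is Lipschitz
(`HasOrder.lipschitzOnWith`, `stronglyRationalBiLipschitzTrivial_of_control`).

**The control function.**  The obvious candidate `∑ |xᵢ| ^ (2 c / Wᵢ)` may be reducible.  If `n ≥ 2`,
it is replaced by a function whose restriction to a real plane is
`(x ^ (2p) + y ^ (2q)) ^ m + x ^ (pm) μ + μ ^ 2`, where `q : p` is the ratio of the weights of the first
two variables in lowest terms and `μ = x ^ u y ^ v` is a monomial of weight `pqm + 1`, one more than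
the weight of `x ^ (pm)`.  In a factorization `g h` the lowest weighted components multiply to
`(x ^ (2p) + y ^ (2q)) ^ m`.  If both vanished on the curve `x ^ (2p) + y ^ (2q) = 0`, so would the next
component `x ^ (pm) μ` of the product, which is not the case.  But a factor of
`(x ^ (2p) + y ^ (2q)) ^ m` which does not vanish at one point `(ζ, 1)` of the curve vanishes at none
of them, by homogeneity and complex conjugation, and therefore is constant (`eq_zero_of_dvd_pow`,
`constantCoeff_ne_zero_of_factorization`).  In one complex variable the same argument applies to
`|z| ^ 2` with a perturbation in the real and imaginary part; here `f` is a multiple of a power of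
`z`, so `Γ` may consist of this power, with a multiple of the Euler field.
-/

namespace BiLipRX

/-! ### Generic points and derivations -/

open scoped TensorProduct in
/-- A derivation into a field extends along a formally smooth map. -/
theorem exists_derivation_extending {k R K : Type*} [Field k] [CommRing R] [Field K]
    [Algebra k R] [Algebra k K] [Algebra R K] [IsScalarTower k R K]
    [Algebra.FormallySmooth R K] (d : Derivation k R K) :
    ∃ D : Derivation k K K, ∀ r : R, D (algebraMap R K r) = d r := by
  -- Differentials extend injectively because the first cotangent homology of `K / R` vanishes.
  have hinj : Function.Injective (KaehlerDifferential.mapBaseChange k R K) := by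
    rw [← LinearMap.ker_eq_bot, eq_bot_iff]
    intro x hx
    obtain ⟨y, rfl⟩ := (Algebra.H1Cotangent.exact_δ_mapBaseChange k R K x).1 hx
    rw [Subsingleton.elim y 0, map_zero]
    exact Submodule.zero_mem _
  obtain ⟨g, hg⟩ := LinearMap.exists_leftInverse_of_injective _ (LinearMap.ker_eq_bot.2 hinj)
  let φ : K ⊗[R] Ω[R⁄k] →ₗ[K] K := LinearMap.liftBaseChange K d.liftKaehlerDifferential
  refine ⟨(φ.comp g).compDer (KaehlerDifferential.D k K), fun r => ?_⟩
  have h1 : KaehlerDifferential.D k K (algebraMap R K r)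
      = KaehlerDifferential.mapBaseChange k R K (1 ⊗ₜ KaehlerDifferential.D k R r) := by
    simp
  have h2 := LinearMap.congr_fun hg (1 ⊗ₜ KaehlerDifferential.D k R r)
  simp only [LinearMap.comp_apply, LinearMap.id_apply] at h2
  have h3 : φ (g (KaehlerDifferential.D k K (algebraMap R K r))) = d r := by
    rw [h1, h2]
    simp [φ]
  exact h3

/-- In characteristic zero, algebraically independent elements of a finitely generated field
extension admit derivations which act on them as the partial derivatives. -/
theorem exists_derivations_of_algebraicIndependent {k K ι : Type*} [Field k] [CharZero k] [Field K]
    [Algebra k K] [Algebra.EssFiniteType k K] [DecidableEq ι] (x : ι → K)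
    (hx : AlgebraicIndependent k x) :
    ∃ D : ι → Derivation k K K, ∀ i j, D i (x j) = if j = i then 1 else 0 := by
  let R := MvPolynomial ι k
  let _ : Algebra R K := (MvPolynomial.aeval x).toRingHom.toAlgebra
  have hmap : ∀ P : R, algebraMap R K P = MvPolynomial.aeval x P := fun _ => rfl
  have : IsScalarTower k R K := IsScalarTower.of_algebraMap_eq fun a => by
    rw [hmap, AlgHom.commutes]
  have : FaithfulSMul R K := (faithfulSMul_iff_algebraMap_injective R K).2 hx
  let L := FractionRing R
  let _ : Algebra L K := FractionRing.liftAlgebra R K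
  have : IsScalarTower R L K := FractionRing.isScalarTower_liftAlgebra R K
  have : IsScalarTower k L K := IsScalarTower.of_algebraMap_eq fun a => by
    rw [IsScalarTower.algebraMap_apply k R K, IsScalarTower.algebraMap_apply R L K,
      IsScalarTower.algebraMap_apply k R L]
  have : Algebra.EssFiniteType L K := Algebra.EssFiniteType.of_comp k L K
  have : CharZero L := charZero_of_injective_algebraMap (FaithfulSMul.algebraMap_injective k L)
  -- `K` is finitely generated and separable over `L`, hence formally smooth.
  have : Algebra.FormallySmooth L K := inferInstance
  have : Algebra.FormallySmooth R L := .of_isLocalization (nonZeroDivisors R)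
  have : Algebra.FormallySmooth R K := .comp R L K
  choose D hD using fun i => exists_derivation_extending (k := k) (R := R) (K := K)
    (MvPolynomial.mkDerivation k (fun j => if j = i then 1 else 0))
  refine ⟨D, fun i j => ?_⟩
  have h1 := hD i (MvPolynomial.X j)
  rw [hmap] at h1
  rw [MvPolynomial.aeval_X] at h1
  exact h1.trans (MvPolynomial.mkDerivation_X k _ _)

/-- Let `Z ⊆ k^(ι ⊕ κ)` project onto `k^ι`.  Then there is a point `z` of `Z` with coordinates in a
field extension `K` such that the first group of coordinates is independent: there are derivations
of `K` over `k` which act on these coordinates as the partial derivatives. -/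
theorem exists_generic_point.{u} {k : Type u} [Field k] [CharZero k] {ι κ : Type} [Finite ι] [Finite κ]
    [DecidableEq ι]
    (Z : Set (ι ⊕ κ → k)) (hZ : ∀ s : ι → k, ∃ z ∈ Z, ∀ i, z (Sum.inl i) = s i) :
    ∃ (K : Type u) (_ : Field K) (_ : Algebra k K) (z : ι ⊕ κ → K) (D : ι → Derivation k K K),
      (∀ P : MvPolynomial (ι ⊕ κ) k, (∀ y ∈ Z, MvPolynomial.eval y P = 0) →
        MvPolynomial.aeval z P = 0) ∧
      ∀ i j, D i (z (Sum.inl j)) = if j = i then 1 else 0 := by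
  classical
  let Y := MvPolynomial (ι ⊕ κ) k
  let R := MvPolynomial ι k
  let J : Ideal Y := ⨅ y ∈ Z, RingHom.ker (MvPolynomial.eval y)
  have hJ : ∀ P : Y, P ∈ J ↔ ∀ y ∈ Z, MvPolynomial.eval y P = 0 := fun P => by
    simp [J, Submodule.mem_iInf, RingHom.mem_ker]
  let inc : R →ₐ[k] Y := MvPolynomial.rename Sum.inl
  have hcomap : J.comap inc.toRingHom = ⊥ := by
    rw [eq_bot_iff]
    intro P hP
    rw [Ideal.mem_comap, hJ] at hP
    rw [Ideal.mem_bot]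
    apply MvPolynomial.funext
    intro s
    obtain ⟨z, hz, hzs⟩ := hZ s
    have := hP z hz
    have h2 : (z ∘ Sum.inl) = s := funext hzs
    change MvPolynomial.eval z (MvPolynomial.rename Sum.inl P) = 0 at this
    rw [MvPolynomial.eval_rename, h2] at this
    simpa using this
  -- A minimal prime over `J` that lies over zero: a component of `Z` which dominates `k^ι`.
  obtain ⟨Q, hQ, hJQ, hQc⟩ := Ideal.exists_comap_eq_of_mem_minimalPrimes (I := J)
    inc.toRingHom ⊥ (by
      rw [hcomap]
      have := IsDomain.minimalPrimes_eq_singleton_bot R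
      rw [minimalPrimes] at this
      simp [this])
  let K := FractionRing (Y ⧸ Q)
  let φ : Y →ₐ[k] K := (IsScalarTower.toAlgHom k (Y ⧸ Q) K).comp (Ideal.Quotient.mkₐ k Q)
  have hφ : ∀ P : Y, φ P = 0 ↔ P ∈ Q := fun P => by
    change algebraMap (Y ⧸ Q) K (Ideal.Quotient.mk Q P) = 0 ↔ _
    rw [map_eq_zero_iff _ (IsFractionRing.injective (Y ⧸ Q) K), Ideal.Quotient.eq_zero_iff_mem]
  have haeval : MvPolynomial.aeval (fun a => φ (MvPolynomial.X a)) = φ := by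
    ext a
    simp
  have hind : AlgebraicIndependent k fun i => φ (MvPolynomial.X (Sum.inl i)) := by
    rw [algebraicIndependent_iff]
    intro P hP
    have h1 : MvPolynomial.aeval (fun i => φ (MvPolynomial.X (Sum.inl i))) P = φ (inc P) := by
      have : MvPolynomial.aeval (fun i => φ (MvPolynomial.X (Sum.inl i))) = φ.comp inc := by
        ext i
        rw [MvPolynomial.aeval_X]
        exact (congrArg φ (MvPolynomial.rename_X Sum.inl i)).symm
      rw [this, AlgHom.comp_apply]
    rw [h1, hφ] at hP
    have : P ∈ Q.comap inc.toRingHom := hP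
    rwa [hQc] at this
  have : Algebra.EssFiniteType (Y ⧸ Q) K :=
    Algebra.EssFiniteType.of_isLocalization _ (nonZeroDivisors (Y ⧸ Q))
  have : Algebra.EssFiniteType k K := Algebra.EssFiniteType.comp k (Y ⧸ Q) K
  obtain ⟨D, hD⟩ := exists_derivations_of_algebraicIndependent _ hind
  refine ⟨K, inferInstance, inferInstance, fun a => φ (MvPolynomial.X a), D, fun P hP => ?_, hD⟩
  rw [haeval, hφ]
  exact hJQ ((hJ P).2 hP)

/-! ### Linear maps applied to coefficients -/

section Coefficients

open MvPolynomial

variable {k A B σ : Type*} [Field k] [CommRing A] [CommRing B] [Algebra k A] [Algebra k B]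

/-- The coefficientwise action of a linear map on polynomials. -/
noncomputable def mapCoeff (π : A →ₗ[k] B) : MvPolynomial σ A →ₗ[k] MvPolynomial σ B where
  toFun P := ∑ β ∈ P.support, monomial β (π (coeff β P))
  map_add' P Q := by
    classical
    ext γ
    simp only [coeff_add, coeff_sum, coeff_monomial, Finset.sum_ite_eq']
    have h : ∀ R : MvPolynomial σ A,
        (if γ ∈ R.support then π (coeff γ R) else 0) = π (coeff γ R) := fun R => by
      by_cases h1 : coeff γ R = 0 <;> simp [h1]
    rw [h P, h Q, ← map_add, ← coeff_add, h (P + Q)]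
  map_smul' c P := by
    classical
    ext γ
    simp only [coeff_smul, coeff_sum, coeff_monomial, Finset.sum_ite_eq', RingHom.id_apply]
    have h : ∀ R : MvPolynomial σ A,
        (if γ ∈ R.support then π (coeff γ R) else 0) = π (coeff γ R) := fun R => by
      by_cases h1 : coeff γ R = 0 <;> simp [h1]
    rw [h P, ← map_smul, ← coeff_smul, h (c • P)]

@[simp]
theorem coeff_mapCoeff (π : A →ₗ[k] B) (P : MvPolynomial σ A) (β : σ →₀ ℕ) :
    coeff β (mapCoeff π P) = π (coeff β P) := by
  classical
  change coeff β (∑ β ∈ P.support, monomial β (π (coeff β P))) = _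
  simp only [coeff_sum, coeff_monomial, Finset.sum_ite_eq']
  by_cases h1 : coeff β P = 0 <;> simp_all [mem_support_iff]

theorem mapCoeff_monomial (π : A →ₗ[k] B) (β : σ →₀ ℕ) (a : A) :
    mapCoeff π (monomial β a) = monomial β (π a) := by
  classical
  ext γ
  rw [coeff_mapCoeff, coeff_monomial, coeff_monomial]
  split_ifs <;> simp

theorem mapCoeff_monomial_mul (π : A →ₗ[k] B) (β : σ →₀ ℕ) (a : A) (P : MvPolynomial σ A) :
    mapCoeff π (monomial β a * P) = monomial β 1 * mapCoeff (π ∘ₗ LinearMap.mulLeft k a) P := by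
  classical
  ext γ
  rw [coeff_mapCoeff, coeff_monomial_mul', coeff_monomial_mul']
  split_ifs <;> simp

/-- A coefficientwise linear map is linear over the polynomials with coefficients in `k`. -/
theorem mapCoeff_map_mul (π : A →ₗ[k] B) (P : MvPolynomial σ k) (Q : MvPolynomial σ A) :
    mapCoeff π (MvPolynomial.map (algebraMap k A) P * Q) = MvPolynomial.map (algebraMap k B) P * mapCoeff π Q := by
  induction P using MvPolynomial.induction_on' with
  | add p q hp hq => simp only [map_add, add_mul, hp, hq]
  | monomial β c =>
    rw [map_monomial, map_monomial, mapCoeff_monomial_mul]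
    have : monomial β (algebraMap k B c) = c • monomial β (1 : B) := by
      rw [smul_monomial, Algebra.algebraMap_eq_smul_one]
    rw [this, smul_mul_assoc, ← mul_smul_comm]
    congr 1
    ext γ
    simp [Algebra.smul_def]
    rw [← Algebra.smul_def, map_smul, Algebra.smul_def]

theorem mapCoeff_map (π : A →ₗ[k] B) (P : MvPolynomial σ k) :
    mapCoeff π (MvPolynomial.map (algebraMap k A) P) = MvPolynomial.map (algebraMap k B) P * C (π 1) := by
  have := mapCoeff_map_mul π P 1
  rwa [mul_one, show (1 : MvPolynomial σ A) = monomial 0 1 from rfl, mapCoeff_monomial] at this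

/-- An element of an ideal extended from `k` stays in the ideal under coefficientwise functionals. -/
theorem mapCoeff_mem_of_mem_map (J : Ideal (MvPolynomial σ k)) {P : MvPolynomial σ A}
    (hP : P ∈ J.map (MvPolynomial.map (algebraMap k A))) (π : A →ₗ[k] k) : mapCoeff π P ∈ J := by
  induction hP using Submodule.span_induction generalizing π with
  | mem x hx =>
    obtain ⟨u, hu, rfl⟩ := hx
    rw [mapCoeff_map]
    simpa [MvPolynomial.map_id] using J.mul_mem_right (C (π 1)) hu
  | zero => simp
  | add x y _ _ hx hy => rw [map_add]; exact J.add_mem (hx π) (hy π)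
  | smul a x _ hx =>
    rw [smul_eq_mul]
    induction a using MvPolynomial.induction_on' with
    | add p q hp hq => rw [add_mul, map_add]; exact J.add_mem hp hq
    | monomial β c => rw [mapCoeff_monomial_mul]; exact J.mul_mem_left _ (hx _)

/-- Conversely, a polynomial all of whose coefficientwise functionals lie in `J` lies in the
extension of `J`. -/
theorem mem_map_of_mapCoeff_mem {K : Type*} [Field K] [Algebra k K]
    (J : Ideal (MvPolynomial σ k)) {P : MvPolynomial σ K}
    (hP : ∀ π : K →ₗ[k] k, mapCoeff π P ∈ J) : P ∈ J.map (MvPolynomial.map (algebraMap k K)) := by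
  classical
  let b := Module.Basis.ofVectorSpace k K
  let T := P.support.biUnion fun β => (b.repr (coeff β P)).support
  have hPT : P = ∑ i ∈ T, C (b i) * MvPolynomial.map (algebraMap k K) (mapCoeff (b.coord i) P) := by
    ext β
    simp only [coeff_sum, coeff_C_mul, coeff_map, coeff_mapCoeff, Module.Basis.coord_apply]
    have h1 := b.linearCombination_repr (coeff β P)
    rw [Finsupp.linearCombination_apply, Finsupp.sum_of_support_subset (s := T)] at h1
    · conv_lhs => rw [← h1]
      exact Finset.sum_congr rfl fun i _ => by rw [Algebra.smul_def, mul_comm]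
    · intro i hi
      by_cases h0 : coeff β P = 0
      · simp [h0] at hi
      · exact Finset.mem_biUnion.2 ⟨β, mem_support_iff.2 h0, hi⟩
    · simp
  rw [hPT]
  exact Ideal.sum_mem _ fun i _ => Ideal.mul_mem_left _ _ (Ideal.mem_map_of_mem _ (hP _))

/-- A family of polynomials which lies in `J` at all points of `Z` lies in the extension of `J` at a
generic point of `Z`. -/
theorem map_aeval_mem_of_forall_mem {K τ : Type*} [Field K] [Algebra k K] (Z : Set (τ → k))
    (z : τ → K)
    (hz : ∀ P : MvPolynomial τ k, (∀ y ∈ Z, eval y P = 0) → aeval z P = 0)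
    (J : Ideal (MvPolynomial σ k)) (P : MvPolynomial σ (MvPolynomial τ k))
    (hP : ∀ y ∈ Z, MvPolynomial.map (eval y) P ∈ J) :
    MvPolynomial.map (aeval z : MvPolynomial τ k →ₐ[k] K).toRingHom P ∈ J.map (MvPolynomial.map (algebraMap k K)) := by
  apply mem_map_of_mapCoeff_mem
  intro π
  by_contra hcon
  obtain ⟨L, hL, hLJ⟩ := Submodule.exists_le_ker_of_notMem (p := J.restrictScalars k) hcon
  have hsum : ∀ Q : MvPolynomial σ k, Q.support ⊆ P.support →
      L Q = ∑ β ∈ P.support, coeff β Q * L (monomial β 1) := by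
    intro Q hQ
    conv_lhs => rw [Q.as_sum, map_sum]
    rw [Finset.sum_subset hQ]
    · refine Finset.sum_congr rfl fun β _ => ?_
      rw [← mul_one (coeff β Q), ← smul_eq_mul, ← smul_monomial, map_smul]
      simp
    · intro β _ hβ
      rw [notMem_support_iff.1 hβ]
      simp
  have h1 := hz (∑ β ∈ P.support, coeff β P * C (L (monomial β 1))) (fun y hy => by
    have h2 : L (MvPolynomial.map (eval y) P) = 0 := hLJ (hP y hy)
    rw [hsum _ (support_map_subset _ _)] at h2
    simpa [coeff_map] using h2)
  apply hL
  rw [hsum]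
  · have h3 := congrArg π h1
    rw [map_sum, map_sum, map_zero] at h3
    rw [← h3]
    refine Finset.sum_congr rfl fun β _ => ?_
    rw [coeff_mapCoeff, coeff_map, map_mul, algHom_C, mul_comm (aeval z (coeff β P)),
      ← Algebra.smul_def, map_smul, smul_eq_mul, mul_comm]
    rfl
  · intro β hβ
    rw [mem_support_iff, coeff_mapCoeff, coeff_map] at hβ
    rw [mem_support_iff]
    intro h0
    simp [h0] at hβ

end Coefficients

/-! ### From jets of coordinate changes to vector fields -/

section Jets

open MvPolynomial

variable {σ : Type}

/-- Substituting polynomials without constant term preserves the order of vanishing. -/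
theorem bind₁_mem_pow_idealOfVars {A : Type*} [CommRing A] {Φ : σ → MvPolynomial σ A}
    (hΦ : ∀ i, Φ i ∈ idealOfVars σ A) {N : ℕ} {P : MvPolynomial σ A}
    (hP : P ∈ idealOfVars σ A ^ N) : bind₁ Φ P ∈ idealOfVars σ A ^ N := by
  have h1 : (idealOfVars σ A).map (bind₁ Φ) ≤ idealOfVars σ A := by
    rw [Ideal.map_span, Ideal.span_le]
    rintro _ ⟨_, ⟨i, rfl⟩, rfl⟩
    simpa using hΦ i
  have h2 := Ideal.mem_map_of_mem (bind₁ Φ) hP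
  rw [Ideal.map_pow] at h2
  exact Ideal.pow_right_mono h1 N h2

/-- Substituting congruent polynomials gives congruent polynomials. -/
theorem bind₁_sub_mem {A : Type*} [CommRing A] {J : Ideal (MvPolynomial σ A)}
    {Φ Ψ : σ → MvPolynomial σ A} (h : ∀ i, Φ i - Ψ i ∈ J) (P : MvPolynomial σ A) :
    bind₁ Φ P - bind₁ Ψ P ∈ J := by
  have h1 : (Ideal.Quotient.mkₐ A J).comp (bind₁ Φ) = (Ideal.Quotient.mkₐ A J).comp (bind₁ Ψ) := by
    ext i
    simpa using Ideal.Quotient.eq.2 (h i)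
  have h2 := DFunLike.congr_fun h1 P
  simp only [AlgHom.comp_apply, Ideal.Quotient.mkₐ_eq_mk] at h2
  exact Ideal.Quotient.eq.1 h2

theorem map_mem_pow_idealOfVars {A B : Type*} [CommRing A] [CommRing B] (g : A →+* B) {N : ℕ}
    {P : MvPolynomial σ A} (hP : P ∈ idealOfVars σ A ^ N) :
    MvPolynomial.map g P ∈ idealOfVars σ B ^ N := by
  rw [mem_pow_idealOfVars_iff'] at hP ⊢
  intro x hx
  rw [coeff_map, hP x hx, map_zero]

theorem mapCoeff_mem_pow_idealOfVars {k A B : Type*} [Field k] [CommRing A] [CommRing B]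
    [Algebra k A] [Algebra k B] (π : A →ₗ[k] B) {N : ℕ}
    {P : MvPolynomial σ A} (hP : P ∈ idealOfVars σ A ^ N) :
    mapCoeff π P ∈ idealOfVars σ B ^ N := by
  rw [mem_pow_idealOfVars_iff'] at hP ⊢
  intro x hx
  rw [coeff_mapCoeff, hP x hx, map_zero]

section Derivation

variable {k K : Type*} [Field k] [Field K] [Algebra k K] (D : Derivation k K K)

/-- A derivation of the coefficients is a derivation of the polynomial ring. -/
theorem mapCoeff_derivation_mul (P Q : MvPolynomial σ K) :
    mapCoeff (D : K →ₗ[k] K) (P * Q)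
      = P * mapCoeff (D : K →ₗ[k] K) Q + Q * mapCoeff (D : K →ₗ[k] K) P := by
  induction P using MvPolynomial.induction_on' with
  | add p q hp hq => simp only [map_add, add_mul, mul_add, hp, hq]; ring
  | monomial β c =>
    induction Q using MvPolynomial.induction_on' with
    | add p q hp hq => simp only [map_add, add_mul, mul_add, hp, hq]; ring
    | monomial γ d =>
      simp only [monomial_mul, mapCoeff_monomial, Derivation.coeFn_coe, Derivation.leibniz,
        smul_eq_mul, map_add, add_comm γ β]

/-- A derivation over `k` preserves the ideals which are defined over `k`. -/
theorem mapCoeff_derivation_mem (J : Ideal (MvPolynomial σ k)) {P : MvPolynomial σ K}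
    (hP : P ∈ J.map (MvPolynomial.map (algebraMap k K))) :
    mapCoeff (D : K →ₗ[k] K) P ∈ J.map (MvPolynomial.map (algebraMap k K)) := by
  induction hP using Submodule.span_induction with
  | mem x hx =>
    obtain ⟨u, hu, rfl⟩ := hx
    rw [mapCoeff_map]
    simp
  | zero => simp
  | add x y _ _ hx hy => rw [map_add]; exact Ideal.add_mem _ hx hy
  | smul a x hx h =>
    rw [smul_eq_mul, mapCoeff_derivation_mul]
    exact Ideal.add_mem _ (Ideal.mul_mem_left _ _ h) (Ideal.mul_mem_right _ _ hx)

variable [Fintype σ]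

/-- The chain rule for a coefficientwise derivation. -/
theorem mapCoeff_derivation_bind₁ (Φ : σ → MvPolynomial σ K) (u : MvPolynomial σ k) :
    mapCoeff (D : K →ₗ[k] K) (bind₁ Φ (MvPolynomial.map (algebraMap k K) u))
      = ∑ j, bind₁ Φ (MvPolynomial.map (algebraMap k K) (pderiv j u))
          * mapCoeff (D : K →ₗ[k] K) (Φ j) := by
  classical
  induction u using MvPolynomial.induction_on with
  | C a =>
    simp only [map_C, bind₁_C_right, pderiv_C, map_zero, zero_mul, Finset.sum_const_zero]
    rw [show (C (algebraMap k K a) : MvPolynomial σ K) = monomial 0 (algebraMap k K a) from rfl,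
      mapCoeff_monomial]
    simp
  | add p q hp hq => simp only [map_add, add_mul, Finset.sum_add_distrib, hp, hq]
  | mul_X p i hp =>
    simp only [map_mul, map_X, bind₁_X_right, mapCoeff_derivation_mul, hp, pderiv_mul, pderiv_X,
      map_add, add_mul, Finset.sum_add_distrib, Finset.mul_sum]
    rw [add_comm]
    congr 1
    · exact Finset.sum_congr rfl fun j _ => by ring
    · rw [Finset.sum_eq_single i]
      · simp
      · intro j _ hj
        simp [hj.symm]
      · simp

end Derivation

/-- If all perturbations of `f` of order `> N` are equivalent to `f` on the level of `l`-jets, by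
jets of coordinate changes which preserve the ideal `I`, then every polynomial of order `> N` is, up
to order `l`, the derivative of `f` along a vector field which preserves `I` up to order `l`.

The jets of the coordinate changes depend on the perturbation in an arbitrary way.  At a generic
point of the set of all pairs (perturbation, coordinate change), however, the coordinate change can
be differentiated with respect to the coefficients of the perturbation. -/
theorem exists_infinitesimal_of_jets.{u} [Fintype σ] {k : Type u} [Field k] [CharZero k]
    (f : MvPolynomial σ k) (I : Ideal (MvPolynomial σ k)) (N l : ℕ)
    (H : ∀ h ∈ idealOfVars σ k ^ (N + 1), ∃ Φ Ψ : σ → MvPolynomial σ k,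
      (∀ i, ∀ β ∈ (Φ i).support, β ≠ 0 ∧ β.degree ≤ l) ∧
      (∀ i, ∀ β ∈ (Ψ i).support, β ≠ 0 ∧ β.degree ≤ l) ∧
      bind₁ Φ f - (f + h) ∈ idealOfVars σ k ^ (l + 1) ∧
      (∀ u ∈ I, bind₁ Φ u ∈ I ⊔ idealOfVars σ k ^ (l + 1)) ∧
      (∀ u ∈ I, bind₁ Ψ u ∈ I ⊔ idealOfVars σ k ^ (l + 1)) ∧
      (∀ i, bind₁ Ψ (Φ i) - X i ∈ idealOfVars σ k ^ (l + 1)) ∧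
      (∀ i, bind₁ Φ (Ψ i) - X i ∈ idealOfVars σ k ^ (l + 1)))
    (h : MvPolynomial σ k) (hh : h ∈ idealOfVars σ k ^ (N + 1)) :
    ∃ ξ : σ → MvPolynomial σ k,
      ∑ j, pderiv j f * ξ j - h ∈ idealOfVars σ k ^ (l + 1) ∧
      ∀ u ∈ I, ∑ j, pderiv j u * ξ j ∈ I ⊔ idealOfVars σ k ^ (l + 1) := by
  classical
  -- The parameters are the coefficients of the perturbation, the unknowns those of `Φ` and `Ψ`.
  let ι := {β : σ →₀ ℕ // N + 1 ≤ β.degree ∧ β.degree ≤ l}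
  let S := {β : σ →₀ ℕ // β ≠ 0 ∧ β.degree ≤ l}
  let κ := Bool × σ × S
  have hfin : Finite {β : σ →₀ ℕ // β.degree ≤ l} := (Finsupp.finite_of_degree_le l).to_subtype
  have : Finite ι := Finite.of_injective (β := {β : σ →₀ ℕ // β.degree ≤ l})
    (fun β => ⟨β.1, β.2.2⟩) fun a b hab => Subtype.ext (Subtype.mk.inj hab)
  have : Finite S := Finite.of_injective (β := {β : σ →₀ ℕ // β.degree ≤ l})
    (fun β => ⟨β.1, β.2.2⟩) fun a b hab => Subtype.ext (Subtype.mk.inj hab)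
  let _ : Fintype ι := Fintype.ofFinite ι
  let _ : Fintype S := Fintype.ofFinite S
  -- `G true` and `G false` are the universal `Φ` and `Ψ`, and `g` is the universal perturbation.
  let Y := MvPolynomial (ι ⊕ κ) k
  let G : Bool → σ → MvPolynomial σ Y := fun b i =>
    ∑ β : S, monomial β.1 (X (Sum.inr (b, i, β)))
  let g : MvPolynomial σ Y := ∑ β : ι, monomial β.1 (X (Sum.inl β))
  let J := I ⊔ idealOfVars σ k ^ (l + 1)
  let E : MvPolynomial σ k → MvPolynomial σ Y := MvPolynomial.map C
  let Pf : MvPolynomial σ Y := bind₁ (G true) (E f) - (E f + g)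
  let PI : Bool → MvPolynomial σ k → MvPolynomial σ Y := fun b u => bind₁ (G b) (E u)
  let Pinv : Bool → σ → MvPolynomial σ Y := fun b i => bind₁ (G (!b)) (G b i) - X i
  -- The values of the parameters and unknowns for which all the required relations hold.
  let Z : Set (ι ⊕ κ → k) := {z |
    MvPolynomial.map (eval z) Pf ∈ idealOfVars σ k ^ (l + 1) ∧
    (∀ b, ∀ u ∈ I, MvPolynomial.map (eval z) (PI b u) ∈ J) ∧
    (∀ b i, MvPolynomial.map (eval z) (Pinv b i) ∈ idealOfVars σ k ^ (l + 1))}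
  have heX : ∀ (z : ι ⊕ κ → k) a, eval z (X a : Y) = z a := fun z a => eval_X a
  have hEz : ∀ (z : ι ⊕ κ → k) u, MvPolynomial.map (eval z) (E u) = u := by
    intro z u
    have : (eval z).comp (C : k →+* Y) = RingHom.id k := by ext a; simp
    simp only [E, MvPolynomial.map_map, this, MvPolynomial.map_id]
  have hmG : ∀ {A : Type u} [CommRing A] (θ : Y →+* A) b i, MvPolynomial.map θ (G b i)
      = ∑ β : S, monomial β.1 (θ (X (Sum.inr (b, i, β)))) := fun θ b i => by
    simp [G, map_sum, map_monomial]
  have hmg : ∀ {A : Type u} [CommRing A] (θ : Y →+* A), MvPolynomial.map θ g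
      = ∑ β : ι, monomial β.1 (θ (X (Sum.inl β))) := fun θ => by
    simp [g, map_sum, map_monomial]
  have hZ : ∀ s : ι → k, ∃ z ∈ Z, ∀ i, z (Sum.inl i) = s i := by
    intro s
    obtain ⟨Φ, Ψ, hΦ, hΨ, h1, h2, h3, h4, h5⟩ := H (∑ β : ι, monomial β.1 (s β)) (by
      refine Ideal.sum_mem _ fun β _ => ?_
      rw [mem_pow_idealOfVars_iff']
      intro x hx
      rw [coeff_monomial, if_neg]
      rintro rfl
      have := β.2.1
      omega)
    let z : ι ⊕ κ → k := Sum.elim s fun a => coeff a.2.2.1 (if a.1 then Φ a.2.1 else Ψ a.2.1)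
    have key : ∀ P : MvPolynomial σ k, (∀ β ∈ P.support, β ≠ 0 ∧ β.degree ≤ l) →
        ∑ β : S, monomial β.1 (coeff β.1 P) = P := by
      intro P hP
      ext γ
      simp only [coeff_sum, coeff_monomial]
      by_cases hγ : γ ≠ 0 ∧ γ.degree ≤ l
      · rw [Finset.sum_eq_single (⟨γ, hγ⟩ : S)]
        · simp
        · intro b _ hb
          rw [if_neg]
          rintro rfl
          exact hb rfl
        · simp
      · rw [notMem_support_iff.1 fun h => hγ (hP γ h)]
        refine Finset.sum_eq_zero fun b _ => ?_
        rw [if_neg]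
        rintro rfl
        exact hγ b.2
    have hzΦ : (fun i => MvPolynomial.map (eval z) (G true i)) = Φ := by
      funext i
      rw [hmG, ← key _ (hΦ i)]
      simp only [heX]
      simp [z, key _ (hΦ i)]
    have hzΨ : (fun i => MvPolynomial.map (eval z) (G false i)) = Ψ := by
      funext i
      rw [hmG, ← key _ (hΨ i)]
      simp only [heX]
      simp [z, key _ (hΨ i)]
    refine ⟨z, ⟨?_, ?_, ?_⟩, fun i => rfl⟩
    · simp only [Pf, map_sub, map_add, map_bind₁, hEz, hzΦ, hmg, heX]
      simpa [z] using h1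
    · intro b u hu
      cases b
      · simp only [PI, map_bind₁, hEz, hzΨ]
        exact h3 u hu
      · simp only [PI, map_bind₁, hEz, hzΦ]
        exact h2 u hu
    · intro b i
      cases b
      · simp only [Pinv, map_sub, map_bind₁, Bool.not_false, hzΦ, map_X]
        rw [show MvPolynomial.map (eval z) (G false i) = Ψ i from congrFun hzΨ i]
        exact h5 i
      · simp only [Pinv, map_sub, map_bind₁, Bool.not_true, hzΨ, map_X]
        rw [show MvPolynomial.map (eval z) (G true i) = Φ i from congrFun hzΦ i]
        exact h4 i
  -- The relations remain true at the generic point.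
  obtain ⟨K, _, _, z, D, hzZ, hD⟩ := exists_generic_point Z hZ
  let θ : Y →+* K := (aeval z : Y →ₐ[k] K).toRingHom
  have hθX : ∀ a, θ (X a : Y) = z a := fun a => aeval_X z a
  let m : MvPolynomial σ k → MvPolynomial σ K := MvPolynomial.map (algebraMap k K)
  let JK : Ideal (MvPolynomial σ K) := J.map (MvPolynomial.map (algebraMap k K))
  have htr := fun J' P => map_aeval_mem_of_forall_mem (σ := σ) Z z hzZ J' P
  have hpow : (idealOfVars σ k ^ (l + 1)).map (MvPolynomial.map (algebraMap k K))
      = idealOfVars σ K ^ (l + 1) := by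
    rw [Ideal.map_pow, idealOfVars, Ideal.map_span, ← Set.range_comp]
    congr 3
    funext i
    simp
  have hJK : idealOfVars σ K ^ (l + 1) ≤ JK := by
    rw [← hpow]
    exact Ideal.map_mono le_sup_right
  have hEθ : ∀ u, MvPolynomial.map θ (E u) = m u := by
    intro u
    have : θ.comp (C : k →+* Y) = algebraMap k K := by
      ext a
      exact aeval_C z a
    simp only [E, MvPolynomial.map_map, this, m]
  let F : Bool → σ → MvPolynomial σ K := fun b i => MvPolynomial.map θ (G b i)
  have hF0 : ∀ b i, F b i ∈ idealOfVars σ K := by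
    intro b i
    simp only [F, hmG]
    refine Ideal.sum_mem _ fun β _ => ?_
    rw [← pow_one (idealOfVars σ K), mem_pow_idealOfVars_iff']
    intro x hx
    rw [coeff_monomial, if_neg]
    rintro rfl
    have := β.2.1
    simp only [Nat.lt_one_iff, Finsupp.degree_eq_zero_iff] at hx
    exact this hx
  have ha : bind₁ (F true) (m f) - (m f + ∑ β : ι, monomial β.1 (z (Sum.inl β)))
      ∈ idealOfVars σ K ^ (l + 1) := by
    have := htr _ Pf fun y hy => hy.1
    rw [hpow] at this
    have h2 : MvPolynomial.map θ Pf ∈ idealOfVars σ K ^ (l + 1) := this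
    simp only [Pf, map_sub, map_add, map_bind₁, hEθ, hmg] at h2
    simp only [hθX] at h2
    exact h2
  have hb : ∀ b, ∀ u ∈ I, bind₁ (F b) (m u) ∈ JK := by
    intro b u hu
    have h2 : MvPolynomial.map θ (PI b u) ∈ JK := htr J (PI b u) fun y hy => hy.2.1 b u hu
    simpa only [PI, map_bind₁, hEθ] using h2
  have hc : ∀ b i, bind₁ (F (!b)) (F b i) - X i ∈ idealOfVars σ K ^ (l + 1) := by
    intro b i
    have := htr _ (Pinv b i) fun y hy => hy.2.2 b i
    rw [hpow] at this
    have h2 : MvPolynomial.map θ (Pinv b i) ∈ idealOfVars σ K ^ (l + 1) := this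
    simpa only [Pinv, map_sub, map_bind₁, map_X] using h2
  -- Substituting `Ψ` maps the ideals into themselves.
  have hΨJ : ∀ P ∈ JK, bind₁ (F false) P ∈ JK := by
    have : JK ≤ JK.comap (bind₁ (F false)) := by
      rw [Ideal.map_le_iff_le_comap]
      intro u hu
      obtain ⟨u1, hu1, u2, hu2, rfl⟩ := Submodule.mem_sup.1 hu
      change bind₁ (F false) (m (u1 + u2)) ∈ JK
      simp only [m, map_add]
      exact Ideal.add_mem _ (hb false u1 hu1)
        (hJK (bind₁_mem_pow_idealOfVars (hF0 false) (map_mem_pow_idealOfVars _ hu2)))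
    exact fun P hP => this hP
  have hcomp : ∀ P, bind₁ (F false) (bind₁ (F true) P) - P ∈ idealOfVars σ K ^ (l + 1) := by
    intro P
    rw [bind₁_bind₁]
    have := bind₁_sub_mem (J := idealOfVars σ K ^ (l + 1)) (hc true) P
    simpa using this
  -- The velocity of `Φ` with respect to the coefficient of `x ^ β`, moved back by `Ψ`.
  let ξ : ι → σ → MvPolynomial σ K := fun β j =>
    bind₁ (F false) (mapCoeff (D β : K →ₗ[k] K) (F true j))
  have hdiff : ∀ β u, bind₁ (F false) (mapCoeff (D β : K →ₗ[k] K) (bind₁ (F true) (m u)))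
      - ∑ j, m (pderiv j u) * ξ β j ∈ idealOfVars σ K ^ (l + 1) := by
    intro β u
    rw [mapCoeff_derivation_bind₁, map_sum, ← Finset.sum_sub_distrib]
    refine Ideal.sum_mem _ fun j _ => ?_
    rw [map_mul, ← sub_mul]
    exact Ideal.mul_mem_right _ _ (hcomp _)
  have hξI : ∀ β, ∀ u ∈ I, ∑ j, m (pderiv j u) * ξ β j ∈ JK := by
    intro β u hu
    have h1 := hΨJ _ (mapCoeff_derivation_mem (D β) J (hb true u hu))
    have h2 := Ideal.sub_mem _ h1 (hJK (hdiff β u))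
    rwa [sub_sub_cancel] at h2
  have hξf : ∀ β : ι, ∑ j, m (pderiv j f) * ξ β j - bind₁ (F false) (monomial β.1 1)
      ∈ idealOfVars σ K ^ (l + 1) := by
    intro β
    have h1 := bind₁_mem_pow_idealOfVars (hF0 false)
      (mapCoeff_mem_pow_idealOfVars (D β : K →ₗ[k] K) ha)
    have h2 : mapCoeff (D β : K →ₗ[k] K) (m f) = 0 := by
      simp only [m]
      rw [mapCoeff_map]
      simp
    have h3 : mapCoeff (D β : K →ₗ[k] K) (∑ γ : ι, monomial γ.1 (z (Sum.inl γ)))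
        = monomial β.1 1 := by
      rw [map_sum]
      simp only [mapCoeff_monomial, Derivation.coeFn_coe, hD]
      rw [Finset.sum_eq_single β]
      · simp
      · intro γ _ hγ
        simp [hγ]
      · simp
    rw [map_sub, map_add, h2, h3, zero_add, map_sub] at h1
    have h4 := Ideal.sub_mem _ h1 (hdiff β f)
    rwa [sub_sub_sub_cancel_left] at h4
  -- The substituted monomials span all polynomials of order `> N`.
  let c : ι → K := fun β => coeff β.1 (bind₁ (F true) (m h))
  have hspan : m h - ∑ β : ι, C (c β) * bind₁ (F false) (monomial β.1 1)
      ∈ idealOfVars σ K ^ (l + 1) := by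
    have h1 : bind₁ (F true) (m h) - ∑ β : ι, C (c β) * monomial β.1 1
        ∈ idealOfVars σ K ^ (l + 1) := by
      rw [mem_pow_idealOfVars_iff']
      intro x hx
      have h2 : bind₁ (F true) (m h) ∈ idealOfVars σ K ^ (N + 1) :=
        bind₁_mem_pow_idealOfVars (hF0 true) (map_mem_pow_idealOfVars _ hh)
      rw [mem_pow_idealOfVars_iff'] at h2
      simp only [coeff_sub, coeff_sum, coeff_C_mul, coeff_monomial]
      by_cases hxN : N + 1 ≤ x.degree
      · rw [Finset.sum_eq_single (⟨x, hxN, by omega⟩ : ι)]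
        · simp [c]
        · intro b _ hb
          rw [if_neg, mul_zero]
          rintro rfl
          exact hb rfl
        · simp
      · rw [h2 x (by omega), Finset.sum_eq_zero, sub_zero]
        intro b _
        rw [if_neg, mul_zero]
        rintro rfl
        exact hxN b.2.1
    have h2 := Ideal.sub_mem _ (bind₁_mem_pow_idealOfVars (hF0 false) h1) (hcomp (m h))
    rw [map_sub, map_sum, sub_sub_sub_cancel_left] at h2
    simpa only [map_mul, algHom_C, algebraMap_eq] using h2
  -- A functional on `K` that maps `1` to `1` takes the vector field back to `k`.
  obtain ⟨π, hπ⟩ := LinearMap.exists_leftInverse_of_injective (Algebra.linearMap k K)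
    (LinearMap.ker_eq_bot.2 (algebraMap k K).injective)
  have hπ1 : π 1 = 1 := by
    simpa using LinearMap.congr_fun hπ 1
  have hπm : ∀ u, mapCoeff π (m u) = u := fun u => by
    simp only [m]
    rw [mapCoeff_map, hπ1]
    simp [MvPolynomial.map_id]
  have hπmul : ∀ u (ζ : σ → MvPolynomial σ K), mapCoeff π (∑ j, m (pderiv j u) * ζ j)
      = ∑ j, pderiv j u * mapCoeff π (ζ j) := by
    intro u ζ
    rw [map_sum]
    refine Finset.sum_congr rfl fun j _ => ?_
    simp only [m]
    rw [mapCoeff_map_mul]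
    simp [MvPolynomial.map_id]
  have hswap : ∀ u, ∑ j, m (pderiv j u) * (∑ β : ι, C (c β) * ξ β j)
      = ∑ β : ι, C (c β) * ∑ j, m (pderiv j u) * ξ β j := by
    intro u
    simp only [Finset.mul_sum]
    rw [Finset.sum_comm]
    exact Finset.sum_congr rfl fun _ _ => Finset.sum_congr rfl fun _ _ => by ring
  refine ⟨fun j => mapCoeff π (∑ β : ι, C (c β) * ξ β j), ?_, fun u hu => ?_⟩
  · rw [← hπmul, hswap]
    conv => enter [2, 2]; rw [← hπm h]
    rw [← map_sub]
    apply mapCoeff_mem_pow_idealOfVars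
    have h1 : ∑ β : ι, C (c β) * (∑ j, m (pderiv j f) * ξ β j - bind₁ (F false) (monomial β.1 1))
        ∈ idealOfVars σ K ^ (l + 1) :=
      Ideal.sum_mem _ fun β _ => Ideal.mul_mem_left _ _ (hξf β)
    have h2 := Ideal.sub_mem _ h1 hspan
    simp only [mul_sub, Finset.sum_sub_distrib] at h2
    simpa only [sub_sub_sub_cancel_right, sub_sub, add_sub_cancel] using h2
  · rw [← hπmul, hswap]
    apply mapCoeff_mem_of_mem_map J
    exact Ideal.sum_mem _ fun β _ => Ideal.mul_mem_left _ _ (hξI β u hu)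

end Jets

/-! ### Weighted homogeneous components of vector fields -/

section Graded

open MvPolynomial

variable {k σ : Type*} [Field k]

theorem weightedHomogeneousComponent_mul_right (W : σ → ℕ) (P : MvPolynomial σ k)
    {Q : MvPolynomial σ k} {b : ℕ} (hQ : IsWeightedHomogeneous W Q b) (a : ℕ) :
    weightedHomogeneousComponent W (a + b) (P * Q) = weightedHomogeneousComponent W a P * Q := by
  induction P using MvPolynomial.induction_on' with
  | add p q hp hq => rw [add_mul, map_add, map_add, hp, hq, add_mul]
  | monomial β c =>
    have h1 := isWeightedHomogeneous_monomial W β c rfl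
    by_cases h : Finsupp.weight W β = a
    · rw [h] at h1
      rw [(h1.mul hQ).weightedHomogeneousComponent_same, h1.weightedHomogeneousComponent_same]
    · rw [(h1.mul hQ).weightedHomogeneousComponent_ne _ (by omega),
        h1.weightedHomogeneousComponent_ne _ (Ne.symm h), zero_mul]

theorem sum_range_weightedHomogeneousComponent (W : σ → ℕ) (P : MvPolynomial σ k) {M : ℕ}
    (hM : ∀ β ∈ P.support, Finsupp.weight W β < M) :
    ∑ e ∈ Finset.range M, weightedHomogeneousComponent W e P = P := by
  classical
  ext β
  simp only [coeff_sum, coeff_weightedHomogeneousComponent, Finset.sum_ite_eq, Finset.mem_range]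
  split_ifs with h
  · rfl
  · exact (notMem_support_iff.1 fun h' => h (hM β h')).symm

theorem exists_weight_bound (W : σ → ℕ) (P : MvPolynomial σ k) :
    ∃ M, ∀ β ∈ P.support, Finsupp.weight W β < M :=
  ⟨weightedTotalDegree W P + 1, fun _ hβ => Nat.lt_succ_of_le (le_weightedTotalDegree W hβ)⟩

theorem degree_le_weight {W : σ → ℕ} (hW : ∀ i, 0 < W i) (β : σ →₀ ℕ) :
    β.degree ≤ Finsupp.weight W β := by
  rw [Finsupp.degree_apply, Finsupp.weight_apply, Finsupp.sum]
  exact Finset.sum_le_sum fun i _ => by simpa using Nat.le_mul_of_pos_right _ (hW i)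

theorem weight_le_degree_mul {W : σ → ℕ} {w₁ : ℕ} (hW : ∀ i, W i ≤ w₁) (β : σ →₀ ℕ) :
    Finsupp.weight W β ≤ β.degree * w₁ := by
  rw [Finsupp.degree_apply, Finsupp.weight_apply, Finsupp.sum, Finset.sum_mul]
  exact Finset.sum_le_sum fun i _ => by simpa using Nat.mul_le_mul_left _ (hW i)

/-- If the derivation along a field maps the generators of an ideal into the ideal, then it maps the
whole ideal into itself. -/
theorem sum_pderiv_mul_mem_span [Fintype σ] {I : Ideal (MvPolynomial σ k)}
    {T : Set (MvPolynomial σ k)} (hT : I = Ideal.span T) (η : σ → MvPolynomial σ k)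
    (h : ∀ u ∈ T, ∑ j, pderiv j u * η j ∈ I) {u : MvPolynomial σ k} (hu : u ∈ I) :
    ∑ j, pderiv j u * η j ∈ I := by
  have hu' := hu
  rw [hT] at hu
  clear hu'
  induction hu using Submodule.span_induction with
  | mem x hx => exact h x hx
  | zero => simp
  | add x y _ _ hx hy =>
    simp only [map_add, add_mul, Finset.sum_add_distrib]
    exact I.add_mem hx hy
  | smul a x hx hh =>
    have hx' : x ∈ I := by rw [hT]; exact hx
    have : ∑ j, pderiv j (a • x) * η j
        = x * (∑ j, pderiv j a * η j) + a * ∑ j, pderiv j x * η j := by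
      rw [Finset.mul_sum, Finset.mul_sum, ← Finset.sum_add_distrib]
      refine Finset.sum_congr rfl fun j _ => ?_
      rw [smul_eq_mul, pderiv_mul]
      ring
    rw [this]
    exact I.add_mem (I.mul_mem_right _ hx') (I.mul_mem_left _ hh)

/-- For a weighted homogeneous polynomial `f` and a weighted homogeneous ideal `I`, a monomial which
to arbitrarily high order is a derivative of `f` along fields preserving `I` is exactly such a
derivative: take the component of the field of the weight that matters. -/
theorem exists_homogeneous_field [Fintype σ] {W : σ → ℕ} (hW : ∀ i, 0 < W i)
    {f : MvPolynomial σ k} {d : ℕ} (hf : IsWeightedHomogeneous W f d)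
    {I : Ideal (MvPolynomial σ k)}
    (hI : ∀ P ∈ I, ∀ e, weightedHomogeneousComponent W e P ∈ I)
    (β : σ →₀ ℕ) (hβ : d ≤ Finsupp.weight W β)
    (H : ∀ l : ℕ, ∃ ξ : σ → MvPolynomial σ k,
      ∑ j, pderiv j f * ξ j - monomial β 1 ∈ idealOfVars σ k ^ (l + 1) ∧
      ∀ u ∈ I, ∑ j, pderiv j u * ξ j ∈ I ⊔ idealOfVars σ k ^ (l + 1)) :
    ∃ η : σ → MvPolynomial σ k,
      ∑ j, pderiv j f * η j = monomial β 1 ∧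
      (∀ u ∈ I, ∑ j, pderiv j u * η j ∈ I) ∧
      ∀ j, IsWeightedHomogeneous W (η j) (Finsupp.weight W β - d + W j) := by
  obtain ⟨T, hT⟩ := (isNoetherianRing_iff_ideal_fg _).1 inferInstance I
  choose M hM using exists_weight_bound W (k := k)
  let M₀ := T.sup M
  let a := Finsupp.weight W β - d
  obtain ⟨ξ, h1, h2⟩ := H (M₀ + a + Finsupp.weight W β)
  -- `M₀` bounds the weights in a set of generators of `I`; only these have to be checked, so the
  -- error terms of the chosen order do not contribute to the components that matter.
  let η : σ → MvPolynomial σ k := fun j => weightedHomogeneousComponent W (a + W j) (ξ j)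
  have hcut : ∀ e < M₀ + a + Finsupp.weight W β + 1,
      ∀ Q ∈ idealOfVars σ k ^ (M₀ + a + Finsupp.weight W β + 1),
      weightedHomogeneousComponent W e Q = 0 := by
    intro e he Q hQ
    apply weightedHomogeneousComponent_eq_zero'
    intro x hx h
    have := (mem_pow_idealOfVars_iff _ _).1 hQ x hx
    have := degree_le_weight hW x
    omega
  have hcomp : ∀ u e, IsWeightedHomogeneous W u e →
      weightedHomogeneousComponent W (a + e) (∑ j, pderiv j u * ξ j) = ∑ j, pderiv j u * η j := by
    intro u e hu
    rw [map_sum]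
    refine Finset.sum_congr rfl fun j _ => ?_
    by_cases hj : W j ≤ e
    · have h3 := hu.pderiv (i := j) (n' := e - W j) (by omega)
      rw [mul_comm, show a + e = (a + W j) + (e - W j) by omega,
        weightedHomogeneousComponent_mul_right W _ h3, mul_comm]
    · have : pderiv j u = 0 := by
        apply pderiv_eq_zero_of_notMem_vars
        intro hv
        obtain ⟨x, hx, hxj⟩ := mem_vars_iff_mem_support j |>.1 hv
        have h3 := hu (mem_support_iff.1 hx)
        have := Finsupp.le_weight_of_ne_zero' W (Finsupp.mem_support_iff.1 hxj)
        omega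
      simp [this]
  have hηI : ∀ u ∈ I, ∀ e, e < M₀ → IsWeightedHomogeneous W u e →
      ∑ j, pderiv j u * η j ∈ I := by
    intro u hu e he hue
    rw [← hcomp u e hue]
    obtain ⟨p, hp, q, hq, hpq⟩ := Submodule.mem_sup.1 (h2 u hu)
    rw [← hpq, map_add, hcut _ (by omega) q hq, add_zero]
    exact hI p hp _
  refine ⟨η, ?_, fun u hu => ?_, fun j => weightedHomogeneousComponent_isWeightedHomogeneous _ _⟩
  · rw [← hcomp f d hf, show a + d = Finsupp.weight W β from Nat.sub_add_cancel hβ]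
    have h3 := hcut (Finsupp.weight W β) (by omega) _ h1
    rw [map_sub, sub_eq_zero] at h3
    rw [h3]
    exact (isWeightedHomogeneous_monomial W β (1 : k) rfl).weightedHomogeneousComponent_same
  · refine sum_pderiv_mul_mem_span hT.symm η (fun v hv => ?_) hu
    have hvI : v ∈ I := hT ▸ Ideal.subset_span hv
    have hvM : M v ≤ M₀ := Finset.le_sup (f := M) hv
    rw [← sum_range_weightedHomogeneousComponent W v (hM v)]
    simp only [map_sum, Finset.sum_mul]
    rw [Finset.sum_comm]
    exact I.sum_mem fun e he => hηI _ (hI v hvI e) e ((Finset.mem_range.1 he).trans_le hvM)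
      (weightedHomogeneousComponent_isWeightedHomogeneous _ _)

end Graded

/-! ### The lemma of Hadamard for analytic functions -/

section Hadamard

variable {𝕂 : Type*} [RCLike 𝕂] {Z : Type*} [NormedAddCommGroup Z] [NormedSpace 𝕂 Z]
variable {ι : Type*} [Fintype ι]

/-- The vector at place `k` of a multilinear map of `m + 1` variables is replaced by `e`, and the
projection `P` is applied to the variables before it. -/
noncomputable def hadamardTerm (P : Z →L[𝕂] Z) (e : Z) {m : ℕ}
    (f : ContinuousMultilinearMap 𝕂 (fun _ : Fin (m + 1) => Z) 𝕂) (k : Fin (m + 1)) :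
    ContinuousMultilinearMap 𝕂 (fun _ : Fin m => Z) 𝕂 :=
  (f.curryMid k e).compContinuousLinearMap
    fun j => if j.castSucc < k then P else ContinuousLinearMap.id 𝕂 Z

theorem norm_hadamardTerm_le (P : Z →L[𝕂] Z) (hP : ‖P‖ ≤ 1) (e : Z) {m : ℕ}
    (f : ContinuousMultilinearMap 𝕂 (fun _ : Fin (m + 1) => Z) 𝕂) (k : Fin (m + 1)) :
    ‖hadamardTerm P e f k‖ ≤ ‖f‖ * ‖e‖ := by
  refine (ContinuousMultilinearMap.norm_compContinuousLinearMap_le _ _).trans ?_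
  have h1 : ∏ j : Fin m, ‖(if j.castSucc < k then P else ContinuousLinearMap.id 𝕂 Z)‖ ≤ 1 := by
    refine Finset.prod_le_one (fun _ _ => norm_nonneg _) fun j _ => ?_
    split_ifs
    · exact hP
    · exact ContinuousLinearMap.norm_id_le
  have h2 : ‖f.curryMid k e‖ ≤ ‖f‖ * ‖e‖ := by
    have := (f.curryMid k).le_opNorm e
    rwa [ContinuousMultilinearMap.norm_curryMid] at this
  calc _ ≤ (‖f‖ * ‖e‖) * 1 := mul_le_mul h2 h1 (by positivity) (by positivity)
    _ = _ := mul_one _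

/-- The difference of `f` at `(z, …, z)` and at `(P z, …, P z)` telescopes, one argument being changed at
a time. -/
theorem sum_hadamardTerm (P : Z →L[𝕂] Z) (e : ι → Z) (c : ι → 𝕂) (z : Z)
    (hz : z - P z = ∑ i, c i • e i) {m : ℕ}
    (f : ContinuousMultilinearMap 𝕂 (fun _ : Fin (m + 1) => Z) 𝕂) :
    f (fun _ => z) - f (fun _ => P z)
      = ∑ i, c i * ∑ k, hadamardTerm P (e i) f k (fun _ => z) := by
  -- `a r` has `P z` at the first `r` places and `z` at the others.
  let a : ℕ → 𝕂 := fun r => f fun j => if (j : ℕ) < r then P z else z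
  have h0 : a 0 = f fun _ => z := by simp [a]
  have h1 : a (m + 1) = f fun _ => P z := by
    simp only [a]
    congr 1
    funext j
    rw [if_pos j.2]
  have h2 : ∀ k : Fin (m + 1), a k - a (k + 1) = ∑ i, c i * hadamardTerm P (e i) f k (fun _ => z) := by
    intro k
    let v : Fin (m + 1) → Z := fun j => if (j : ℕ) < k then P z else z
    have hv1 : (fun j : Fin (m + 1) => if (j : ℕ) < k then P z else z) = Function.update v k z := by
      funext j
      by_cases hj : j = k
      · subst hj; simp
      · simp [Function.update_of_ne hj, v]
    have hv2 : (fun j : Fin (m + 1) => if (j : ℕ) < (k : ℕ) + 1 then P z else z)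
        = Function.update v k (P z) := by
      funext j
      by_cases hj : j = k
      · subst hj; simp
      · have : (j : ℕ) ≠ k := fun h => hj (Fin.ext h)
        simp only [Function.update_of_ne hj, v]
        congr 1
        exact propext ⟨fun h => by omega, fun h => by omega⟩
    simp only [a]
    rw [hv1, hv2, ← f.map_update_sub, hz]
    have hsum := f.toMultilinearMap.map_update_sum Finset.univ k (fun i => c i • e i) v
    simp only [ContinuousMultilinearMap.coe_coe] at hsum
    rw [hsum]
    refine Finset.sum_congr rfl fun i _ => ?_
    rw [f.map_update_smul, smul_eq_mul]
    congr 1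
    simp only [hadamardTerm, ContinuousMultilinearMap.compContinuousLinearMap_apply,
      ContinuousMultilinearMap.curryMid_apply]
    congr 1
    funext j
    refine Fin.succAboveCases k ?_ (fun l => ?_) j
    · simp
    · rw [Fin.insertNth_apply_succAbove, Function.update_of_ne (Fin.succAbove_ne k l)]
      simp only [v]
      by_cases hl : l.castSucc < k
      · rw [Fin.succAbove_of_castSucc_lt _ _ hl]
        rw [if_pos hl, if_pos (by simpa [Fin.lt_def] using hl)]
      · rw [Fin.succAbove_of_le_castSucc _ _ (not_lt.1 hl)]
        rw [if_neg hl, if_neg (by simp [Fin.lt_def] at hl ⊢; omega)]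
        simp
  have h3 : ∑ k : Fin (m + 1), (a k - a (k + 1)) = a 0 - a (m + 1) := by
    rw [Fin.sum_univ_eq_sum_range (fun k => a k - a (k + 1)), Finset.sum_range_sub']
  rw [← h0, ← h1, ← h3, Finset.sum_congr rfl fun k _ => h2 k, Finset.sum_comm]
  simp only [Finset.mul_sum]

/-- Hadamard's lemma for analytic functions: if `z - P z` is a combination `∑ cᵢ(z) eᵢ` of fixed
vectors then `h(z) - h(P z) = ∑ cᵢ(z) hᵢ(z)` with analytic `hᵢ`. -/
theorem exists_analyticAt_hadamard (P : Z →L[𝕂] Z) (hP : ‖P‖ ≤ 1) (e : ι → Z) (c : ι → Z → 𝕂)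
    (hz : ∀ z, z - P z = ∑ i, c i z • e i) {h : Z → 𝕂} (hh : AnalyticAt 𝕂 h 0) :
    ∃ H : ι → Z → 𝕂, (∀ i, AnalyticAt 𝕂 (H i) 0) ∧
      ∀ᶠ z in 𝓝 (0 : Z), h z = h (P z) + ∑ i, c i z * H i z := by
  obtain ⟨p, r, hp⟩ := hh
  let q : ι → FormalMultilinearSeries 𝕂 Z 𝕂 := fun i m => ∑ k, hadamardTerm P (e i) (p (m + 1)) k
  obtain ⟨r', hr'0, hr'⟩ : ∃ r' : ℝ≥0, 0 < r' ∧ (r' : ENNReal) < p.radius := by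
    obtain ⟨r', h0, h1⟩ := ENNReal.lt_iff_exists_nnreal_btwn.1 (hp.r_pos.trans_le hp.r_le)
    exact ⟨r', by simpa using h0, h1⟩
  obtain ⟨C, hC0, hC⟩ := p.norm_mul_pow_le_of_lt_radius hr'
  have hq : ∀ i, 0 < (q i).radius := by
    intro i
    have : ((r' / 2 : ℝ≥0) : ENNReal) ≤ (q i).radius := by
      apply FormalMultilinearSeries.le_radius_of_bound _ (C * ‖e i‖ / r')
      intro m
      have h1 : ‖q i m‖ ≤ (m + 1) * (‖p (m + 1)‖ * ‖e i‖) := by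
        refine (norm_sum_le _ _).trans ?_
        refine (Finset.sum_le_card_nsmul _ _ _ fun k _ => norm_hadamardTerm_le P hP (e i) _ k).trans ?_
        simp
      -- The `m + 1` summands of `q i m` cost a factor two in the radius.
      have h2 : ((m : ℝ) + 1) ≤ 2 ^ m := by
        have := Nat.lt_two_pow_self (n := m)
        exact_mod_cast this
      have h3 := hC (m + 1)
      have hr0 : (0 : ℝ) < r' := by exact_mod_cast hr'0
      have h4 : ‖p (m + 1)‖ * (r' : ℝ) ^ m ≤ C / r' := by
        rw [le_div_iff₀ hr0, mul_assoc, ← pow_succ]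
        exact h3
      calc ‖q i m‖ * ((r' / 2 : ℝ≥0) : ℝ) ^ m
          ≤ ((m + 1) * (‖p (m + 1)‖ * ‖e i‖)) * ((r' : ℝ) ^ m / 2 ^ m) := by
            rw [NNReal.coe_div, div_pow]
            exact mul_le_mul_of_nonneg_right h1 (by positivity)
        _ = ((m + 1) / 2 ^ m) * ‖e i‖ * (‖p (m + 1)‖ * (r' : ℝ) ^ m) := by ring
        _ ≤ 1 * ‖e i‖ * (C / r') := by
            gcongr
            rw [div_le_one (by positivity)]
            exact h2
        _ = _ := by ring
    refine lt_of_lt_of_le ?_ this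
    have : 0 < r' / 2 := by positivity
    exact_mod_cast this
  refine ⟨fun i => (q i).sum, fun i => ((q i).hasFPowerSeriesOnBall (hq i)).analyticAt, ?_⟩
  have hnb : ∀ᶠ z in 𝓝 (0 : Z), ∀ i, z ∈ Metric.eball (0 : Z) (q i).radius := by
    rw [Filter.eventually_all]
    exact fun i => Metric.eball_mem_nhds _ (hq i)
  filter_upwards [hnb, Metric.eball_mem_nhds (0 : Z) hp.r_pos] with z hz1 hz2
  have hPz : P z ∈ Metric.eball (0 : Z) r := by
    rw [mem_eball_zero_iff] at hz2 ⊢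
    refine lt_of_le_of_lt ?_ hz2
    have : ‖P z‖ ≤ ‖z‖ := (P.le_opNorm z).trans (by nlinarith [norm_nonneg z])
    simpa [enorm_le_iff_norm_le] using this
  have s1 := hp.hasSum hz2
  have s2 := hp.hasSum hPz
  have s3 : HasSum (fun m => p (m + 1) (fun _ => z) - p (m + 1) (fun _ => P z))
      (h z - h (P z)) := by
    have := s1.sub s2
    rw [← hasSum_nat_add_iff' 1] at this
    simpa [show ((fun _ => z : Fin 0 → Z)) = fun _ => P z from funext fun j => j.elim0] using this
  have s4 : HasSum (fun m => ∑ i, c i z * q i m (fun _ => z)) (∑ i, c i z * (q i).sum z) := by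
    refine hasSum_sum fun i _ => ?_
    simpa using (((q i).hasFPowerSeriesOnBall (hq i)).hasSum (hz1 i)).mul_left (c i z)
  have h5 : ∀ m, p (m + 1) (fun _ => z) - p (m + 1) (fun _ => P z)
      = ∑ i, c i z * q i m (fun _ => z) := by
    intro m
    rw [sum_hadamardTerm P e (fun i => c i z) z (hz z)]
    simp [q]
  simp only [h5] at s3
  rw [← s3.unique s4]
  ring

end Hadamard

/-! ### Taylor expansion with analytic remainder -/

section Taylor

variable {𝕂 : Type*} [RCLike 𝕂] {n : ℕ} {T : Type*} [NormedAddCommGroup T] [NormedSpace 𝕂 T]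

/-- The monomial function `x ↦ x^β`. -/
def mon (β : Fin n →₀ ℕ) (x : Fin n → 𝕂) : 𝕂 := ∏ i, x i ^ β i

theorem eval_monomial_one (β : Fin n →₀ ℕ) (x : Fin n → 𝕂) :
    MvPolynomial.eval x (MvPolynomial.monomial β 1) = mon β x := by
  rw [MvPolynomial.eval_monomial, one_mul, mon, Finsupp.prod_fintype _ _ (fun _ => pow_zero _)]

theorem mon_add (β γ : Fin n →₀ ℕ) (x : Fin n → 𝕂) : mon (β + γ) x = mon β x * mon γ x := by
  simp [mon, pow_add, Finset.prod_mul_distrib]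

@[simp]
theorem mon_zero (x : Fin n → 𝕂) : mon 0 x = 1 := by simp [mon]

theorem mon_single (i : Fin n) (a : ℕ) (x : Fin n → 𝕂) : mon (Finsupp.single i a) x = x i ^ a := by
  rw [mon, Finset.prod_eq_single i]
  · simp
  · intro j _ hj
    simp [Finsupp.single_eq_of_ne hj]
  · simp

theorem eval_eq_sum_mon (P : MvPolynomial (Fin n) 𝕂) (x : Fin n → 𝕂) :
    MvPolynomial.eval x P = ∑ β ∈ P.support, MvPolynomial.coeff β P * mon β x :=
  MvPolynomial.eval_eq' x P

theorem norm_mon_le (β : Fin n →₀ ℕ) (x : Fin n → 𝕂) : ‖mon β x‖ ≤ ‖x‖ ^ β.degree := by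
  rw [mon, norm_prod, Finsupp.degree_eq_sum, ← Finset.prod_pow_eq_pow_sum]
  refine Finset.prod_le_prod (fun _ _ => norm_nonneg _) fun i _ => ?_
  rw [norm_pow]
  exact pow_le_pow_left₀ (norm_nonneg _) (norm_le_pi_norm x i) _

/-- The exponents of degree at most `M`. -/
noncomputable def expLE (n M : ℕ) : Finset (Fin n →₀ ℕ) := (Finsupp.finite_of_degree_le M).toFinset

@[simp]
theorem mem_expLE {M : ℕ} {β : Fin n →₀ ℕ} : β ∈ expLE n M ↔ β.degree ≤ M := by simp [expLE]

/-- Taylor expansion with analytic remainder, in the first group of variables. -/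
theorem exists_analyticAt_expansion {h : (Fin n → 𝕂) × T → 𝕂} (hh : AnalyticAt 𝕂 h 0) (M : ℕ) :
    ∃ H : (Fin n →₀ ℕ) → (Fin n → 𝕂) × T → 𝕂, (∀ β, AnalyticAt 𝕂 (H β) 0) ∧
      (∀ β, β.degree < M → ∀ z, H β z = H β (0, z.2)) ∧
      ∀ᶠ z in 𝓝 (0 : (Fin n → 𝕂) × T), h z = ∑ β ∈ expLE n M, mon β z.1 * H β z := by
  classical
  induction M with
  | zero =>
    refine ⟨fun _ => h, fun _ => hh, fun β hβ => absurd hβ (by omega), .of_forall fun z => ?_⟩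
    have : expLE n 0 = {0} := by
      ext β
      simp [Finsupp.degree_eq_zero_iff]
    simp [this]
  | succ M ih =>
    obtain ⟨H, hH, hHc, hsum⟩ := ih
    let P : (Fin n → 𝕂) × T →L[𝕂] (Fin n → 𝕂) × T :=
      (ContinuousLinearMap.inr 𝕂 (Fin n → 𝕂) T).comp (ContinuousLinearMap.snd 𝕂 (Fin n → 𝕂) T)
    have hPz : ∀ z, P z = (0, z.2) := fun z => rfl
    have hP : ‖P‖ ≤ 1 := P.opNorm_le_bound zero_le_one fun z => by
      rw [hPz, one_mul, Prod.norm_def, Prod.norm_def]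
      simp
    have hz : ∀ z, z - P z = ∑ i, (z.1 i) • ((Pi.single i 1, 0) : (Fin n → 𝕂) × T) := by
      intro z
      rw [hPz]
      ext
      · simp [Finset.sum_apply, Prod.fst_sum, Pi.single_apply]
      · simp [Prod.snd_sum]
    -- Only the remainders of degree `M` depend on `x`; Hadamard splits off their values at `x = 0`.
    choose K hK hKs using fun β => exists_analyticAt_hadamard P hP _ (fun i z => z.1 i) hz (hH β)
    let Q : Finset ((Fin n →₀ ℕ) × Fin n) := (expLE n M).filter (fun β => β.degree = M) ×ˢ Finset.univ
    let s : (Fin n →₀ ℕ) × Fin n → (Fin n →₀ ℕ) := fun p => p.1 + Finsupp.single p.2 1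
    let D : Finset (Fin n →₀ ℕ) := (expLE n (M + 1)).filter fun β => β.degree = M + 1
    have hs : ∀ p ∈ Q, s p ∈ D := by
      intro p hp
      simp only [Q, Finset.mem_product, Finset.mem_filter, Finset.mem_univ, and_true] at hp
      simp [s, D, hp.2]
    have hP0 : AnalyticAt 𝕂 P 0 := P.analyticAt 0
    refine ⟨fun γ => if γ.degree ≤ M then fun z => H γ (P z)
      else fun z => ∑ p ∈ Q with s p = γ, K p.1 p.2 z, fun γ => ?_, fun γ hγ z => ?_, ?_⟩
    · dsimp only
      split_ifs
      · have h0 : AnalyticAt 𝕂 (H γ) (P 0) := by rw [map_zero]; exact hH γ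
        exact h0.comp hP0
      · exact Finset.analyticAt_fun_sum _ fun p _ => hK p.1 p.2
    · dsimp only
      rw [if_pos (by omega)]
      simp [hPz]
    · have hKs' : ∀ᶠ z in 𝓝 (0 : (Fin n → 𝕂) × T), ∀ β ∈ expLE n M,
          H β z = H β (P z) + ∑ i, z.1 i * K β i z :=
        (Filter.eventually_all_finset _).2 fun β _ => hKs β
      filter_upwards [hsum, hKs'] with z hz1 hz2
      have hsplit : ∀ g : (Fin n →₀ ℕ) → 𝕂,
          ∑ β ∈ expLE n (M + 1), g β = ∑ β ∈ expLE n M, g β + ∑ β ∈ D, g β := by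
        intro g
        rw [← Finset.sum_filter_add_sum_filter_not _ (fun β => β.degree ≤ M)]
        congr 1
        · refine Finset.sum_congr ?_ fun _ _ => rfl
          ext β
          simp only [Finset.mem_filter, mem_expLE]
          omega
        · refine Finset.sum_congr ?_ fun _ _ => rfl
          ext β
          simp only [D, Finset.mem_filter, mem_expLE]
          omega
      rw [hz1, hsplit]
      have e1 : ∑ β ∈ expLE n M, mon β z.1 * H β z = ∑ β ∈ expLE n M, mon β z.1 * H β (P z)
          + ∑ p ∈ Q, mon (s p) z.1 * K p.1 p.2 z := by
        rw [Finset.sum_product, Finset.sum_filter, ← Finset.sum_add_distrib]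
        refine Finset.sum_congr rfl fun β hβ => ?_
        split_ifs with hβM
        · conv_lhs => rw [hz2 β hβ, mul_add, Finset.mul_sum]
          congr 1
          refine Finset.sum_congr rfl fun i _ => ?_
          simp only [s, mon_add, mon_single, pow_one]
          ring
        · rw [add_zero, hHc β (lt_of_le_of_ne (mem_expLE.1 hβ) hβM) z, hPz]
      rw [e1]
      congr 1
      · refine Finset.sum_congr rfl fun β hβ => ?_
        rw [if_pos (mem_expLE.1 hβ)]
      · rw [← Finset.sum_fiberwise_of_maps_to hs]
        refine Finset.sum_congr rfl fun γ hγ => ?_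
        rw [if_neg (by simp only [D, Finset.mem_filter] at hγ; omega), Finset.mul_sum]
        refine Finset.sum_congr rfl fun p hp => ?_
        rw [(Finset.mem_filter.1 hp).2]

/-- An analytic function is the sum of a polynomial of degree less than `M` and of the monomials of
degree `M` with analytic coefficients. -/
theorem exists_taylor_polynomial {g : (Fin n → 𝕂) → 𝕂} (hg : AnalyticAt 𝕂 g 0) (M : ℕ) :
    ∃ (P : MvPolynomial (Fin n) 𝕂) (H : (Fin n →₀ ℕ) → (Fin n → 𝕂) → 𝕂),
      (∀ β ∈ P.support, β.degree < M) ∧ (∀ β, AnalyticAt 𝕂 (H β) 0) ∧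
      ∀ᶠ x in 𝓝 (0 : Fin n → 𝕂), g x = MvPolynomial.eval x P
        + ∑ β ∈ expLE n M with β.degree = M, mon β x * H β x := by
  classical
  have h0 : AnalyticAt 𝕂 (fun z : (Fin n → 𝕂) × 𝕂 => g z.1) 0 :=
    AnalyticAt.fun_comp (f := Prod.fst) (g := g) hg analyticAt_fst
  obtain ⟨H, hH, hHc, hs⟩ := exists_analyticAt_expansion h0 M
  have hin : AnalyticAt 𝕂 (fun x : Fin n → 𝕂 => (x, (0 : 𝕂))) 0 :=
    analyticAt_id.prod analyticAt_const
  have ht : Tendsto (fun x : Fin n → 𝕂 => (x, (0 : 𝕂))) (𝓝 0) (𝓝 0) := hin.continuousAt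
  refine ⟨∑ β ∈ expLE n M with β.degree < M, MvPolynomial.monomial β (H β 0),
    fun β x => H β (x, 0), fun β hβ => ?_, fun β => AnalyticAt.fun_comp (hH β) hin, ?_⟩
  · obtain ⟨γ, hγ, hγ'⟩ := Finset.mem_biUnion.1 (MvPolynomial.support_sum hβ)
    have := MvPolynomial.support_monomial_subset hγ'
    rw [Finset.mem_singleton] at this
    rw [this]
    exact (Finset.mem_filter.1 hγ).2
  · filter_upwards [ht.eventually hs] with x hx
    change g x = _ at hx
    rw [hx, map_sum, ← Finset.sum_filter_add_sum_filter_not _ (fun β => β.degree < M)]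
    congr 1
    · refine Finset.sum_congr rfl fun β hβ => ?_
      rw [hHc β (Finset.mem_filter.1 hβ).2, ← mul_one (H β 0), ← smul_eq_mul (H β 0),
        ← MvPolynomial.smul_monomial, MvPolynomial.smul_eval, eval_monomial_one, mul_comm]
      rfl
    · refine Finset.sum_congr ?_ fun _ _ => rfl
      ext β
      simp only [Finset.mem_filter, mem_expLE]
      omega

end Taylor

/-! ### The weighted scaling and orders of vanishing -/

section Scaling

open MvPolynomial (eval pderiv weightedHomogeneousComponent IsWeightedHomogeneous idealOfVars)
open Asymptotics

variable {𝕂 : Type*} [RCLike 𝕂] {n : ℕ}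

/-- The weighted scaling `λ · x = (λ^{W₁} x₁, …, λ^{Wₙ} xₙ)`. -/
def scale (W : Fin n → ℕ) (c : ℝ) (x : Fin n → 𝕂) : Fin n → 𝕂 := fun i => (c : 𝕂) ^ W i * x i

theorem mon_scale (W : Fin n → ℕ) (c : ℝ) (β : Fin n →₀ ℕ) (x : Fin n → 𝕂) :
    mon β (scale W c x) = (c : 𝕂) ^ (Finsupp.weight W β) * mon β x := by
  simp only [mon, scale, mul_pow, Finset.prod_mul_distrib, ← pow_mul]
  rw [Finset.prod_pow_eq_pow_sum, Finsupp.weight_eq_sum]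
  simp [mul_comm]

theorem norm_scale_le {W : Fin n → ℕ} (hW : ∀ i, 0 < W i) {c : ℝ} (h0 : 0 ≤ c) (h1 : c ≤ 1)
    (x : Fin n → 𝕂) : ‖scale W c x‖ ≤ c * ‖x‖ := by
  rw [pi_norm_le_iff_of_nonneg (by positivity)]
  intro i
  rw [scale, norm_mul, norm_pow, RCLike.norm_ofReal, abs_of_nonneg h0]
  exact mul_le_mul (pow_le_of_le_one h0 h1 (hW i).ne') (norm_le_pi_norm x i) (norm_nonneg _) h0

theorem eval_scale_of_isWeightedHomogeneous {W : Fin n → ℕ} {P : MvPolynomial (Fin n) 𝕂} {e : ℕ}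
    (hP : IsWeightedHomogeneous W P e) (c : ℝ) (x : Fin n → 𝕂) :
    eval (scale W c x) P = (c : 𝕂) ^ e * eval x P := by
  rw [eval_eq_sum_mon, eval_eq_sum_mon, Finset.mul_sum]
  refine Finset.sum_congr rfl fun β hβ => ?_
  rw [mon_scale, hP (MvPolynomial.mem_support_iff.1 hβ)]
  ring

/-- A polynomial which is `O(c ^ D)` for small positive `c` has no terms of degree less than `D`. -/
theorem coeff_eq_zero_of_eval_le (p : Polynomial 𝕂) (D : ℕ) (C : ℝ)
    (h : ∀ᶠ c : ℝ in 𝓝[>] 0, ‖p.eval (c : 𝕂)‖ ≤ C * c ^ D) : ∀ e < D, p.coeff e = 0 := by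
  intro e
  induction e using Nat.strong_induction_on with
  | _ e ih =>
    intro he
    obtain ⟨q, rfl⟩ := Polynomial.X_pow_dvd_iff.2 fun j hj => ih j hj (hj.trans he)
    have h1 : Tendsto (fun c : ℝ => q.eval (c : 𝕂)) (𝓝[>] 0) (𝓝 (q.eval 0)) := by
      have h2 : ContinuousAt (fun c : ℝ => q.eval (c : 𝕂)) 0 :=
        (q.continuous.comp RCLike.continuous_ofReal).continuousAt
      have h3 := h2.tendsto
      simp only [RCLike.ofReal_zero] at h3
      exact h3.mono_left nhdsWithin_le_nhds
    have h2 : Tendsto (fun c : ℝ => q.eval (c : 𝕂)) (𝓝[>] 0) (𝓝 0) := by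
      have h3 : Tendsto (fun c : ℝ => C * c ^ (D - e)) (𝓝[>] 0) (𝓝 0) := by
        have h4 : ContinuousAt (fun c : ℝ => C * c ^ (D - e)) 0 := by fun_prop
        have h5 := h4.tendsto
        rw [zero_pow (by omega), mul_zero] at h5
        exact h5.mono_left nhdsWithin_le_nhds
      refine squeeze_zero_norm' ?_ h3
      filter_upwards [h, self_mem_nhdsWithin] with c hc hc0
      have hc0' : (0 : ℝ) < c := hc0
      rw [Polynomial.eval_mul, Polynomial.eval_pow, Polynomial.eval_X, norm_mul, norm_pow,
        RCLike.norm_ofReal, abs_of_pos hc0'] at hc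
      have h6 : C * c ^ D = c ^ e * (C * c ^ (D - e)) := by
        rw [mul_left_comm, ← pow_add, Nat.add_sub_cancel' he.le]
      rw [h6] at hc
      exact le_of_mul_le_mul_left hc (pow_pos hc0' e)
    have h3 := tendsto_nhds_unique h1 h2
    rw [Polynomial.coeff_X_pow_mul', if_pos le_rfl, Nat.sub_self, Polynomial.coeff_zero_eq_eval_zero]
    exact h3

/-- If `P(λ · x) = O(λ^D)` then the weighted components of `P` of weight less than `D` vanish
at `x`. -/
theorem eval_component_eq_zero {W : Fin n → ℕ} (P : MvPolynomial (Fin n) 𝕂) (x : Fin n → 𝕂)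
    (D : ℕ) (C : ℝ) (h : ∀ᶠ c : ℝ in 𝓝[>] 0, ‖eval (scale W c x) P‖ ≤ C * c ^ D) :
    ∀ e < D, eval x (weightedHomogeneousComponent W e P) = 0 := by
  obtain ⟨M, hM⟩ := exists_weight_bound W P
  let p : Polynomial 𝕂 := ∑ e ∈ Finset.range M,
    Polynomial.monomial e (eval x (weightedHomogeneousComponent W e P))
  have hp : ∀ c : ℝ, p.eval (c : 𝕂) = eval (scale W c x) P := by
    intro c
    conv_rhs => rw [← sum_range_weightedHomogeneousComponent W P hM, map_sum]
    rw [Polynomial.eval_finsetSum]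
    refine Finset.sum_congr rfl fun e _ => ?_
    rw [eval_scale_of_isWeightedHomogeneous
      (MvPolynomial.weightedHomogeneousComponent_isWeightedHomogeneous e P), Polynomial.eval_monomial,
      mul_comm]
  intro e he
  have h1 := coeff_eq_zero_of_eval_le p D C (by simpa only [hp] using h) e he
  by_cases heM : e < M
  · simpa [p, Polynomial.finsetSum_coeff, Polynomial.coeff_monomial, heM] using h1
  · rw [MvPolynomial.weightedHomogeneousComponent_eq_zero', map_zero]
    intro β hβ hβe
    have := hM β hβ
    omega

theorem scale_tendsto {W : Fin n → ℕ} (hW : ∀ i, 0 < W i) (x : Fin n → 𝕂) :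
    Tendsto (fun c : ℝ => scale W c x) (𝓝[>] 0) (𝓝 0) := by
  have h1 : Tendsto (fun c : ℝ => c * ‖x‖) (𝓝[>] 0) (𝓝 0) := by
    have h4 : ContinuousAt (fun c : ℝ => c * ‖x‖) 0 := by fun_prop
    have h5 := h4.tendsto
    rw [zero_mul] at h5
    exact h5.mono_left nhdsWithin_le_nhds
  refine squeeze_zero_norm' ?_ h1
  have h2 : ∀ᶠ c : ℝ in 𝓝[>] 0, c < 1 := nhdsWithin_le_nhds (Iio_mem_nhds zero_lt_one)
  filter_upwards [h2, self_mem_nhdsWithin] with c hc hc0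
  exact norm_scale_le hW (le_of_lt hc0) hc.le x

/-- A function of order `N` is of order `N` along the orbits of the scaling. -/
theorem exists_bound_scale {W : Fin n → ℕ} (hW : ∀ i, 0 < W i) {g : (Fin n → 𝕂) → 𝕂} {N : ℕ}
    (hg : g =O[𝓝 0] fun x => ‖x‖ ^ N) (x : Fin n → 𝕂) :
    ∃ C : ℝ, ∀ᶠ c : ℝ in 𝓝[>] 0, ‖g (scale W c x)‖ ≤ C * c ^ N := by
  obtain ⟨C, hC0, hC⟩ := hg.exists_nonneg
  refine ⟨C * ‖x‖ ^ N, ?_⟩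
  have h2 : ∀ᶠ c : ℝ in 𝓝[>] 0, c < 1 := nhdsWithin_le_nhds (Iio_mem_nhds zero_lt_one)
  filter_upwards [h2, self_mem_nhdsWithin, (scale_tendsto hW x).eventually hC.bound] with c h1 h0 h3
  have h0' : (0 : ℝ) ≤ c := le_of_lt h0
  refine h3.trans ?_
  rw [norm_pow, norm_norm, mul_assoc]
  refine mul_le_mul_of_nonneg_left ?_ hC0
  rw [← mul_pow, mul_comm ‖x‖]
  exact pow_le_pow_left₀ (norm_nonneg _) (norm_scale_le hW h0' h1.le x) N

theorem isBigO_mon {β : Fin n →₀ ℕ} {N : ℕ} (h : N ≤ β.degree) :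
    (fun x : Fin n → 𝕂 => mon β x) =O[𝓝 0] fun x => ‖x‖ ^ N := by
  refine IsBigO.of_bound 1 ?_
  filter_upwards [Metric.ball_mem_nhds (0 : Fin n → 𝕂) one_pos] with x hx
  rw [mem_ball_zero_iff] at hx
  rw [one_mul, norm_pow, norm_norm]
  exact (norm_mon_le β x).trans (pow_le_pow_of_le_one (norm_nonneg _) hx.le h)

theorem isBigO_eval_of_mem {N : ℕ} {P : MvPolynomial (Fin n) 𝕂}
    (hP : P ∈ idealOfVars (Fin n) 𝕂 ^ N) :
    (fun x => eval x P) =O[𝓝 0] fun x => ‖x‖ ^ N := by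
  simp only [eval_eq_sum_mon]
  refine IsBigO.fun_sum fun β hβ => ?_
  exact (isBigO_mon ((MvPolynomial.mem_pow_idealOfVars_iff N P).1 hP β hβ)).const_mul_left _

theorem mem_pow_idealOfVars_of_isBigO {N : ℕ} {P : MvPolynomial (Fin n) 𝕂}
    (hP : (fun x => eval x P) =O[𝓝 0] fun x => ‖x‖ ^ N) : P ∈ idealOfVars (Fin n) 𝕂 ^ N := by
  rw [MvPolynomial.mem_pow_idealOfVars_iff']
  intro β hβ
  have h0 : weightedHomogeneousComponent (fun _ : Fin n => 1) β.degree P = 0 := by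
    apply MvPolynomial.funext
    intro x
    obtain ⟨C, hC⟩ := exists_bound_scale (W := fun _ => 1) (fun _ => one_pos) hP x
    rw [eval_component_eq_zero P x N C hC _ hβ, map_zero]
  classical
  have h1 := MvPolynomial.coeff_weightedHomogeneousComponent (w := fun _ : Fin n => 1) β.degree P β
  rw [h0, if_pos (by rw [Finsupp.degree_eq_weight_one])] at h1
  simpa using h1.symm

theorem isBigO_taylor_remainder {H : (Fin n →₀ ℕ) → (Fin n → 𝕂) → 𝕂}
    (hH : ∀ β, AnalyticAt 𝕂 (H β) 0) (M : ℕ) :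
    (fun x => ∑ β ∈ expLE n M with β.degree = M, mon β x * H β x) =O[𝓝 0] fun x => ‖x‖ ^ M := by
  refine IsBigO.fun_sum fun β hβ => ?_
  have h1 := isBigO_mon (𝕂 := 𝕂) (Finset.mem_filter.1 hβ).2.ge
  have h2 : H β =O[𝓝 0] fun _ => (1 : ℝ) := (hH β).continuousAt.isBigO_one ℝ
  simpa using h1.mul h2

/-- Taylor's formula. -/
theorem exists_polynomial_isBigO {g : (Fin n → 𝕂) → 𝕂} (hg : AnalyticAt 𝕂 g 0) (M : ℕ) :
    ∃ P : MvPolynomial (Fin n) 𝕂, (∀ β ∈ P.support, β.degree < M) ∧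
      (fun x => g x - eval x P) =O[𝓝 0] fun x => ‖x‖ ^ M := by
  obtain ⟨P, H, hP, hH, hs⟩ := exists_taylor_polynomial hg M
  refine ⟨P, hP, (isBigO_taylor_remainder hH M).congr' ?_ EventuallyEq.rfl⟩
  filter_upwards [hs] with x hx
  rw [hx]
  ring

theorem hasFDerivAt_eval (P : MvPolynomial (Fin n) 𝕂) (x : Fin n → 𝕂) :
    HasFDerivAt (fun y => eval y P)
      (∑ j, eval x (pderiv j P) • (ContinuousLinearMap.proj j : (Fin n → 𝕂) →L[𝕂] 𝕂)) x := by
  classical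
  induction P using MvPolynomial.induction_on with
  | C a =>
    simp only [MvPolynomial.eval_C]
    exact (hasFDerivAt_const (𝕜 := 𝕂) a x).congr_fderiv (by ext v; simp)
  | add p q hp hq =>
    simp only [map_add]
    exact (hp.fun_add hq).congr_fderiv (by ext v; simp [add_mul, Finset.sum_add_distrib])
  | mul_X p i hp =>
    have h1 := hp.mul (hasFDerivAt_apply i x)
    simp only [map_mul, MvPolynomial.eval_X]
    refine h1.congr_fderiv ?_
    ext v
    simp only [add_apply, smul_apply, smul_eq_mul,
      ContinuousLinearMap.proj_apply, sum_apply, MvPolynomial.pderiv_mul,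
      map_add, map_mul, MvPolynomial.eval_X, add_mul, Finset.sum_add_distrib, Finset.mul_sum]
    rw [add_comm]
    congr 1
    · exact Finset.sum_congr rfl fun j _ => by ring
    · rw [Finset.sum_eq_single i]
      · simp
      · intro j _ hj
        simp [hj.symm]
      · simp

theorem fderiv_eval_apply (P : MvPolynomial (Fin n) 𝕂) (x v : Fin n → 𝕂) :
    fderiv 𝕂 (fun y => eval y P) x v = ∑ j, eval x (pderiv j P) * v j := by
  rw [(hasFDerivAt_eval P x).fderiv]
  simp

theorem analyticAt_eval (P : MvPolynomial (Fin n) 𝕂) (x : Fin n → 𝕂) :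
    AnalyticAt 𝕂 (fun y => eval y P) x := by
  have := AnalyticAt.aeval_mvPolynomial (A := 𝕂) (B := 𝕂) (f := fun (y : Fin n → 𝕂) i => y i) (z := x)
    (fun i => (ContinuousLinearMap.proj (R := 𝕂) (φ := fun _ : Fin n => 𝕂) i).analyticAt x) P
  simpa [MvPolynomial.aeval_eq_eval] using this

theorem pderiv_mem_pow_idealOfVars {N : ℕ} {P : MvPolynomial (Fin n) 𝕂}
    (hP : P ∈ idealOfVars (Fin n) 𝕂 ^ (N + 1)) (j : Fin n) :
    pderiv j P ∈ idealOfVars (Fin n) 𝕂 ^ N := by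
  rw [MvPolynomial.mem_pow_idealOfVars_iff'] at hP ⊢
  intro β hβ
  rw [MvPolynomial.coeff_pderiv, hP _ (by simp; omega), zero_mul]

/-- The derivative of an analytic function of order `N + 1` has order `N`. -/
theorem isBigO_fderiv {r : (Fin n → 𝕂) → 𝕂} (hr : AnalyticAt 𝕂 r 0) {N : ℕ}
    (hO : r =O[𝓝 0] fun x => ‖x‖ ^ (N + 1)) :
    (fun x => fderiv 𝕂 r x) =O[𝓝 0] fun x => ‖x‖ ^ N := by
  obtain ⟨P, H, hP, hH, hs⟩ := exists_taylor_polynomial hr (N + 1)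
  have hP0 : P = 0 := by
    have h1 : (fun x => eval x P) =O[𝓝 0] fun x => ‖x‖ ^ (N + 1) := by
      refine (hO.sub (isBigO_taylor_remainder hH (N + 1))).congr' ?_ EventuallyEq.rfl
      filter_upwards [hs] with x hx
      rw [hx]
      ring
    have h2 := (MvPolynomial.mem_pow_idealOfVars_iff _ _).1 (mem_pow_idealOfVars_of_isBigO h1)
    rw [← MvPolynomial.support_eq_empty, Finset.eq_empty_iff_forall_notMem]
    intro β hβ
    have := h2 β hβ
    have := hP β hβ
    omega
  let L : (Fin n →₀ ℕ) → (Fin n → 𝕂) → (Fin n → 𝕂) →L[𝕂] 𝕂 := fun β x =>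
    mon β x • fderiv 𝕂 (H β) x + H β x • ∑ j, eval x (pderiv j (MvPolynomial.monomial β 1)) •
      (ContinuousLinearMap.proj j : (Fin n → 𝕂) →L[𝕂] 𝕂)
  have hder : (fun x => fderiv 𝕂 r x) =ᶠ[𝓝 0]
      fun x => ∑ β ∈ expLE n (N + 1) with β.degree = N + 1, L β x := by
    have hd : ∀ᶠ x in 𝓝 (0 : Fin n → 𝕂), ∀ β ∈ expLE n (N + 1), AnalyticAt 𝕂 (H β) x :=
      (Filter.eventually_all_finset _).2 fun β _ => (hH β).eventually_analyticAt
    filter_upwards [hs.eventually_nhds, hd] with x hx hdx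
    have hx' : r =ᶠ[𝓝 x] fun x => ∑ β ∈ expLE n (N + 1) with β.degree = N + 1, mon β x * H β x := by
      filter_upwards [hx] with y hy
      rw [hy, hP0]
      simp
    rw [hx'.fderiv_eq]
    refine (HasFDerivAt.fun_sum fun β hβ => ?_).fderiv
    have h1 := hasFDerivAt_eval (MvPolynomial.monomial β (1 : 𝕂)) x
    simp only [eval_monomial_one] at h1
    exact h1.mul (hdx β (Finset.mem_filter.1 hβ).1).differentiableAt.hasFDerivAt
  refine IsBigO.congr' ?_ hder.symm EventuallyEq.rfl
  refine IsBigO.fun_sum fun β hβ => ?_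
  have hdeg := (Finset.mem_filter.1 hβ).2
  refine IsBigO.add ?_ ?_
  · have h1 := isBigO_mon (𝕂 := 𝕂) (β := β) (N := N) (by omega)
    have h2 : (fun x => fderiv 𝕂 (H β) x) =O[𝓝 0] fun _ => (1 : ℝ) :=
      (hH β).fderiv.continuousAt.isBigO_one ℝ
    simpa using h1.smul h2
  · have h1 : H β =O[𝓝 0] fun _ => (1 : ℝ) := (hH β).continuousAt.isBigO_one ℝ
    have h2 : (fun x : Fin n → 𝕂 => ∑ j, eval x (pderiv j (MvPolynomial.monomial β 1)) •
      (ContinuousLinearMap.proj j : (Fin n → 𝕂) →L[𝕂] 𝕂)) =O[𝓝 0] fun x => ‖x‖ ^ N := by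
      refine IsBigO.fun_sum fun j _ => ?_
      have h3 : MvPolynomial.monomial β (1 : 𝕂) ∈ idealOfVars (Fin n) 𝕂 ^ (N + 1) :=
        (MvPolynomial.monomial_mem_pow_idealOfVars_iff _ _ one_ne_zero).2 hdeg.ge
      have h4 := isBigO_eval_of_mem (pderiv_mem_pow_idealOfVars h3 j)
      have h5 := h4.smul (isBigO_refl (fun _ : Fin n → 𝕂 =>
        (ContinuousLinearMap.proj j : (Fin n → 𝕂) →L[𝕂] 𝕂)) (𝓝 0))
      refine h5.trans ?_
      refine IsBigO.of_bound ‖(ContinuousLinearMap.proj j : (Fin n → 𝕂) →L[𝕂] 𝕂)‖ (.of_forall fun x => ?_)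
      rw [norm_smul, mul_comm]
    simpa using h1.smul h2

end Scaling

/-! ### Germs and vector fields on cones -/

section Germs

open MvPolynomial (eval pderiv weightedHomogeneousComponent IsWeightedHomogeneous idealOfVars
  vanishingIdeal)
open Asymptotics

variable {𝕂 : Type*} [RCLike 𝕂] {n : ℕ}

theorem mem_vanishingIdeal' {X' : Set (Fin n → 𝕂)} {P : MvPolynomial (Fin n) 𝕂} :
    P ∈ vanishingIdeal 𝕂 X' ↔ ∀ x ∈ X', eval x P = 0 := by
  simp [MvPolynomial.mem_vanishingIdeal_iff, MvPolynomial.aeval_eq_eval]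

/-- The ideal of a set stable under the scaling is weighted homogeneous. -/
theorem component_mem_vanishingIdeal {W : Fin n → ℕ} {X' : Set (Fin n → 𝕂)}
    (hX' : ∀ c : ℝ, 0 < c → ∀ x ∈ X', scale W c x ∈ X') {P : MvPolynomial (Fin n) 𝕂}
    (hP : P ∈ vanishingIdeal 𝕂 X') (e : ℕ) :
    weightedHomogeneousComponent W e P ∈ vanishingIdeal 𝕂 X' := by
  rw [mem_vanishingIdeal'] at hP ⊢
  intro x hx
  refine eval_component_eq_zero P x (e + 1) 0 ?_ e (Nat.lt_succ_self e)
  filter_upwards [self_mem_nhdsWithin] with c hc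
  rw [hP _ (hX' c hc x hx)]
  simp

/-- A germ vanishing on a cone `X'` agrees to any order with a polynomial vanishing on `X'`. -/
theorem exists_mem_vanishingIdeal_isBigO {W : Fin n → ℕ} (hW : ∀ i, 0 < W i)
    {X X' : Set (Fin n → 𝕂)} (hXX' : ∀ᶠ x in 𝓝 (0 : Fin n → 𝕂), x ∈ X ↔ x ∈ X')
    (hX' : ∀ c : ℝ, 0 < c → ∀ x ∈ X', scale W c x ∈ X') {g : (Fin n → 𝕂) → 𝕂}
    (hg : VanishesOn X g) (N : ℕ) :
    ∃ P ∈ vanishingIdeal 𝕂 X', (fun x => g x - eval x P) =O[𝓝 0] fun x => ‖x‖ ^ N := by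
  let w := ∑ i, W i
  have hw : ∀ i, W i ≤ w := fun i => Finset.single_le_sum (fun _ _ => Nat.zero_le _)
    (Finset.mem_univ i)
  have hN : N ≤ N * (w + 1) := Nat.le_mul_of_pos_right _ (Nat.succ_pos _)
  -- The jet of `g` is taken to an order that controls all components of weight less than
  -- `N (w + 1)`, and these contain all terms of degree less than `N`.
  obtain ⟨Q, -, hQO⟩ := exists_polynomial_isBigO hg.1 (N * (w + 1))
  obtain ⟨M, hM⟩ := exists_weight_bound W Q
  let P := ∑ e ∈ Finset.range (N * (w + 1)), weightedHomogeneousComponent W e Q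
  have hcomp : ∀ e < N * (w + 1), weightedHomogeneousComponent W e Q ∈ vanishingIdeal 𝕂 X' := by
    intro e he
    rw [mem_vanishingIdeal']
    intro x hx
    obtain ⟨C, hC⟩ := exists_bound_scale hW hQO x
    refine eval_component_eq_zero Q x _ C ?_ e he
    filter_upwards [hC, (scale_tendsto hW x).eventually (hXX'.and hg.2), self_mem_nhdsWithin]
      with c h1 h2 h3
    rw [h2.2 (h2.1.2 (hX' c h3 x hx)), zero_sub, norm_neg] at h1
    exact h1
  refine ⟨P, Ideal.sum_mem _ fun e he => hcomp e (Finset.mem_range.1 he), ?_⟩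
  have hQP : Q - P ∈ idealOfVars (Fin n) 𝕂 ^ N := by
    rw [MvPolynomial.mem_pow_idealOfVars_iff']
    classical
    intro β hβ
    simp only [P, MvPolynomial.coeff_sub, MvPolynomial.coeff_sum,
      MvPolynomial.coeff_weightedHomogeneousComponent, Finset.sum_ite_eq, Finset.mem_range]
    rw [if_pos, sub_self]
    calc Finsupp.weight W β ≤ β.degree * w := weight_le_degree_mul hw β
      _ ≤ β.degree * (w + 1) := Nat.mul_le_mul_left _ (Nat.le_succ w)
      _ < N * (w + 1) := Nat.mul_lt_mul_of_pos_right hβ (Nat.succ_pos w)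
  have h1 : (fun x : Fin n → 𝕂 => ‖x‖ ^ (N * (w + 1))) =O[𝓝 0] fun x => ‖x‖ ^ N := by
    refine IsBigO.of_bound 1 ?_
    filter_upwards [Metric.ball_mem_nhds (0 : Fin n → 𝕂) one_pos] with x hx
    rw [mem_ball_zero_iff] at hx
    rw [one_mul, norm_pow, norm_norm, norm_pow, norm_norm]
    exact pow_le_pow_of_le_one (norm_nonneg _) hx.le hN
  refine ((hQO.trans h1).add (isBigO_eval_of_mem hQP)).congr_left fun x => ?_
  rw [map_sub]
  ring

theorem analyticAt_scale (W : Fin n → ℕ) (x : Fin n → 𝕂) (c : ℝ) :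
    AnalyticAt ℝ (fun c : ℝ => scale W c x) c := by
  rw [analyticAt_pi_iff]
  intro i
  have h1 : AnalyticAt ℝ (fun c : ℝ => (c : 𝕂)) c := (RCLike.ofRealCLM (K := 𝕂)).analyticAt c
  exact (h1.pow (W i)).mul analyticAt_const

/-- An analytic function on `[0, 1]` which at `0` vanishes to infinite order vanishes at `1`. -/
theorem eq_zero_of_flat {u : ℝ → 𝕂} (hu : ∀ c ∈ Set.Icc (0 : ℝ) 1, AnalyticAt ℝ u c)
    (hflat : ∀ N : ℕ, ∃ C : ℝ, ∀ᶠ c : ℝ in 𝓝[>] 0, ‖u c‖ ≤ C * c ^ N) : u 1 = 0 := by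
  have h0 : AnalyticAt ℝ u 0 := hu 0 ⟨le_rfl, zero_le_one⟩
  have hev : ∀ᶠ c in 𝓝 (0 : ℝ), u c = 0 := by
    by_contra hne
    obtain ⟨m, g, hg, hg0, hug⟩ := (h0.exists_eventuallyEq_pow_smul_nonzero_iff).2 hne
    obtain ⟨C, hC⟩ := hflat (m + 1)
    have h1 : Tendsto g (𝓝[>] 0) (𝓝 (g 0)) := hg.continuousAt.tendsto.mono_left nhdsWithin_le_nhds
    have h2 : Tendsto g (𝓝[>] 0) (𝓝 0) := by
      have h3 : Tendsto (fun c : ℝ => C * c) (𝓝[>] 0) (𝓝 0) := by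
        have h4 : ContinuousAt (fun c : ℝ => C * c) 0 := by fun_prop
        have h5 := h4.tendsto
        rw [mul_zero] at h5
        exact h5.mono_left nhdsWithin_le_nhds
      refine squeeze_zero_norm' ?_ h3
      filter_upwards [hC, nhdsWithin_le_nhds hug, self_mem_nhdsWithin] with c hc hc1 hc0
      have hc0' : (0 : ℝ) < c := hc0
      rw [hc1, norm_smul, sub_zero, norm_pow, Real.norm_of_nonneg hc0'.le, pow_succ,
        mul_left_comm] at hc
      exact le_of_mul_le_mul_left hc (pow_pos hc0' m)
    exact hg0 (tendsto_nhds_unique h1 h2)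
  have h1 : AnalyticOnNhd ℝ u (Set.Icc 0 1) := fun c hc => hu c hc
  exact h1.eqOn_zero_of_preconnected_of_eventuallyEq_zero isPreconnected_Icc
    (Set.left_mem_Icc.2 zero_le_one) hev (Set.right_mem_Icc.2 zero_le_one)

theorem analyticAt_fderiv_apply {E : Type*} [NormedAddCommGroup E] [NormedSpace 𝕂 E] [CompleteSpace E]
    {g : E → 𝕂} {η : E → E} {x : E} (hg : AnalyticAt 𝕂 g x) (hη : AnalyticAt 𝕂 η x) :
    AnalyticAt 𝕂 (fun y => fderiv 𝕂 g y (η y)) x :=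
  ((ContinuousLinearMap.id 𝕂 (E →L[𝕂] 𝕂)).analyticAt_bilinear (fderiv 𝕂 g x, η x)).fun_comp_of_eq
    (hg.fderiv.prod hη) rfl

/-- A polynomial vector field which preserves the ideal of polynomials vanishing on a cone is tangent
to the germ of the cone.  The derivative of a germ vanishing on the cone is flat along the orbits of
the scaling in the cone, hence zero by analyticity. -/
theorem isTangentField_of_polynomial {W : Fin n → ℕ} (hW : ∀ i, 0 < W i)
    {X X' : Set (Fin n → 𝕂)} (hXX' : ∀ᶠ x in 𝓝 (0 : Fin n → 𝕂), x ∈ X ↔ x ∈ X')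
    (hX' : ∀ c : ℝ, 0 < c → ∀ x ∈ X', scale W c x ∈ X') (η : Fin n → MvPolynomial (Fin n) 𝕂)
    (hη : ∀ u ∈ vanishingIdeal 𝕂 X', ∑ j, pderiv j u * η j ∈ vanishingIdeal 𝕂 X') :
    IsTangentField X (fun x i => eval x (η i)) := by
  have hηa : ∀ x : Fin n → 𝕂, AnalyticAt 𝕂 (fun x i => eval x (η i)) x := fun x =>
    analyticAt_pi_iff.2 fun i => analyticAt_eval (η i) x
  refine ⟨hηa 0, fun g hg => ?_⟩
  let h : (Fin n → 𝕂) → 𝕂 := fun x => fderiv 𝕂 g x (fun i => eval x (η i))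
  have hh : AnalyticAt 𝕂 h 0 := analyticAt_fderiv_apply hg.1 (hηa 0)
  refine ⟨hh, ?_⟩
  change ∀ᶠ x in 𝓝 0, x ∈ X → h x = 0
  obtain ⟨ε, hε, hball⟩ := Metric.eventually_nhds_iff_ball.1 hh.eventually_analyticAt
  filter_upwards [hXX', Metric.ball_mem_nhds (0 : Fin n → 𝕂) hε] with x hx hxε hxX
  rw [mem_ball_zero_iff] at hxε
  have hxX' := hx.1 hxX
  have hone : scale W 1 x = x := by
    funext i
    simp [scale]
  rw [← hone]
  refine eq_zero_of_flat (u := fun c => h (scale W c x)) (fun c hc => ?_) fun N => ?_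
  · have h1 : AnalyticAt ℝ h (scale W c x) := by
      refine (hball _ ?_).restrictScalars
      rw [mem_ball_zero_iff]
      exact (norm_scale_le hW hc.1 hc.2 x).trans_lt
        (lt_of_le_of_lt (mul_le_of_le_one_left (norm_nonneg _) hc.2) hxε)
    exact h1.fun_comp_of_eq (analyticAt_scale W x c) rfl
  · obtain ⟨P, hP, hPO⟩ := exists_mem_vanishingIdeal_isBigO hW hXX' hX' hg (N + 1)
    have hr : AnalyticAt 𝕂 (fun x => g x - eval x P) 0 := hg.1.sub (analyticAt_eval P 0)
    have h1 := isBigO_fderiv hr hPO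
    have h2 : (fun x : Fin n → 𝕂 => fun i => eval x (η i)) =O[𝓝 0] fun _ => (1 : ℝ) :=
      (hηa 0).continuousAt.isBigO_one ℝ
    have h3 : (fun x => fderiv 𝕂 (fun x => g x - eval x P) x (fun i => eval x (η i)))
        =O[𝓝 0] fun x => ‖x‖ ^ N := by
      have h4 : (fun x => fderiv 𝕂 (fun x => g x - eval x P) x (fun i => eval x (η i)))
          =O[𝓝 0] fun x => ‖fderiv 𝕂 (fun x => g x - eval x P) x‖ * ‖fun i => eval x (η i)‖ :=
        IsBigO.of_bound 1 (.of_forall fun x => by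
          rw [one_mul, norm_mul, norm_norm, norm_norm]
          exact ContinuousLinearMap.le_opNorm _ _)
      refine h4.trans ?_
      simpa using h1.norm_left.mul h2.norm_left
    obtain ⟨C, hC⟩ := exists_bound_scale hW h3 x
    refine ⟨C, ?_⟩
    filter_upwards [hC, self_mem_nhdsWithin,
      (scale_tendsto hW x).eventually hg.1.eventually_analyticAt] with c hc hc0 hga
    convert hc using 2
    simp only [h]
    have e1 : fderiv 𝕂 (fun x => g x - eval x P) (scale W c x)
        = fderiv 𝕂 g (scale W c x) - fderiv 𝕂 (fun x => eval x P) (scale W c x) :=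
      fderiv_fun_sub hga.differentiableAt (analyticAt_eval P _).differentiableAt
    have e2 := mem_vanishingIdeal'.1 (hη P hP) _ (hX' c hc0 x hxX')
    rw [map_sum] at e2
    simp only [map_mul] at e2
    rw [e1, sub_apply, fderiv_eval_apply, e2, sub_zero]

end Germs

/-! ### Infinitesimal form of finite determinacy -/

section Jets

open MvPolynomial (eval pderiv bind₁ weightedHomogeneousComponent IsWeightedHomogeneous idealOfVars
  vanishingIdeal)
open Asymptotics

variable {𝕂 : Type*} [RCLike 𝕂] {n : ℕ}

/-- The orders of vanishing of two functions add up in their product. -/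
theorem iteratedFDeriv_mul_eq_zero {E : Type*} [NormedAddCommGroup E] [NormedSpace 𝕂 E]
    {f g : E → 𝕂} (hf : ContDiff 𝕂 ⊤ f) (hg : ContDiff 𝕂 ⊤ g) {x : E} {a b : ℕ}
    (ha : ∀ m < a, iteratedFDeriv 𝕂 m f x = 0) (hb : ∀ m < b, iteratedFDeriv 𝕂 m g x = 0) {m : ℕ}
    (hm : m < a + b) : iteratedFDeriv 𝕂 m (fun y => f y * g y) x = 0 := by
  have h := norm_iteratedFDeriv_mul_le (𝕜 := 𝕂) hf hg x (n := m) (by exact_mod_cast le_top)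
  rw [Finset.sum_eq_zero, norm_le_zero_iff] at h
  · exact h
  · intro i hi
    by_cases hia : i < a
    · simp [ha i hia]
    · rw [Finset.mem_range] at hi
      simp [hb (m - i) (by omega)]

theorem contDiff_mon (β : Fin n →₀ ℕ) : ContDiff 𝕂 ⊤ (mon (𝕂 := 𝕂) β) := by
  unfold mon
  fun_prop

theorem iteratedFDeriv_pow_coord_eq_zero (i : Fin n) (a : ℕ) :
    ∀ m < a, iteratedFDeriv 𝕂 m (fun x : Fin n → 𝕂 => x i ^ a) 0 = 0 := by
  induction a with
  | zero => intro m hm; omega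
  | succ a ih =>
    intro m hm
    simp only [pow_succ]
    refine iteratedFDeriv_mul_eq_zero (b := 1) (by fun_prop) (by fun_prop) ih ?_ hm
    intro m hm
    obtain rfl : m = 0 := by omega
    ext v
    simp

theorem iteratedFDeriv_mon_eq_zero (β : Fin n →₀ ℕ) {m : ℕ} (hm : m < β.degree) :
    iteratedFDeriv 𝕂 m (mon (𝕂 := 𝕂) β) 0 = 0 := by
  have key : ∀ s : Finset (Fin n), ∀ m < ∑ i ∈ s, β i,
      iteratedFDeriv 𝕂 m (fun x : Fin n → 𝕂 => ∏ i ∈ s, x i ^ β i) 0 = 0 := by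
    intro s
    induction s using Finset.induction_on with
    | empty => intro m hm; simp at hm
    | insert i s hi ih =>
      intro m hm
      simp only [Finset.prod_insert hi]
      rw [Finset.sum_insert hi] at hm
      exact iteratedFDeriv_mul_eq_zero (by fun_prop) (by fun_prop)
        (iteratedFDeriv_pow_coord_eq_zero i _) ih hm
  refine key Finset.univ m ?_
  rwa [Finsupp.degree_eq_sum] at hm

/-- Adding a polynomial of order at least `N` does not change the `m`-jet for `m < N`. -/
theorem iteratedFDeriv_eval_add (f : MvPolynomial (Fin n) 𝕂) {N : ℕ} {P : MvPolynomial (Fin n) 𝕂}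
    (hP : P ∈ idealOfVars (Fin n) 𝕂 ^ N) {m : ℕ} (hm : m < N) :
    iteratedFDeriv 𝕂 m (fun x => eval x (f + P)) 0 = iteratedFDeriv 𝕂 m (fun x => eval x f) 0 := by
  have hc : ∀ Q : MvPolynomial (Fin n) 𝕂, ContDiff 𝕂 ⊤ fun x => eval x Q := by
    intro Q
    simp only [eval_eq_sum_mon]
    exact ContDiff.sum fun β _ => contDiff_const.mul (contDiff_mon β)
  have h0 : iteratedFDeriv 𝕂 m (fun x => eval x P) 0 = 0 := by
    simp only [eval_eq_sum_mon]
    rw [iteratedFDeriv_fun_sum_apply]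
    · refine Finset.sum_eq_zero fun β hβ => ?_
      have h1 := iteratedFDeriv_const_smul_apply (𝕜 := 𝕂) (i := m) (x := 0) (a := P.coeff β)
        ((contDiff_mon (𝕂 := 𝕂) β).of_le le_top).contDiffAt
      change iteratedFDeriv 𝕂 m (P.coeff β • mon (𝕂 := 𝕂) β) 0 = 0
      rw [h1, iteratedFDeriv_mon_eq_zero, smul_zero]
      refine hm.trans_le ?_
      by_contra hlt
      rw [MvPolynomial.mem_support_iff] at hβ
      exact hβ ((MvPolynomial.mem_pow_idealOfVars_iff' _ _).1 hP β (not_le.1 hlt))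
    · intro β _
      exact (contDiff_const.mul ((contDiff_mon β).of_le le_top)).contDiffAt
  simp only [map_add]
  rw [fun_iteratedFDeriv_add_apply ((hc f).of_le le_top).contDiffAt
    ((hc P).of_le le_top).contDiffAt, h0, add_zero]

theorem eval_bind₁' (Φ : Fin n → MvPolynomial (Fin n) 𝕂) (P : MvPolynomial (Fin n) 𝕂)
    (x : Fin n → 𝕂) : eval x (bind₁ Φ P) = eval (fun i => eval x (Φ i)) P := by
  induction P using MvPolynomial.induction_on with
  | C a => simp
  | add p q hp hq => simp [hp, hq]
  | mul_X p i hp => simp [hp]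

/-- Composition is compatible with jets. -/
theorem isBigO_comp_sub_eval_bind₁ {φ : (Fin n → 𝕂) → (Fin n → 𝕂)} (hφ : AnalyticAt 𝕂 φ 0)
    (hφ0 : φ 0 = 0) {l : ℕ} {Φ : Fin n → MvPolynomial (Fin n) 𝕂}
    (hΦ : ∀ i, (fun x => φ x i - eval x (Φ i)) =O[𝓝 0] fun x => ‖x‖ ^ (l + 1))
    {u : (Fin n → 𝕂) → 𝕂} {P : MvPolynomial (Fin n) 𝕂}
    (hP : (fun x => u x - eval x P) =O[𝓝 0] fun x => ‖x‖ ^ (l + 1)) :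
    (fun x => u (φ x) - eval x (bind₁ Φ P)) =O[𝓝 0] fun x => ‖x‖ ^ (l + 1) := by
  have ht : Tendsto φ (𝓝 0) (𝓝 0) := by
    have := hφ.continuousAt.tendsto
    rwa [hφ0] at this
  have hφO : φ =O[𝓝 0] fun x => ‖x‖ := by
    have := hφ.differentiableAt.isBigO_sub
    simpa [hφ0] using this.norm_right
  have h1 : (fun x => u (φ x) - eval (φ x) P) =O[𝓝 0] fun x => ‖x‖ ^ (l + 1) :=
    (hP.comp_tendsto ht).trans (hφO.norm_left.pow (l + 1))
  have hΦO : (fun x => φ x - fun i => eval x (Φ i)) =O[𝓝 0] fun x => ‖x‖ ^ (l + 1) :=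
    isBigO_pi.2 hΦ
  have hΦt : Tendsto (fun x i => eval x (Φ i)) (𝓝 0) (𝓝 (0 : Fin n → 𝕂)) := by
    have h2 : Tendsto (fun x : Fin n → 𝕂 => ‖x‖ ^ (l + 1)) (𝓝 0) (𝓝 0) := by
      have h3 : Continuous fun x : Fin n → 𝕂 => ‖x‖ ^ (l + 1) := by fun_prop
      simpa using h3.tendsto 0
    have h4 := ht.sub (hΦO.trans_tendsto h2)
    simpa using h4
  have h5 : (fun x => eval (φ x) P - eval (fun i => eval x (Φ i)) P) =O[𝓝 0]
      fun x => φ x - fun i => eval x (Φ i) := by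
    have h6 := (analyticAt_eval P (0 : Fin n → 𝕂)).hasStrictFDerivAt.isBigO_sub
    have h7 := h6.comp_tendsto (k := fun x => (φ x, fun i => eval x (Φ i))) (ht.prodMk_nhds hΦt)
    simpa only [Function.comp_def] using h7
  have h8 := h1.add (h5.trans hΦO)
  simp only [sub_add_sub_cancel] at h8
  simpa only [eval_bind₁'] using h8

/-- The polynomial jet of order `l` of an analytic map which fixes the origin. -/
theorem exists_jet {φ : (Fin n → 𝕂) → (Fin n → 𝕂)} (hφ : AnalyticAt 𝕂 φ 0) (hφ0 : φ 0 = 0) (l : ℕ) :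
    ∃ Φ : Fin n → MvPolynomial (Fin n) 𝕂,
      (∀ i, ∀ β ∈ (Φ i).support, β ≠ 0 ∧ β.degree ≤ l) ∧
      ∀ i, (fun x => φ x i - eval x (Φ i)) =O[𝓝 0] fun x => ‖x‖ ^ (l + 1) := by
  choose Φ hΦ hΦO using fun i => exists_polynomial_isBigO (analyticAt_pi_iff.1 hφ i) (l + 1)
  refine ⟨Φ, fun i β hβ => ⟨?_, Nat.lt_succ_iff.1 (hΦ i β hβ)⟩, hΦO⟩
  rintro rfl
  have h1 := (hΦO i).eq_zero_imp.self_of_nhds (by simp)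
  rw [hφ0, Pi.zero_apply, zero_sub, neg_eq_zero] at h1
  rw [MvPolynomial.mem_support_iff, ← MvPolynomial.constantCoeff_eq] at hβ
  rw [MvPolynomial.eval_zero] at h1
  exact hβ h1

/-- Finite determinacy in terms of jets: polynomial jets of the diffeomorphisms which carry `f` to
its deformations `f + h`. -/
theorem RXFinitelyDetermined.exists_jets {W : Fin n → ℕ} (hW : ∀ i, 0 < W i)
    {X X' : Set (Fin n → 𝕂)} (hXX' : ∀ᶠ x in 𝓝 (0 : Fin n → 𝕂), x ∈ X ↔ x ∈ X')
    (hX' : ∀ c : ℝ, 0 < c → ∀ x ∈ X', scale W c x ∈ X') {f : MvPolynomial (Fin n) 𝕂}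
    (hf : RXFinitelyDetermined X (fun x => eval x f)) :
    ∃ N : ℕ, ∀ l : ℕ, ∀ h ∈ idealOfVars (Fin n) 𝕂 ^ (N + 1),
      ∃ Φ Ψ : Fin n → MvPolynomial (Fin n) 𝕂,
        (∀ i, ∀ β ∈ (Φ i).support, β ≠ 0 ∧ β.degree ≤ l) ∧
        (∀ i, ∀ β ∈ (Ψ i).support, β ≠ 0 ∧ β.degree ≤ l) ∧
        bind₁ Φ f - (f + h) ∈ idealOfVars (Fin n) 𝕂 ^ (l + 1) ∧
        (∀ u ∈ vanishingIdeal 𝕂 X',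
          bind₁ Φ u ∈ vanishingIdeal 𝕂 X' ⊔ idealOfVars (Fin n) 𝕂 ^ (l + 1)) ∧
        (∀ u ∈ vanishingIdeal 𝕂 X',
          bind₁ Ψ u ∈ vanishingIdeal 𝕂 X' ⊔ idealOfVars (Fin n) 𝕂 ^ (l + 1)) ∧
        (∀ i, bind₁ Ψ (Φ i) - MvPolynomial.X i ∈ idealOfVars (Fin n) 𝕂 ^ (l + 1)) ∧
        ∀ i, bind₁ Φ (Ψ i) - MvPolynomial.X i ∈ idealOfVars (Fin n) 𝕂 ^ (l + 1) := by
  obtain ⟨N, hN⟩ := hf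
  refine ⟨N, fun l h hh => ?_⟩
  obtain ⟨φ, ψ, hφ, hψ, hφ0, hψ0, hψφ, hφψ, hφX, hfφ⟩ := hN (fun x => eval x (f + h))
    (analyticAt_eval _ 0) fun m hm => iteratedFDeriv_eval_add f hh (Nat.lt_succ_of_le hm)
  have hφt : Tendsto φ (𝓝 0) (𝓝 0) := by
    have := hφ.continuousAt.tendsto
    rwa [hφ0] at this
  have hψt : Tendsto ψ (𝓝 0) (𝓝 0) := by
    have := hψ.continuousAt.tendsto
    rwa [hψ0] at this
  have hψX : ∀ᶠ x in 𝓝 (0 : Fin n → 𝕂), x ∈ X ↔ ψ x ∈ X := by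
    filter_upwards [hψt.eventually hφX, hφψ] with x h1 h2
    rw [h1, h2]
  obtain ⟨Φ, hΦ, hΦO⟩ := exists_jet hφ hφ0 l
  obtain ⟨Ψ, hΨ, hΨO⟩ := exists_jet hψ hψ0 l
  have hself : ∀ P : MvPolynomial (Fin n) 𝕂,
      (fun x => eval x P - eval x P) =O[𝓝 0] fun x => ‖x‖ ^ (l + 1) := fun P => by
    simp only [sub_self]
    exact isBigO_zero _ _
  -- a diffeomorphism preserving `X` preserves its ideal, up to high order
  have hideal : ∀ {χ : (Fin n → 𝕂) → (Fin n → 𝕂)} {Χ : Fin n → MvPolynomial (Fin n) 𝕂},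
      AnalyticAt 𝕂 χ 0 → χ 0 = 0 → (∀ᶠ x in 𝓝 (0 : Fin n → 𝕂), x ∈ X ↔ χ x ∈ X) →
      (∀ i, (fun x => χ x i - eval x (Χ i)) =O[𝓝 0] fun x => ‖x‖ ^ (l + 1)) →
      ∀ u ∈ vanishingIdeal 𝕂 X',
        bind₁ Χ u ∈ vanishingIdeal 𝕂 X' ⊔ idealOfVars (Fin n) 𝕂 ^ (l + 1) := by
    intro χ Χ hχ hχ0 hχX hΧ u hu
    have hχt : Tendsto χ (𝓝 0) (𝓝 0) := by
      have := hχ.continuousAt.tendsto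
      rwa [hχ0] at this
    have hv : VanishesOn X fun x => eval (χ x) u := by
      refine ⟨(analyticAt_eval u 0).fun_comp_of_eq hχ hχ0, ?_⟩
      filter_upwards [hχX, hχt.eventually hXX'] with x h1 h2 hx
      exact mem_vanishingIdeal'.1 hu _ (h2.1 (h1.1 hx))
    obtain ⟨P, hP, hPO⟩ := exists_mem_vanishingIdeal_isBigO hW hXX' hX' hv (l + 1)
    have h3 := isBigO_comp_sub_eval_bind₁ hχ hχ0 hΧ (hself u)
    refine Submodule.mem_sup.2 ⟨P, hP, bind₁ Χ u - P, mem_pow_idealOfVars_of_isBigO ?_, by ring⟩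
    refine (hPO.sub h3).congr_left fun x => ?_
    rw [map_sub]
    ring
  refine ⟨Φ, Ψ, hΦ, hΨ, ?_, hideal hφ hφ0 hφX hΦO, hideal hψ hψ0 hψX hΨO, fun i => ?_, fun i => ?_⟩
  · refine mem_pow_idealOfVars_of_isBigO
      ((isBigO_comp_sub_eval_bind₁ hφ hφ0 hΦO (hself f)).neg_left.congr' ?_ EventuallyEq.rfl)
    filter_upwards [hfφ] with x hx
    rw [map_sub, hx]
    ring
  · refine mem_pow_idealOfVars_of_isBigO
      ((isBigO_comp_sub_eval_bind₁ hψ hψ0 hΨO (hΦO i)).neg_left.congr' ?_ EventuallyEq.rfl)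
    filter_upwards [hφψ] with x hx
    rw [map_sub, hx, MvPolynomial.eval_X]
    ring
  · refine mem_pow_idealOfVars_of_isBigO
      ((isBigO_comp_sub_eval_bind₁ hφ hφ0 hΦO (hΨO i)).neg_left.congr' ?_ EventuallyEq.rfl)
    filter_upwards [hψφ] with x hx
    rw [map_sub, hx, MvPolynomial.eval_X]
    ring

/-- If the weighted homogeneous `f` is finitely determined, every monomial `x ^ β` of high degree and
of weight at least the degree of `f` is the derivative of `f` along a weighted homogeneous polynomial
vector field tangent to `X`. -/
theorem RXFinitelyDetermined.exists_homogeneous_tangentField {W : Fin n → ℕ} (hW : ∀ i, 0 < W i)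
    {X X' : Set (Fin n → 𝕂)} (hXX' : ∀ᶠ x in 𝓝 (0 : Fin n → 𝕂), x ∈ X ↔ x ∈ X')
    (hX' : ∀ c : ℝ, 0 < c → ∀ x ∈ X', scale W c x ∈ X') {f : MvPolynomial (Fin n) 𝕂} {d : ℕ}
    (hfd : IsWeightedHomogeneous W f d) (hf : RXFinitelyDetermined X (fun x => eval x f)) :
    ∃ N : ℕ, ∀ β : Fin n →₀ ℕ, N < β.degree → d ≤ Finsupp.weight W β →
      ∃ η : Fin n → MvPolynomial (Fin n) 𝕂,
        ∑ j, pderiv j f * η j = MvPolynomial.monomial β 1 ∧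
        IsTangentField X (fun x i => eval x (η i)) ∧
        ∀ j, IsWeightedHomogeneous W (η j) (Finsupp.weight W β - d + W j) := by
  obtain ⟨N, hN⟩ := hf.exists_jets hW hXX' hX'
  refine ⟨N, fun β hβN hβ => ?_⟩
  have hmem : MvPolynomial.monomial β (1 : 𝕂) ∈ idealOfVars (Fin n) 𝕂 ^ (N + 1) :=
    MvPolynomial.monomial_mem_pow_idealOfVars_iff _ _ one_ne_zero |>.2 hβN
  obtain ⟨η, h1, h2, h3⟩ := exists_homogeneous_field hW hfd
    (fun u hu e => component_mem_vanishingIdeal hX' hu e) β hβ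
    (fun l => exists_infinitesimal_of_jets f (vanishingIdeal 𝕂 X') N l (hN l) _ hmem)
  exact ⟨η, h1, isTangentField_of_polynomial hW hXX' hX' η h2, h3⟩

end Jets

/-! ### Expansion of deformations -/

section Deformation

open MvPolynomial (eval weightedHomogeneousComponent idealOfVars)
open Asymptotics

variable {𝕂 : Type*} [RCLike 𝕂] {n : ℕ}

/-- A germ all of whose Taylor monomials have weight at least `D` is `O(c ^ D)` along the orbits of
the scaling. -/
theorem exists_bound_scale_of_filtration {W : Fin n → ℕ} (hW : ∀ i, 0 < W i)
    {g : (Fin n → 𝕂) → 𝕂} (hg : AnalyticAt 𝕂 g 0) {D : ℕ}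
    (hD : ∀ (m : ℕ) (s : Fin m → Fin n),
      iteratedFDeriv 𝕂 m g 0 (fun l => Pi.single (s l) (1 : 𝕂)) ≠ 0 → D ≤ ∑ l, W (s l))
    (x : Fin n → 𝕂) :
    ∃ C : ℝ, ∀ᶠ c : ℝ in 𝓝[>] 0, ‖g (scale W c x)‖ ≤ C * c ^ D := by
  obtain ⟨p, r, hp⟩ := hg
  have hrem : (fun y => g y - p.partialSum D y) =O[𝓝 0] fun y => ‖y‖ ^ D := by
    simpa using hp.hasFPowerSeriesAt.isBigO_sub_partialSum_pow D
  obtain ⟨C₀, hC₀⟩ := exists_bound_scale hW hrem x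
  have hterm : ∀ m : ℕ, ∃ C : ℝ, ∀ c : ℝ, 0 < c → c ≤ 1 →
      ‖p m (fun _ => scale W c x)‖ ≤ C * c ^ D := by
    intro m
    let A := iteratedFDeriv 𝕂 m g 0
    refine ⟨∑ s : Fin m → Fin n, ‖∏ l, x (s l)‖ * ‖A fun l => Pi.single (s l) (1 : 𝕂)‖,
      fun c hc hc1 => ?_⟩
    have h1 : scale W c x
        = ∑ i, ((c : 𝕂) ^ W i * x i) • (Pi.single i (1 : 𝕂) : Fin n → 𝕂) := by
      rw [← pi_eq_sum_univ']
      rfl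
    have h2 : ‖p m (fun _ => scale W c x)‖ ≤ ‖A fun _ => scale W c x‖ := by
      have h3 := hp.factorial_smul (scale W c x) m
      change ‖_‖ ≤ ‖iteratedFDeriv 𝕂 m g 0 fun _ => scale W c x‖
      rw [← h3, ← Nat.cast_smul_eq_nsmul 𝕂, norm_smul]
      refine le_mul_of_one_le_left (norm_nonneg _) ?_
      rw [RCLike.norm_natCast]
      exact_mod_cast Nat.factorial_pos m
    refine h2.trans ?_
    rw [h1, ContinuousMultilinearMap.map_sum, Finset.sum_mul]
    refine (norm_sum_le _ _).trans (Finset.sum_le_sum fun s _ => ?_)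
    rw [ContinuousMultilinearMap.map_smul_univ, norm_smul]
    by_cases h0 : A (fun l => Pi.single (s l) (1 : 𝕂)) = 0
    · rw [h0]
      simp
    have h4 : ‖∏ l, ((c : 𝕂) ^ W (s l) * x (s l))‖ ≤ c ^ D * ‖∏ l, x (s l)‖ := by
      rw [Finset.prod_mul_distrib, norm_mul, Finset.prod_pow_eq_pow_sum, norm_pow,
        RCLike.norm_ofReal, abs_of_pos hc]
      exact mul_le_mul_of_nonneg_right (pow_le_pow_of_le_one hc.le hc1 (hD m s h0))
        (norm_nonneg _)
    calc _ ≤ (c ^ D * ‖∏ l, x (s l)‖) * ‖A fun l => Pi.single (s l) (1 : 𝕂)‖ :=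
          mul_le_mul_of_nonneg_right h4 (norm_nonneg _)
      _ = _ := by ring
  choose C hC using hterm
  refine ⟨C₀ + ∑ m ∈ Finset.range D, C m, ?_⟩
  have h2 : ∀ᶠ c : ℝ in 𝓝[>] 0, c < 1 := nhdsWithin_le_nhds (Iio_mem_nhds zero_lt_one)
  filter_upwards [hC₀, h2, self_mem_nhdsWithin] with c h3 h1 h0
  have h4 : ‖p.partialSum D (scale W c x)‖ ≤ (∑ m ∈ Finset.range D, C m) * c ^ D := by
    rw [FormalMultilinearSeries.partialSum, Finset.sum_mul]
    exact (norm_sum_le _ _).trans (Finset.sum_le_sum fun m _ => hC m c h0 h1.le)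
  calc ‖g (scale W c x)‖
      = ‖(g (scale W c x) - p.partialSum D (scale W c x)) + p.partialSum D (scale W c x)‖ := by
        rw [sub_add_cancel]
    _ ≤ _ := (norm_add_le _ _).trans (add_le_add h3 h4)
    _ = _ := by ring

/-- An analytic family of germs of filtration at least `D`, zero for `t = 0`, is a combination of
monomials of weight at least `D` with analytic coefficients which are zero for `t = 0`. -/
theorem exists_deformation_expansion {W : Fin n → ℕ} (hW : ∀ i, 0 < W i)
    {G : (Fin n → 𝕂) × 𝕂 → 𝕂} (hG : AnalyticAt 𝕂 G 0)
    (hG0 : ∀ᶠ x in 𝓝 (0 : Fin n → 𝕂), G (x, 0) = 0) {D : ℕ}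
    (hD : ∀ᶠ t in 𝓝 (0 : 𝕂), ∀ (m : ℕ) (s : Fin m → Fin n),
      iteratedFDeriv 𝕂 m (fun x => G (x, t)) 0 (fun l => Pi.single (s l) (1 : 𝕂)) ≠ 0 →
        D ≤ ∑ l, W (s l)) :
    ∃ (B : Finset (Fin n →₀ ℕ)) (h : (Fin n →₀ ℕ) → (Fin n → 𝕂) × 𝕂 → 𝕂),
      (∀ β ∈ B, D ≤ Finsupp.weight W β) ∧ (∀ β, AnalyticAt 𝕂 (h β) 0) ∧
      (∀ β x, h β (x, 0) = 0) ∧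
      ∀ᶠ q in 𝓝 (0 : (Fin n → 𝕂) × 𝕂), G q = ∑ β ∈ B, mon β q.1 * h β q := by
  obtain ⟨H, hHa, hHlow, hHs⟩ := exists_analyticAt_expansion hG D
  have hswap : ∀ {p : (Fin n → 𝕂) × 𝕂 → Prop}, (∀ᶠ q in 𝓝 0, p q) →
      ∀ᶠ t in 𝓝 (0 : 𝕂), ∀ᶠ x in 𝓝 (0 : Fin n → 𝕂), p (x, t) := by
    intro p hp
    have h1 : Tendsto (Prod.swap : 𝕂 × (Fin n → 𝕂) → _) (𝓝 (0, 0)) (𝓝 0) :=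
      continuous_swap.tendsto (0, 0)
    exact (h1.eventually hp).curry_nhds
  -- the coefficients of small weight are zero
  have hlow : ∀ᶠ t in 𝓝 (0 : 𝕂), ∀ β ∈ expLE n D, Finsupp.weight W β < D → H β (0, t) = 0 := by
    have hbd : ∀ᶠ q in 𝓝 (0 : (Fin n → 𝕂) × 𝕂), ∀ β ∈ expLE n D, AnalyticAt 𝕂 (H β) q :=
      (Finset.eventually_all _).2 fun β _ => (hHa β).eventually_analyticAt
    filter_upwards [hD, hswap hHs, hswap hbd, hswap hG.eventually_analyticAt] with t h1 h2 h3 h4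
    have hin : AnalyticAt 𝕂 (fun x : Fin n → 𝕂 => (x, t)) 0 := analyticAt_id.prod analyticAt_const
    let P : MvPolynomial (Fin n) 𝕂 :=
      ∑ β ∈ expLE n D with β.degree < D, MvPolynomial.monomial β (H β (0, t))
    have hP : ∀ x, eval x P = ∑ β ∈ expLE n D with β.degree < D, mon β x * H β (0, t) := by
      intro x
      rw [map_sum]
      refine Finset.sum_congr rfl fun β _ => ?_
      rw [← mul_one (H β (0, t)), ← MvPolynomial.C_mul_monomial, map_mul, MvPolynomial.eval_C,
        eval_monomial_one, mul_one, mul_comm]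
    have hrem : (fun x => G (x, t) - eval x P) =O[𝓝 0] fun x => ‖x‖ ^ D := by
      have h5 : (fun x => ∑ β ∈ expLE n D with ¬ β.degree < D, mon β x * H β (x, t))
          =O[𝓝 0] fun x => ‖x‖ ^ D := by
        refine IsBigO.fun_sum fun β hβ => ?_
        rw [Finset.mem_filter] at hβ
        have h6 : AnalyticAt 𝕂 (fun x => H β (x, t)) 0 :=
          (h3.self_of_nhds β hβ.1).fun_comp_of_eq hin rfl
        have h7 : (fun x => H β (x, t)) =O[𝓝 0] fun _ => (1 : ℝ) := h6.continuousAt.isBigO_one ℝ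
        simpa using (isBigO_mon (𝕂 := 𝕂) (not_lt.1 hβ.2)).mul h7
      refine h5.congr' ?_ EventuallyEq.rfl
      filter_upwards [h2] with x hx
      rw [hx, hP, ← Finset.sum_filter_add_sum_filter_not (expLE n D) (fun β => β.degree < D),
        add_comm, add_sub_assoc, left_eq_add, sub_eq_zero]
      refine Finset.sum_congr rfl fun β hβ => ?_
      rw [hHlow β (Finset.mem_filter.1 hβ).2]
    intro β hβ hβD
    have hdeg : β.degree < D := (degree_le_weight hW β).trans_lt hβD
    have h0 : weightedHomogeneousComponent W (Finsupp.weight W β) P = 0 := by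
      apply MvPolynomial.funext
      intro x
      obtain ⟨C₁, hC₁⟩ := exists_bound_scale hW hrem x
      obtain ⟨C₂, hC₂⟩ := exists_bound_scale_of_filtration hW
        (h4.self_of_nhds.fun_comp_of_eq hin rfl) h1 x
      rw [eval_component_eq_zero P x D (C₂ + C₁) ?_ _ hβD, map_zero]
      filter_upwards [hC₁, hC₂] with c e1 e2
      rw [add_mul]
      refine le_trans ?_ (add_le_add e2 e1)
      rw [← sub_sub_cancel (G (scale W c x, t)) (eval (scale W c x) P)]
      refine (norm_sub_le _ _).trans (le_of_eq ?_)
      rw [sub_sub_cancel]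
    classical
    have h5 := MvPolynomial.coeff_weightedHomogeneousComponent (w := W) (Finsupp.weight W β) P β
    rw [h0, if_pos rfl, MvPolynomial.coeff_zero] at h5
    simp only [P, MvPolynomial.coeff_sum, MvPolynomial.coeff_monomial] at h5
    rw [Finset.sum_ite_eq', if_pos (Finset.mem_filter.2 ⟨hβ, hdeg⟩)] at h5
    exact h5.symm
  let B := (expLE n D).filter fun β => D ≤ Finsupp.weight W β
  have hGB : ∀ᶠ q in 𝓝 (0 : (Fin n → 𝕂) × 𝕂), G q = ∑ β ∈ B, mon β q.1 * H β q := by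
    have ht : Tendsto (Prod.snd : (Fin n → 𝕂) × 𝕂 → 𝕂) (𝓝 0) (𝓝 0) := continuous_snd.tendsto 0
    filter_upwards [hHs, ht.eventually hlow] with q h1 h2
    rw [h1, Finset.sum_filter_of_ne]
    intro β hβ hne
    by_contra hlt
    rw [not_le] at hlt
    refine hne ?_
    rw [hHlow β ((degree_le_weight hW β).trans_lt hlt), h2 β hβ hlt, mul_zero]
  have hin : AnalyticAt 𝕂 (fun q : (Fin n → 𝕂) × 𝕂 => (q.1, (0 : 𝕂))) 0 :=
    analyticAt_fst.prod analyticAt_const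
  refine ⟨B, fun β q => H β q - H β (q.1, 0), fun β hβ => (Finset.mem_filter.1 hβ).2,
    fun β => (hHa β).sub ((hHa β).fun_comp_of_eq hin rfl), fun β x => sub_self _, ?_⟩
  have h0 : Tendsto (fun q : (Fin n → 𝕂) × 𝕂 => (q.1, (0 : 𝕂))) (𝓝 0) (𝓝 0) :=
    hin.continuousAt.tendsto
  have h1 : Tendsto (Prod.fst : (Fin n → 𝕂) × 𝕂 → _) (𝓝 0) (𝓝 0) := continuous_fst.tendsto 0
  filter_upwards [hGB, h0.eventually hGB, h1.eventually hG0] with q e1 e2 e3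
  simp only [mul_sub, Finset.sum_sub_distrib]
  rw [← e1, ← e2, e3, sub_zero]

end Deformation

/-! ### Orders with respect to weights -/

section Estimates

variable {𝕂 : Type*} [RCLike 𝕂] {n : ℕ}

/-- The weighted norm `maxᵢ |xᵢ| ^ (1 / Wᵢ)`.  It is homogeneous of degree one for the scaling with
weights `W`, and in general not a norm. -/
noncomputable def wnorm (W : Fin n → ℕ) (x : Fin n → 𝕂) : ℝ := ‖fun i => ‖x i‖ ^ ((W i : ℝ)⁻¹)‖

theorem wnorm_nonneg (W : Fin n → ℕ) (x : Fin n → 𝕂) : 0 ≤ wnorm W x := norm_nonneg _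

theorem norm_coord_le_wnorm_pow {W : Fin n → ℕ} (hW : ∀ i, 0 < W i) (x : Fin n → 𝕂) (i : Fin n) :
    ‖x i‖ ≤ wnorm W x ^ W i := by
  rw [← Real.rpow_inv_natCast_pow (norm_nonneg (x i)) (hW i).ne']
  refine pow_le_pow_left₀ (by positivity) ?_ _
  refine le_trans (le_of_eq ?_) (norm_le_pi_norm _ i)
  rw [Real.norm_of_nonneg (by positivity)]

theorem exists_wnorm_pow_eq {W : Fin n → ℕ} (hW : ∀ i, 0 < W i) (hn : 0 < n) (x : Fin n → 𝕂) :
    ∃ i, wnorm W x ^ W i = ‖x i‖ := by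
  have : Nonempty (Fin n) := ⟨⟨0, hn⟩⟩
  obtain ⟨i, hi⟩ := Finite.exists_max fun i => ‖x i‖ ^ ((W i : ℝ)⁻¹)
  have h : wnorm W x = ‖x i‖ ^ ((W i : ℝ)⁻¹) := by
    refine le_antisymm ((pi_norm_le_iff_of_nonneg (by positivity)).2 fun j => ?_) ?_
    · rw [Real.norm_of_nonneg (by positivity)]
      exact hi j
    · refine le_trans (le_of_eq ?_) (norm_le_pi_norm _ i)
      rw [Real.norm_of_nonneg (by positivity)]
  exact ⟨i, by rw [h, Real.rpow_inv_natCast_pow (norm_nonneg (x i)) (hW i).ne']⟩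

theorem wnorm_pos {W : Fin n → ℕ} (hW : ∀ i, 0 < W i) {x : Fin n → 𝕂} (hx : x ≠ 0) :
    0 < wnorm W x := by
  refine (wnorm_nonneg W x).lt_of_ne fun h => hx (funext fun i => ?_)
  have := norm_coord_le_wnorm_pow hW x i
  rw [← h, zero_pow (hW i).ne'] at this
  exact norm_le_zero_iff.1 this

theorem eventually_wnorm_lt_one {W : Fin n → ℕ} (hW : ∀ i, 0 < W i) :
    ∀ᶠ x in 𝓝 (0 : Fin n → 𝕂), wnorm W x < 1 := by
  have hc : Continuous (wnorm W : (Fin n → 𝕂) → ℝ) := by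
    refine continuous_norm.comp (continuous_pi fun i => ?_)
    exact (continuous_norm.comp (continuous_apply i)).rpow_const fun _ => Or.inr (by positivity)
  have h0 : wnorm W (0 : Fin n → 𝕂) = 0 := by
    have : (fun i : Fin n => ‖(0 : Fin n → 𝕂) i‖ ^ ((W i : ℝ)⁻¹)) = 0 := by
      funext i
      have := (hW i).ne'
      simp [Real.zero_rpow, this]
    rw [wnorm, this, norm_zero]
  have := hc.tendsto 0
  rw [h0] at this
  exact this.eventually (Iio_mem_nhds one_pos)

theorem wnorm_pow_le_norm {W : Fin n → ℕ} (hW : ∀ i, 0 < W i) (hn : 0 < n) {w₁ : ℕ}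
    (hw₁ : ∀ i, W i ≤ w₁) {x : Fin n → 𝕂} (hx : wnorm W x ≤ 1) : wnorm W x ^ w₁ ≤ ‖x‖ := by
  obtain ⟨i, hi⟩ := exists_wnorm_pow_eq hW hn x
  exact (pow_le_pow_of_le_one (wnorm_nonneg W x) hx (hw₁ i)).trans
    (hi.le.trans (norm_le_pi_norm x i))

/-- `u(x, t)` is of order at least `e` with respect to the weights `W`, uniformly in `t`, and its
derivative is of order at least `e - w₁`, as differentiation in `xᵢ` lowers the order by `Wᵢ ≤ w₁`.
Nothing is asked on `x = 0`, where a quotient by a control function need not be differentiable. -/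
def HasOrder (W : Fin n → ℕ) (w₁ : ℕ) (e : ℤ) (u : (Fin n → 𝕂) × 𝕂 → 𝕂) : Prop :=
  ∃ C : ℝ, ∀ᶠ q in 𝓝 (0 : (Fin n → 𝕂) × 𝕂), q.1 ≠ 0 →
    DifferentiableAt ℝ u q ∧ ‖u q‖ ≤ C * wnorm W q.1 ^ e ∧
      ‖fderiv ℝ u q‖ ≤ C * wnorm W q.1 ^ (e - w₁)

variable {W : Fin n → ℕ} {w₁ : ℕ}

theorem eventually_wnorm_fst (hW : ∀ i, 0 < W i) :
    ∀ᶠ q in 𝓝 (0 : (Fin n → 𝕂) × 𝕂), wnorm W q.1 < 1 :=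
  (continuous_fst.tendsto (0 : (Fin n → 𝕂) × 𝕂)).eventually (eventually_wnorm_lt_one hW)

theorem HasOrder.exists_nonneg (hW : ∀ i, 0 < W i) {e : ℤ} {u : (Fin n → 𝕂) × 𝕂 → 𝕂}
    (hu : HasOrder W w₁ e u) :
    ∃ C : ℝ, 0 ≤ C ∧ ∀ᶠ q in 𝓝 (0 : (Fin n → 𝕂) × 𝕂), q.1 ≠ 0 →
      DifferentiableAt ℝ u q ∧ ‖u q‖ ≤ C * wnorm W q.1 ^ e ∧
        ‖fderiv ℝ u q‖ ≤ C * wnorm W q.1 ^ (e - w₁) := by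
  obtain ⟨C, hC⟩ := hu
  refine ⟨|C|, abs_nonneg C, ?_⟩
  filter_upwards [hC] with q hq h0
  obtain ⟨h1, h2, h3⟩ := hq h0
  have hp := wnorm_pos hW h0
  exact ⟨h1, h2.trans (mul_le_mul_of_nonneg_right (le_abs_self C) (zpow_pos hp _).le),
    h3.trans (mul_le_mul_of_nonneg_right (le_abs_self C) (zpow_pos hp _).le)⟩

theorem HasOrder.mono (hW : ∀ i, 0 < W i) {e e' : ℤ} {u : (Fin n → 𝕂) × 𝕂 → 𝕂}
    (hu : HasOrder W w₁ e u) (he : e' ≤ e) : HasOrder W w₁ e' u := by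
  obtain ⟨C, hC0, hC⟩ := hu.exists_nonneg hW
  refine ⟨C, ?_⟩
  filter_upwards [hC, eventually_wnorm_fst hW] with q hq h1 h0
  obtain ⟨h2, h3, h4⟩ := hq h0
  have hp := wnorm_pos hW h0
  refine ⟨h2, h3.trans (mul_le_mul_of_nonneg_left ?_ hC0),
    h4.trans (mul_le_mul_of_nonneg_left ?_ hC0)⟩
  · exact zpow_le_zpow_right_of_le_one₀ hp h1.le he
  · exact zpow_le_zpow_right_of_le_one₀ hp h1.le (by omega)

theorem HasOrder.add {e : ℤ} {u v : (Fin n → 𝕂) × 𝕂 → 𝕂}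
    (hu : HasOrder W w₁ e u) (hv : HasOrder W w₁ e v) : HasOrder W w₁ e (fun q => u q + v q) := by
  obtain ⟨C, hC⟩ := hu
  obtain ⟨C', hC'⟩ := hv
  refine ⟨C + C', ?_⟩
  filter_upwards [hC, hC'] with q h1 h2 h0
  obtain ⟨a1, a2, a3⟩ := h1 h0
  obtain ⟨b1, b2, b3⟩ := h2 h0
  refine ⟨a1.fun_add b1, ?_, ?_⟩
  · rw [add_mul]
    exact (norm_add_le _ _).trans (add_le_add a2 b2)
  · rw [add_mul, fderiv_fun_add a1 b1]
    exact (norm_add_le _ _).trans (add_le_add a3 b3)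

theorem HasOrder.zero (e : ℤ) : HasOrder W w₁ e (fun _ : (Fin n → 𝕂) × 𝕂 => 0) :=
  ⟨0, .of_forall fun q _ => by simp⟩

theorem HasOrder.sum {ι : Type*} {s : Finset ι} {e : ℤ} {u : ι → (Fin n → 𝕂) × 𝕂 → 𝕂}
    (hu : ∀ i ∈ s, HasOrder W w₁ e (u i)) : HasOrder W w₁ e (fun q => ∑ i ∈ s, u i q) := by
  classical
  induction s using Finset.induction_on with
  | empty => simpa using HasOrder.zero e
  | insert i s hi ih =>
    simp only [Finset.sum_insert hi]
    exact (hu i (Finset.mem_insert_self _ _)).add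
      (ih fun j hj => hu j (Finset.mem_insert_of_mem hj))

theorem HasOrder.mul (hW : ∀ i, 0 < W i) {e e' : ℤ} {u v : (Fin n → 𝕂) × 𝕂 → 𝕂}
    (hu : HasOrder W w₁ e u) (hv : HasOrder W w₁ e' v) :
    HasOrder W w₁ (e + e') (fun q => u q * v q) := by
  obtain ⟨C, hC0, hC⟩ := hu.exists_nonneg hW
  obtain ⟨C', hC0', hC'⟩ := hv.exists_nonneg hW
  refine ⟨2 * (C * C'), ?_⟩
  filter_upwards [hC, hC'] with q h1 h2 h0
  obtain ⟨a1, a2, a3⟩ := h1 h0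
  obtain ⟨b1, b2, b3⟩ := h2 h0
  have hp := wnorm_pos hW h0
  refine ⟨a1.fun_mul b1, ?_, ?_⟩
  · rw [norm_mul, zpow_add₀ hp.ne']
    have : 0 ≤ C * C' * (wnorm W q.1 ^ e * wnorm W q.1 ^ e') := by positivity
    calc ‖u q‖ * ‖v q‖ ≤ (C * wnorm W q.1 ^ e) * (C' * wnorm W q.1 ^ e') :=
          mul_le_mul a2 b2 (norm_nonneg _) (by positivity)
      _ ≤ _ := by linarith
  · rw [fderiv_fun_mul a1 b1]
    have e1 : wnorm W q.1 ^ (e + e' - w₁) = wnorm W q.1 ^ e * wnorm W q.1 ^ (e' - w₁) := by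
      rw [← zpow_add₀ hp.ne']
      ring_nf
    have e2 : wnorm W q.1 ^ (e + e' - w₁) = wnorm W q.1 ^ e' * wnorm W q.1 ^ (e - w₁) := by
      rw [← zpow_add₀ hp.ne']
      ring_nf
    calc _ ≤ ‖u q • fderiv ℝ v q‖ + ‖v q • fderiv ℝ u q‖ := norm_add_le _ _
      _ = ‖u q‖ * ‖fderiv ℝ v q‖ + ‖v q‖ * ‖fderiv ℝ u q‖ := by rw [norm_smul, norm_smul]
      _ ≤ (C * wnorm W q.1 ^ e) * (C' * wnorm W q.1 ^ (e' - w₁))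
          + (C' * wnorm W q.1 ^ e') * (C * wnorm W q.1 ^ (e - w₁)) :=
          add_le_add (mul_le_mul a2 b3 (norm_nonneg _) (by positivity))
            (mul_le_mul b2 a3 (norm_nonneg _) (by positivity))
      _ = C * C' * (wnorm W q.1 ^ e * wnorm W q.1 ^ (e' - w₁))
          + C * C' * (wnorm W q.1 ^ e' * wnorm W q.1 ^ (e - w₁)) := by ring
      _ = _ := by rw [← e1, ← e2]; ring

theorem HasOrder.of_analyticAt (hW : ∀ i, 0 < W i) {u : (Fin n → 𝕂) × 𝕂 → 𝕂}
    (hu : AnalyticAt ℝ u 0) : HasOrder W w₁ 0 u := by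
  have h1 : ∀ᶠ q in 𝓝 (0 : (Fin n → 𝕂) × 𝕂), ‖u q‖ < ‖u 0‖ + 1 :=
    hu.continuousAt.norm.eventually (Iio_mem_nhds (lt_add_one _))
  have h2 : ∀ᶠ q in 𝓝 (0 : (Fin n → 𝕂) × 𝕂), ‖fderiv ℝ u q‖ < ‖fderiv ℝ u 0‖ + 1 :=
    hu.fderiv.continuousAt.norm.eventually (Iio_mem_nhds (lt_add_one _))
  refine ⟨(‖u 0‖ + 1) + (‖fderiv ℝ u 0‖ + 1), ?_⟩
  filter_upwards [h1, h2, hu.eventually_analyticAt, eventually_wnorm_fst hW] with q a b ha hq h0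
  have hp := wnorm_pos hW h0
  refine ⟨ha.differentiableAt, ?_, ?_⟩
  · rw [zpow_zero, mul_one]
    linarith [norm_nonneg (fderiv ℝ u 0)]
  · have h3 : 1 ≤ wnorm W q.1 ^ ((0 : ℤ) - w₁) := one_le_zpow_of_nonpos₀ hp hq.le (by omega)
    calc _ ≤ (‖u 0‖ + 1) + (‖fderiv ℝ u 0‖ + 1) := by linarith [norm_nonneg (u 0)]
      _ ≤ _ := le_mul_of_one_le_right (by positivity) h3

theorem HasOrder.coord (hW : ∀ i, 0 < W i) (hw₁ : ∀ i, W i ≤ w₁) (i : Fin n) :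
    HasOrder W w₁ (W i) (fun q : (Fin n → 𝕂) × 𝕂 => q.1 i) := by
  let L : (Fin n → 𝕂) × 𝕂 →L[ℝ] 𝕂 :=
    (ContinuousLinearMap.proj i).comp (ContinuousLinearMap.fst ℝ (Fin n → 𝕂) 𝕂)
  have hL : ‖L‖ ≤ 1 := ContinuousLinearMap.opNorm_le_bound _ zero_le_one fun q => by
    rw [one_mul]
    exact (norm_le_pi_norm q.1 i).trans (norm_fst_le q)
  refine ⟨1, ?_⟩
  filter_upwards [eventually_wnorm_fst hW] with q hq h0
  have hp := wnorm_pos hW h0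
  refine ⟨L.differentiableAt, ?_, ?_⟩
  · rw [one_mul, zpow_natCast]
    exact norm_coord_le_wnorm_pow hW q.1 i
  · have h1 : fderiv ℝ (fun q : (Fin n → 𝕂) × 𝕂 => q.1 i) q = L := L.fderiv
    rw [h1, one_mul]
    have := hw₁ i
    exact hL.trans (one_le_zpow_of_nonpos₀ hp hq.le (by omega))

theorem HasOrder.conj {e : ℤ} {u : (Fin n → 𝕂) × 𝕂 → 𝕂} (hu : HasOrder W w₁ e u) :
    HasOrder W w₁ e (fun q => (starRingEnd 𝕂) (u q)) := by
  obtain ⟨C, hC⟩ := hu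
  refine ⟨C, ?_⟩
  filter_upwards [hC] with q h1 h0
  obtain ⟨a1, a2, a3⟩ := h1 h0
  have h2 : HasFDerivAt (fun q => (starRingEnd 𝕂) (u q))
      ((RCLike.conjCLE (K := 𝕂) : 𝕂 →L[ℝ] 𝕂).comp (fderiv ℝ u q)) q :=
    (RCLike.conjCLE (K := 𝕂) : 𝕂 →L[ℝ] 𝕂).hasFDerivAt.comp q a1.hasFDerivAt
  refine ⟨h2.differentiableAt, by rwa [RCLike.norm_conj], ?_⟩
  rw [h2.fderiv]
  refine le_trans (ContinuousLinearMap.opNorm_le_bound _ (norm_nonneg _) fun v => ?_) a3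
  simpa using ContinuousLinearMap.le_opNorm (fderiv ℝ u q) v

/-- The lower bound for `u` is what makes the order of the inverse exactly opposite. -/
theorem HasOrder.inv (hW : ∀ i, 0 < W i) {e : ℤ} {u : (Fin n → 𝕂) × 𝕂 → 𝕂}
    (hu : HasOrder W w₁ e u) {c₀ : ℝ} (hc₀ : 0 < c₀)
    (hlow : ∀ᶠ q in 𝓝 (0 : (Fin n → 𝕂) × 𝕂), q.1 ≠ 0 → c₀ * wnorm W q.1 ^ e ≤ ‖u q‖) :
    HasOrder W w₁ (-e) (fun q => (u q)⁻¹) := by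
  obtain ⟨C, hC0, hC⟩ := hu.exists_nonneg hW
  refine ⟨c₀⁻¹ + (c₀⁻¹) ^ 2 * C, ?_⟩
  filter_upwards [hC, hlow] with q h1 h2 h0
  obtain ⟨a1, a2, a3⟩ := h1 h0
  have hp := wnorm_pos hW h0
  have hl := h2 h0
  have hpos : 0 < c₀ * wnorm W q.1 ^ e := by positivity
  have hu0 : u q ≠ 0 := norm_pos_iff.1 (hpos.trans_le hl)
  have hinv : ‖u q‖⁻¹ ≤ c₀⁻¹ * wnorm W q.1 ^ (-e) := by
    rw [zpow_neg, ← mul_inv]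
    exact inv_anti₀ hpos hl
  have h3 : HasFDerivAt (fun q => (u q)⁻¹) ((-(u q ^ 2)⁻¹) • fderiv ℝ u q) q :=
    (hasDerivAt_inv hu0).comp_hasFDerivAt q a1.hasFDerivAt
  refine ⟨h3.differentiableAt, ?_, ?_⟩
  · rw [norm_inv, add_mul]
    have : 0 ≤ c₀⁻¹ ^ 2 * C * wnorm W q.1 ^ (-e) := by positivity
    linarith
  · rw [h3.fderiv, norm_smul, norm_neg, norm_inv, norm_pow, ← inv_pow]
    have e1 : wnorm W q.1 ^ (-e - w₁)
        = (wnorm W q.1 ^ (-e)) ^ 2 * wnorm W q.1 ^ (e - w₁) := by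
      rw [pow_two, ← zpow_add₀ hp.ne', ← zpow_add₀ hp.ne']
      ring_nf
    calc ‖u q‖⁻¹ ^ 2 * ‖fderiv ℝ u q‖
        ≤ (c₀⁻¹ * wnorm W q.1 ^ (-e)) ^ 2 * (C * wnorm W q.1 ^ (e - w₁)) :=
          mul_le_mul (pow_le_pow_left₀ (by positivity) hinv 2) a3 (norm_nonneg _) (by positivity)
      _ = c₀⁻¹ ^ 2 * C * wnorm W q.1 ^ (-e - w₁) := by rw [e1]; ring
      _ ≤ _ := by
          rw [add_mul]
          have : 0 ≤ c₀⁻¹ * wnorm W q.1 ^ (-e - w₁) := by positivity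
          linarith

theorem HasOrder.const (hW : ∀ i, 0 < W i) (a : 𝕂) :
    HasOrder W w₁ 0 (fun _ : (Fin n → 𝕂) × 𝕂 => a) :=
  .of_analyticAt hW analyticAt_const

theorem HasOrder.mon (hW : ∀ i, 0 < W i) (hw₁ : ∀ i, W i ≤ w₁) (β : Fin n →₀ ℕ) :
    HasOrder W w₁ (Finsupp.weight W β) (fun q : (Fin n → 𝕂) × 𝕂 => mon β q.1) := by
  induction β using Finsupp.induction_linear with
  | zero => simpa [mon_zero] using HasOrder.const (𝕂 := 𝕂) (w₁ := w₁) hW 1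
  | add β γ hβ hγ => simpa [mon_add] using hβ.mul hW hγ
  | single i a =>
    simp only [mon_single]
    induction a with
    | zero => simpa using HasOrder.const (𝕂 := 𝕂) (w₁ := w₁) hW 1
    | succ a ih =>
      have := ih.mul hW (HasOrder.coord (𝕂 := 𝕂) hW hw₁ i)
      simp only [← pow_succ] at this
      convert this using 1
      simp [Finsupp.weight_single]

theorem HasOrder.eval (hW : ∀ i, 0 < W i) (hw₁ : ∀ i, W i ≤ w₁) {P : MvPolynomial (Fin n) 𝕂}
    {e : ℕ} (hP : MvPolynomial.IsWeightedHomogeneous W P e) :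
    HasOrder W w₁ e (fun q : (Fin n → 𝕂) × 𝕂 => MvPolynomial.eval q.1 P) := by
  simp only [eval_eq_sum_mon]
  refine HasOrder.sum fun β hβ => ?_
  have h := (HasOrder.const hW (P.coeff β)).mul hW (HasOrder.mon hW hw₁ β)
  rwa [zero_add, hP (MvPolynomial.mem_support_iff.1 hβ)] at h

/-- A function of order at least the maximal weight is Lipschitz in `x`, uniformly in `t`. -/
theorem HasOrder.lipschitzOnWith (hn : 0 < n) (hW : ∀ i, 0 < W i) (hw₁ : ∀ i, W i ≤ w₁)
    {u : (Fin n → 𝕂) × 𝕂 → 𝕂} (hu : HasOrder W w₁ w₁ u) (hu0 : ∀ t, u (0, t) = 0) :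
    ∃ C : ℝ≥0, ∃ U ∈ 𝓝 (0 : Fin n → 𝕂), ∀ᶠ t in 𝓝 (0 : 𝕂),
      LipschitzOnWith C (fun x => u (x, t)) U := by
  obtain ⟨C, hC0, hC⟩ := hu.exists_nonneg hW
  have hC' := hC.and (eventually_wnorm_fst (𝕂 := 𝕂) hW)
  rw [Prod.zero_eq_mk, nhds_prod_eq] at hC'
  obtain ⟨pa, ha, pb, hb, hab⟩ := eventually_prod_iff.1 hC'
  obtain ⟨δ, hδ, hball⟩ := Metric.eventually_nhds_iff_ball.1 ha
  refine ⟨⟨C, hC0⟩, Metric.ball 0 δ, Metric.ball_mem_nhds _ hδ, ?_⟩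
  filter_upwards [hb] with t ht
  have hsmall : ∀ x ∈ Metric.ball (0 : Fin n → 𝕂) δ, ‖u (x, t)‖ ≤ C * ‖x‖ := by
    intro x hx
    by_cases h0 : x = 0
    · rw [h0, hu0, norm_zero, norm_zero, mul_zero]
    · have h1 := hab (hball x hx) ht
      refine (h1.1 h0).2.1.trans (mul_le_mul_of_nonneg_left ?_ hC0)
      rw [zpow_natCast]
      exact wnorm_pow_le_norm hW hn hw₁ h1.2.le
  refine LipschitzOnWith.of_dist_le_mul fun x hx y hy => ?_
  rw [dist_eq_norm, dist_eq_norm]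
  change _ ≤ C * _
  -- The mean value inequality applies unless the segment passes through the origin.
  by_cases h0 : (0 : Fin n → 𝕂) ∈ segment ℝ x y
  · have h1 : ‖x - y‖ = ‖x‖ + ‖y‖ := by
      have := dist_add_dist_of_mem_segment h0
      rw [dist_zero_right, dist_zero_left, dist_eq_norm] at this
      exact this.symm
    rw [h1, mul_add]
    exact (norm_sub_le _ _).trans (add_le_add (hsmall x hx) (hsmall y hy))
  · have hd : ∀ z ∈ segment ℝ x y, HasFDerivWithinAt (fun x => u (x, t))
        ((fderiv ℝ u (z, t)).comp (ContinuousLinearMap.inl ℝ (Fin n → 𝕂) 𝕂)) (segment ℝ x y) z := by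
      intro z hz
      have hz0 : z ≠ 0 := fun h => h0 (h ▸ hz)
      have h1 := (hab (hball z ((convex_ball _ _).segment_subset hx hy hz)) ht).1 hz0
      have h2 : HasFDerivAt (fun x : Fin n → 𝕂 => (x, t))
          (ContinuousLinearMap.inl ℝ (Fin n → 𝕂) 𝕂) z := hasFDerivAt_prodMk_left z t
      exact (h1.1.hasFDerivAt.comp z h2).hasFDerivWithinAt
    have hbd : ∀ z ∈ segment ℝ x y,
        ‖(fderiv ℝ u (z, t)).comp (ContinuousLinearMap.inl ℝ (Fin n → 𝕂) 𝕂)‖ ≤ C := by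
      intro z hz
      have hz0 : z ≠ 0 := fun h => h0 (h ▸ hz)
      have h1 := (hab (hball z ((convex_ball _ _).segment_subset hx hy hz)) ht).1 hz0
      have h2 := h1.2.2
      rw [sub_self, zpow_zero, mul_one] at h2
      refine (ContinuousLinearMap.opNorm_comp_le _ _).trans ?_
      calc _ ≤ C * 1 := mul_le_mul h2 (ContinuousLinearMap.norm_inl_le_one ℝ _ _)
            (norm_nonneg _) hC0
        _ = C := mul_one C
    exact (convex_segment x y).norm_image_sub_le_of_norm_hasFDerivWithin_le hd hbd
      (right_mem_segment ℝ x y) (left_mem_segment ℝ x y)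

end Estimates

/-! ### The trivializing vector field -/

section Field

open MvPolynomial (eval pderiv monomial IsWeightedHomogeneous)

variable {𝕂 : Type*} [RCLike 𝕂] {n : ℕ}

theorem mon_apply_zero {β : Fin n →₀ ℕ} (hβ : β ≠ 0) : mon β (0 : Fin n → 𝕂) = 0 := by
  obtain ⟨i, hi⟩ := Finsupp.ne_iff.1 hβ
  exact Finset.prod_eq_zero (Finset.mem_univ i) (by
    rw [Pi.zero_apply, zero_pow (by simpa using hi)])

theorem analyticAt_det {Z ι : Type*} [NormedAddCommGroup Z] [NormedSpace 𝕂 Z] [Fintype ι]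
    [DecidableEq ι] {A : Z → Matrix ι ι 𝕂} {z : Z}
    (hA : ∀ i j, AnalyticAt 𝕂 (fun q => A q i j) z) : AnalyticAt 𝕂 (fun q => (A q).det) z := by
  simp only [Matrix.det_apply']
  exact Finset.analyticAt_fun_sum _ fun σ _ => analyticAt_const.mul
    (Finset.analyticAt_fun_prod _ fun i _ => hA _ _)

theorem exists_analyticAt_inverse {Z ι : Type*} [NormedAddCommGroup Z] [NormedSpace 𝕂 Z] [Fintype ι]
    [DecidableEq ι] {A : Z → Matrix ι ι 𝕂} {z : Z}
    (hA : ∀ i j, AnalyticAt 𝕂 (fun q => A q i j) z) (hz : A z = 1) :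
    ∃ N : Z → Matrix ι ι 𝕂, (∀ i j, AnalyticAt 𝕂 (fun q => N q i j) z) ∧
      ∀ᶠ q in 𝓝 z, N q * A q = 1 := by
  have hdet := analyticAt_det hA
  have hdet0 : (A z).det ≠ 0 := by simp [hz]
  refine ⟨fun q => (A q)⁻¹, fun i j => ?_, ?_⟩
  · simp only [Matrix.inv_def, Ring.inverse_eq_inv', Matrix.smul_apply, smul_eq_mul,
      Matrix.adjugate_apply]
    refine (hdet.inv hdet0).mul (analyticAt_det fun a b => ?_)
    by_cases h : a = j
    · subst h
      simp only [Matrix.updateRow_self]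
      exact analyticAt_const
    · simp only [Matrix.updateRow_ne h]
      exact hA a b
  · filter_upwards [hdet.continuousAt.eventually_ne hdet0] with q hq
    exact Matrix.nonsing_inv_mul _ (isUnit_iff_ne_zero.2 hq)

/-- If `Γ` generates the monomials of weight at least `c` then it generates all weighted homogeneous
polynomials of degree at least `c`. -/
theorem exists_eq_sum_monomial_mul {W : Fin n → ℕ} {c : ℕ} {Γ : Finset (Fin n →₀ ℕ)}
    (hΓ : ∀ β, c ≤ Finsupp.weight W β → ∃ γ ∈ Γ, γ ≤ β) {P : MvPolynomial (Fin n) 𝕂} {e : ℕ}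
    (hP : IsWeightedHomogeneous W P e) (he : c ≤ e) :
    ∃ Q : (Fin n →₀ ℕ) → MvPolynomial (Fin n) 𝕂, P = ∑ γ ∈ Γ, monomial γ 1 * Q γ := by
  have hmem : P ∈ Ideal.span ((fun γ => monomial γ (1 : 𝕂)) '' (Γ : Set (Fin n →₀ ℕ))) := by
    rw [P.as_sum]
    refine Ideal.sum_mem _ fun β hβ => ?_
    obtain ⟨γ, hγ, hγβ⟩ := hΓ β (by rwa [hP (MvPolynomial.mem_support_iff.1 hβ)])
    have h1 : monomial β (P.coeff β) = monomial (β - γ) (P.coeff β) * monomial γ 1 := by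
      rw [MvPolynomial.monomial_mul, tsub_add_cancel_of_le hγβ, mul_one]
    rw [h1]
    exact Ideal.mul_mem_left _ _ (Ideal.subset_span ⟨γ, hγ, rfl⟩)
  obtain ⟨Q, hQ⟩ := (Submodule.mem_span_image_finset_iff_exists_fun _).1 hmem
  classical
  refine ⟨fun γ => if h : γ ∈ Γ then Q ⟨γ, h⟩ else 0, ?_⟩
  rw [← hQ, ← Finset.sum_coe_sort Γ]
  refine Finset.sum_congr rfl fun γ _ => ?_
  dsimp only
  rw [dif_pos γ.2, smul_eq_mul, mul_comm]

/-- Stated without subtraction, the degree is `(weight β - W j) + (a + W j)`; the derivative is zero if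
`β` does not involve the variable `j`. -/
theorem isWeightedHomogeneous_pderiv_monomial_mul {W : Fin n → ℕ} {β : Fin n →₀ ℕ} {j : Fin n}
    {P : MvPolynomial (Fin n) 𝕂} {a : ℕ} (hP : IsWeightedHomogeneous W P (a + W j)) :
    IsWeightedHomogeneous W (pderiv j (monomial β 1) * P) (Finsupp.weight W β + a) := by
  by_cases hj : β j = 0
  · have : pderiv j (monomial β (1 : 𝕂)) = 0 := by simp [MvPolynomial.pderiv_monomial, hj]
    rw [this, zero_mul]
    exact MvPolynomial.isWeightedHomogeneous_zero _ _ _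
  · have h1 : β = (β - Finsupp.single j 1) + Finsupp.single j 1 := by
      rw [tsub_add_cancel_of_le]
      rw [Finsupp.single_le_iff]
      omega
    have h2 : Finsupp.weight W β = Finsupp.weight W (β - Finsupp.single j 1) + W j := by
      conv_lhs => rw [h1, map_add]
      simp [Finsupp.weight_single]
    have h3 := ((MvPolynomial.isWeightedHomogeneous_monomial W β (1 : 𝕂) rfl).pderiv
      (i := j) h2.symm).mul hP
    rwa [h2, add_assoc, add_comm (W j)]

variable {F : (Fin n → 𝕂) × 𝕂 → 𝕂} {f₀ : MvPolynomial (Fin n) 𝕂} {B : Finset (Fin n →₀ ℕ)}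
  {h : (Fin n →₀ ℕ) → (Fin n → 𝕂) × 𝕂 → 𝕂}

theorem eventually_hasFDerivAt_deformation (hh : ∀ β, AnalyticAt 𝕂 (h β) 0)
    (hF : ∀ᶠ q in 𝓝 (0 : (Fin n → 𝕂) × 𝕂), F q = eval q.1 f₀ + ∑ β ∈ B, mon β q.1 * h β q) :
    ∀ᶠ q in 𝓝 (0 : (Fin n → 𝕂) × 𝕂), DifferentiableAt 𝕂 F q ∧ ∀ z, fderiv 𝕂 F q z
      = ∑ j, eval q.1 (pderiv j f₀) * z.1 j
        + ∑ β ∈ B, (mon β q.1 * fderiv 𝕂 (h β) q z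
          + (∑ j, eval q.1 (pderiv j (monomial β 1)) * z.1 j) * h β q) := by
  have hha : ∀ᶠ q in 𝓝 (0 : (Fin n → 𝕂) × 𝕂), ∀ β ∈ B, AnalyticAt 𝕂 (h β) q :=
    (Finset.eventually_all _).2 fun β _ => (hh β).eventually_analyticAt
  filter_upwards [hF.eventually_nhds, hha] with q hq ha
  have hcomp : ∀ P : MvPolynomial (Fin n) 𝕂, HasFDerivAt (fun q : (Fin n → 𝕂) × 𝕂 => eval q.1 P)
      ((∑ j, eval q.1 (pderiv j P) • (ContinuousLinearMap.proj j : (Fin n → 𝕂) →L[𝕂] 𝕂)).comp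
        (ContinuousLinearMap.fst 𝕂 (Fin n → 𝕂) 𝕂)) q :=
    fun P => (hasFDerivAt_eval P q.1).comp q hasFDerivAt_fst
  have h1 := ((hcomp f₀).add (HasFDerivAt.fun_sum fun β hβ =>
    (hcomp (monomial β 1)).mul (ha β hβ).differentiableAt.hasFDerivAt)).congr_of_eventuallyEq
    (f₁ := F) (by
      filter_upwards [hq] with y hy
      rw [hy]
      simp only [Pi.add_apply, Pi.mul_apply, eval_monomial_one])
  refine ⟨h1.differentiableAt, fun z => ?_⟩
  rw [h1.fderiv]
  simp [eval_monomial_one, sum_apply, mul_comm]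

/-- A function which is zero for `t = 0` has no derivative in the directions of `x` there. -/
theorem fderiv_eq_zero_of_slice {u : (Fin n → 𝕂) × 𝕂 → 𝕂} (hu : AnalyticAt 𝕂 u 0)
    (hu0 : ∀ x, u (x, 0) = 0) (v : Fin n → 𝕂) : fderiv 𝕂 u 0 (v, 0) = 0 := by
  have h1 : HasFDerivAt (fun x : Fin n → 𝕂 => u (x, 0))
      ((fderiv 𝕂 u 0).comp (ContinuousLinearMap.inl 𝕂 (Fin n → 𝕂) 𝕂)) 0 :=
    HasFDerivAt.comp (g := u) 0 hu.differentiableAt.hasFDerivAt (hasFDerivAt_prodMk_left 0 0)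
  simp only [hu0] at h1
  have h2 := h1.unique (hasFDerivAt_const 0 0)
  simpa using congrArg (fun L => L v) h2

/-- The derivatives of the deformation along the fields `η γ` are the monomials of `Γ`, up to an
analytic matrix which is invertible at the origin. -/
theorem exists_matrix_of_deformation {W : Fin n → ℕ} {c d D : ℕ} {Γ : Finset (Fin n →₀ ℕ)}
    (hΓ : ∀ β, c ≤ Finsupp.weight W β → ∃ γ ∈ Γ, γ ≤ β) (hΓc : ∀ γ ∈ Γ, c ≤ Finsupp.weight W γ)
    (hdD : d ≤ D) (hB : ∀ β ∈ B, D ≤ Finsupp.weight W β)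
    (hh : ∀ β, AnalyticAt 𝕂 (h β) 0) (hh0 : ∀ β x, h β (x, 0) = 0)
    (hF : ∀ᶠ q in 𝓝 (0 : (Fin n → 𝕂) × 𝕂), F q = eval q.1 f₀ + ∑ β ∈ B, mon β q.1 * h β q)
    {η : (Fin n →₀ ℕ) → Fin n → MvPolynomial (Fin n) 𝕂}
    (hη : ∀ γ ∈ Γ, ∑ j, pderiv j f₀ * η γ j = monomial γ 1)
    (hηW : ∀ γ ∈ Γ, ∀ j, IsWeightedHomogeneous W (η γ j) (Finsupp.weight W γ - d + W j)) :
    ∃ A : (Fin n →₀ ℕ) → (Fin n →₀ ℕ) → (Fin n → 𝕂) × 𝕂 → 𝕂,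
      (∀ γ δ, AnalyticAt 𝕂 (A γ δ) 0) ∧ (∀ γ δ, A γ δ 0 = 0) ∧
      ∀ᶠ q in 𝓝 (0 : (Fin n → 𝕂) × 𝕂), ∀ γ ∈ Γ,
        fderiv 𝕂 F q (fun j => eval q.1 (η γ j), 0)
          = mon γ q.1 + ∑ δ ∈ Γ, A γ δ q * mon δ q.1 := by
  have h1 : ∀ β ∈ B, ∀ γ ∈ Γ, ∀ j, ∃ Q : (Fin n →₀ ℕ) → MvPolynomial (Fin n) 𝕂,
      pderiv j (monomial β 1) * η γ j = ∑ δ ∈ Γ, monomial δ 1 * Q δ := by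
    intro β hβ γ hγ j
    refine exists_eq_sum_monomial_mul hΓ
      (isWeightedHomogeneous_pderiv_monomial_mul (hηW γ hγ j)) ?_
    have := hB β hβ
    have := hΓc γ hγ
    omega
  have h2 : ∀ β ∈ B, ∀ γ ∈ Γ, ∀ j, ∃ Q : (Fin n →₀ ℕ) → MvPolynomial (Fin n) 𝕂,
      monomial β 1 * η γ j = ∑ δ ∈ Γ, monomial δ 1 * Q δ := by
    intro β hβ γ hγ j
    refine exists_eq_sum_monomial_mul hΓ
      ((MvPolynomial.isWeightedHomogeneous_monomial W β (1 : 𝕂) rfl).mul (hηW γ hγ j)) ?_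
    have := hB β hβ
    have := hΓc γ hγ
    omega
  choose! Q₁ hQ₁ using h1
  choose! Q₂ hQ₂ using h2
  -- The product rule for `x ^ β h β`; `h β` and its derivatives in `x` vanish at `t = 0`.
  refine ⟨fun γ δ q => ∑ β ∈ B, ∑ j, (eval q.1 (Q₁ β γ j δ) * h β q
      + eval q.1 (Q₂ β γ j δ) * fderiv 𝕂 (h β) q (Pi.single j 1, 0)), fun γ δ => ?_, fun γ δ => ?_, ?_⟩
  · have h3 : ∀ P : MvPolynomial (Fin n) 𝕂,
        AnalyticAt 𝕂 (fun q : (Fin n → 𝕂) × 𝕂 => eval q.1 P) 0 := fun P =>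
      (analyticAt_eval P 0).fun_comp_of_eq analyticAt_fst rfl
    refine Finset.analyticAt_fun_sum _ fun β _ => Finset.analyticAt_fun_sum _ fun j _ => ?_
    exact ((h3 _).mul (hh β)).add ((h3 _).mul (analyticAt_fderiv_apply (hh β) analyticAt_const))
  · refine Finset.sum_eq_zero fun β _ => Finset.sum_eq_zero fun j _ => ?_
    have h4 : h β 0 = 0 := hh0 β 0
    rw [h4, fderiv_eq_zero_of_slice (hh β) (hh0 β), mul_zero, mul_zero, add_zero]
  · filter_upwards [eventually_hasFDerivAt_deformation hh hF] with q hq γ hγ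
    rw [hq.2]
    have e0 : ∑ j, eval q.1 (pderiv j f₀) * eval q.1 (η γ j) = mon γ q.1 := by
      have := congrArg (eval q.1) (hη γ hγ)
      simpa only [map_sum, map_mul, eval_monomial_one] using this
    rw [e0]
    congr 1
    have e1 : ∀ β ∈ B, ∀ j, eval q.1 (pderiv j (monomial β 1)) * eval q.1 (η γ j)
        = ∑ δ ∈ Γ, mon δ q.1 * eval q.1 (Q₁ β γ j δ) := by
      intro β hβ j
      have := congrArg (eval q.1) (hQ₁ β hβ γ hγ j)
      simpa only [map_sum, map_mul, eval_monomial_one] using this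
    have e2 : ∀ β ∈ B, ∀ j, mon β q.1 * eval q.1 (η γ j)
        = ∑ δ ∈ Γ, mon δ q.1 * eval q.1 (Q₂ β γ j δ) := by
      intro β hβ j
      have := congrArg (eval q.1) (hQ₂ β hβ γ hγ j)
      simpa only [map_sum, map_mul, eval_monomial_one] using this
    have e3 : ∀ L : (Fin n → 𝕂) × 𝕂 →L[𝕂] 𝕂, L (fun j => eval q.1 (η γ j), 0)
        = ∑ j, eval q.1 (η γ j) * L (Pi.single j 1, 0) := by
      intro L
      have := congrArg (L.comp (ContinuousLinearMap.inl 𝕂 (Fin n → 𝕂) 𝕂))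
        (pi_eq_sum_univ' fun j => eval q.1 (η γ j))
      simpa only [map_sum, map_smul, smul_eq_mul, ContinuousLinearMap.comp_apply,
        ContinuousLinearMap.inl_apply] using this
    simp only [Finset.sum_mul]
    rw [Finset.sum_comm]
    refine Finset.sum_congr rfl fun β hβ => ?_
    rw [Finset.sum_comm, e3, Finset.mul_sum, ← Finset.sum_add_distrib]
    refine Finset.sum_congr rfl fun j _ => ?_
    rw [e1 β hβ j, ← mul_assoc, e2 β hβ j, Finset.sum_mul, Finset.sum_mul,
      ← Finset.sum_add_distrib]
    exact Finset.sum_congr rfl fun δ _ => by ring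

theorem exists_lipschitzOnWith_pi {V : (Fin n → 𝕂) × 𝕂 → Fin n → 𝕂}
    (hV : ∀ i, ∃ C : ℝ≥0, ∃ U ∈ 𝓝 (0 : Fin n → 𝕂), ∀ᶠ t in 𝓝 (0 : 𝕂),
      LipschitzOnWith C (fun x => V (x, t) i) U) :
    ∃ C : ℝ≥0, ∃ U ∈ 𝓝 (0 : Fin n → 𝕂), ∀ᶠ t in 𝓝 (0 : 𝕂),
      ∀ i, LipschitzOnWith C (fun x => V (x, t) i) U := by
  choose C U hU hL using hV
  refine ⟨∑ i, C i, ⋂ i, U i, Filter.iInter_mem.2 hU, ?_⟩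
  filter_upwards [eventually_all.2 hL] with t ht i
  exact ((ht i).mono (Set.iInter_subset _ i)).weaken
    (Finset.single_le_sum (fun _ _ => zero_le) (Finset.mem_univ i))

/-- Construction of the trivializing vector field: if `ρ ∂F/∂t` is a combination of the monomials of
`Γ` with coefficients of sufficiently high order, then `ρ ∂F/∂t` is the derivative of `F` along a
combination of the fields `η γ`, whose quotient by `ρ` is Lipschitz. -/
theorem stronglyRationalBiLipschitzTrivial_of_control {X : Set (Fin n → 𝕂)} (hn : 0 < n)
    {W : Fin n → ℕ} (hW : ∀ i, 0 < W i) {w₁ w₂ : ℕ} (hw₁ : ∀ i, W i ≤ w₁) (hw₂ : ∀ i, w₂ ≤ W i)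
    {c d D r : ℕ} (hd : 0 < d) (hD : D + w₂ = d + w₁) {Γ : Finset (Fin n →₀ ℕ)}
    (hΓ : ∀ β, c ≤ Finsupp.weight W β → ∃ γ ∈ Γ, γ ≤ β) (hΓc : ∀ γ ∈ Γ, c ≤ Finsupp.weight W γ)
    (hdc : d ≤ c) (hB : ∀ β ∈ B, D ≤ Finsupp.weight W β)
    (hh : ∀ β, AnalyticAt 𝕂 (h β) 0) (hh0 : ∀ β x, h β (x, 0) = 0)
    (hF : ∀ᶠ q in 𝓝 (0 : (Fin n → 𝕂) × 𝕂), F q = eval q.1 f₀ + ∑ β ∈ B, mon β q.1 * h β q)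
    {η : (Fin n →₀ ℕ) → Fin n → MvPolynomial (Fin n) 𝕂}
    (hη : ∀ γ ∈ Γ, ∑ j, pderiv j f₀ * η γ j = monomial γ 1)
    (hηX : ∀ γ ∈ Γ, IsTangentField X (fun x i => eval x (η γ i)))
    (hηW : ∀ γ ∈ Γ, ∀ j, IsWeightedHomogeneous W (η γ j) (Finsupp.weight W γ - d + W j))
    {ρ : (Fin n → 𝕂) → ℝ} (hρ : IsControlFunction ρ)
    (hρr : HasOrder W w₁ r (fun q : (Fin n → 𝕂) × 𝕂 => ((ρ q.1 : ℝ) : 𝕂)))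
    {c₀ : ℝ} (hc₀ : 0 < c₀) (hρlow : ∀ᶠ x in 𝓝 (0 : Fin n → 𝕂), c₀ * wnorm W x ^ r ≤ ρ x)
    {R : (Fin n →₀ ℕ) → (Fin n → 𝕂) × 𝕂 → 𝕂} (hR : ∀ γ, AnalyticAt ℝ (R γ) 0)
    (hR0 : ∀ γ t, R γ (0, t) = 0) (hRr : ∀ γ, HasOrder W w₁ ((r : ℤ) - c + D) (R γ))
    (hρF : ∀ᶠ q in 𝓝 (0 : (Fin n → 𝕂) × 𝕂),
      ((ρ q.1 : ℝ) : 𝕂) * ∑ β ∈ B, mon β q.1 * fderiv 𝕂 (h β) q (0, 1)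
        = ∑ γ ∈ Γ, R γ q * mon γ q.1) :
    StronglyRationalBiLipschitzTrivial X F := by
  have hw12 : w₂ ≤ w₁ := (hw₂ ⟨0, hn⟩).trans (hw₁ ⟨0, hn⟩)
  obtain ⟨A, hA, hA0, hAF⟩ := exists_matrix_of_deformation hΓ hΓc (by omega : d ≤ D) hB hh hh0 hF
    hη hηW
  classical
  obtain ⟨N, hN, hNA⟩ := exists_analyticAt_inverse (ι := Γ) (z := (0 : (Fin n → 𝕂) × 𝕂))
    (A := fun q => 1 + Matrix.of fun γ δ => A γ.1 δ.1 q)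
    (fun γ δ => by
      simp only [Matrix.add_apply, Matrix.of_apply]
      exact analyticAt_const.add (hA _ _))
    (by
      ext γ δ
      simp [hA0])
  -- The coefficients of the field: `R` multiplied by the inverse `N` of the matrix `1 + A`.
  let b : Γ → (Fin n → 𝕂) × 𝕂 → 𝕂 := fun γ q => ∑ δ : Γ, R δ.1 q * N q δ γ
  have hNr : ∀ γ δ, AnalyticAt ℝ (fun q => N q γ δ) 0 := fun γ δ => (hN γ δ).restrictScalars
  have hb : ∀ γ, AnalyticAt ℝ (b γ) 0 := fun γ =>
    Finset.analyticAt_fun_sum _ fun δ _ => (hR δ.1).mul (hNr δ γ)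
  have hb0 : ∀ γ t, b γ (0, t) = 0 := fun γ t => by simp [b, hR0]
  have hbr : ∀ γ, HasOrder W w₁ ((r : ℤ) - c + D) (b γ) := fun γ => HasOrder.sum fun δ _ => by
    have := (hRr δ.1).mul hW (HasOrder.of_analyticAt hW (hNr δ γ))
    rwa [add_zero] at this
  let v : (Fin n → 𝕂) × 𝕂 → Fin n → 𝕂 := fun q => ∑ γ : Γ, b γ q • fun i => eval q.1 (η γ.1 i)
  let V : (Fin n → 𝕂) × 𝕂 → Fin n → 𝕂 := fun q => (ρ q.1)⁻¹ • v q
  have hρ0 : ρ 0 = 0 := (hρ.eq_zero_iff 0).2 rfl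
  have hV0 : ∀ t, V (0, t) = 0 := fun t => by simp [V, hρ0]
  have hvV : ∀ q, ρ q.1 • V q = v q := by
    rintro ⟨x, t⟩
    by_cases hx : x = 0
    · subst hx
      simp [v, hb0, hρ0]
    · exact smul_inv_smul₀ (fun h0 => hx ((hρ.eq_zero_iff x).1 h0)) _
  refine ⟨ρ, v, V, hρ, ?_, .of_forall hvV, .of_forall hV0, ?_, ?_⟩
  · let σ := Γ.equivFin
    refine ⟨Γ.card, fun j x i => eval x (η (σ.symm j).1 i), fun j => b (σ.symm j),
      fun j => hηX _ (σ.symm j).2, fun j => hb _, .of_forall fun q => ?_⟩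
    exact (Equiv.sum_comp σ.symm fun γ : Γ => b γ q • fun i => eval q.1 (η γ.1 i)).symm
  · refine exists_lipschitzOnWith_pi fun i =>
      HasOrder.lipschitzOnWith hn hW hw₁ (u := fun q => V q i) ?_ fun t => by simp [hV0]
    have h1 : HasOrder W w₁ (-(r : ℤ)) fun q : (Fin n → 𝕂) × 𝕂 => (((ρ q.1 : ℝ) : 𝕂))⁻¹ := by
      refine hρr.inv hW hc₀ ?_
      filter_upwards [(continuous_fst.tendsto (0 : (Fin n → 𝕂) × 𝕂)).eventually hρlow] with q hq _
      rw [zpow_natCast, RCLike.norm_ofReal, abs_of_nonneg (hρ.nonneg _)]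
      exact hq
    have h2 : HasOrder W w₁ ((r : ℤ) - c + D + (c - d + W i))
        fun q : (Fin n → 𝕂) × 𝕂 => ∑ γ : Γ, b γ q * eval q.1 (η γ.1 i) := by
      refine HasOrder.sum fun γ _ => ((hbr γ).mul hW (HasOrder.eval hW hw₁ (hηW γ.1 γ.2 i))).mono hW ?_
      have := hΓc γ.1 γ.2
      push_cast [Nat.cast_sub (hdc.trans this)]
      omega
    -- `-r + (r - c + D) + (c - d + W i) = D - d + W i = w₁ - w₂ + W i ≥ w₁`
    have h3 := (h1.mul hW h2).mono hW (e' := w₁) (by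
      have := hw₂ i
      omega)
    convert h3 using 2 with q
    simp [V, v, RCLike.real_smul_eq_coe_mul, Finset.sum_apply]
  · filter_upwards [eventually_hasFDerivAt_deformation hh hF, hAF, hNA, hρF] with q h1 h2 h3 h4
    have hx : HasFDerivAt (fun y => F (y, q.2))
        ((fderiv 𝕂 F q).comp (ContinuousLinearMap.inl 𝕂 (Fin n → 𝕂) 𝕂)) q.1 :=
      HasFDerivAt.comp (g := F) q.1 h1.1.hasFDerivAt (hasFDerivAt_prodMk_left q.1 q.2)
    have ht : HasDerivAt (fun s => F (q.1, s)) (fderiv 𝕂 F q (0, 1)) q.2 := by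
      have h5 : HasFDerivAt (fun s => F (q.1, s))
          ((fderiv 𝕂 F q).comp (ContinuousLinearMap.inr 𝕂 (Fin n → 𝕂) 𝕂)) q.2 :=
        HasFDerivAt.comp (g := F) q.2 h1.1.hasFDerivAt (hasFDerivAt_prodMk_right q.1 q.2)
      simpa using h5.hasDerivAt
    rw [ht.deriv, hx.fderiv, ContinuousLinearMap.comp_apply, ContinuousLinearMap.inl_apply]
    have ht' : fderiv 𝕂 F q (0, 1) = ∑ β ∈ B, mon β q.1 * fderiv 𝕂 (h β) q (0, 1) := by
      rw [h1.2]
      simp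
    rw [ht']
    by_cases hq0 : q.1 = 0
    · have hVq : V q = 0 := by
        rw [show q = (0, q.2) from Prod.ext hq0 rfl]
        exact hV0 q.2
      rw [hVq, show ((0 : Fin n → 𝕂), (0 : 𝕂)) = 0 from rfl, map_zero]
      refine Finset.sum_eq_zero fun β hβ => ?_
      have hβ0 : β ≠ 0 := by
        rintro rfl
        have := hB 0 hβ
        rw [map_zero] at this
        omega
      rw [hq0, mon_apply_zero hβ0, zero_mul]
    · have hρq : ((ρ q.1 : ℝ) : 𝕂) ≠ 0 := by
        rw [Ne, RCLike.ofReal_eq_zero, hρ.eq_zero_iff]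
        exact hq0
      refine mul_left_cancel₀ hρq ?_
      rw [h4]
      have e1 : ((ρ q.1 : ℝ) : 𝕂) * fderiv 𝕂 F q (V q, 0) = fderiv 𝕂 F q (v q, 0) := by
        rw [← smul_eq_mul, ← map_smul, ← hvV q]
        congr 1
        ext i
        · simp [RCLike.real_smul_eq_coe_mul]
        · simp
      have e2 : fderiv 𝕂 F q (v q, 0)
          = ∑ γ : Γ, b γ q * fderiv 𝕂 F q (fun j => eval q.1 (η γ.1 j), 0) := by
        have := map_sum ((fderiv 𝕂 F q).comp (ContinuousLinearMap.inl 𝕂 (Fin n → 𝕂) 𝕂))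
          (fun γ : Γ => b γ q • fun i => eval q.1 (η γ.1 i)) Finset.univ
        simpa only [map_smul, smul_eq_mul, ContinuousLinearMap.comp_apply,
          ContinuousLinearMap.inl_apply] using this
      have e3 : ∀ γ : Γ, fderiv 𝕂 F q (fun j => eval q.1 (η γ.1 j), 0)
          = ∑ δ : Γ, ((1 : Matrix Γ Γ 𝕂) + Matrix.of fun γ δ : Γ => A γ.1 δ.1 q) γ δ * mon δ.1 q.1 := by
        intro γ
        rw [h2 γ.1 γ.2, ← Finset.sum_coe_sort Γ]
        simp [add_mul, Finset.sum_add_distrib, Matrix.one_apply]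
      rw [e1, e2, ← Finset.sum_coe_sort Γ]
      simp only [e3, b]
      have e4 : (fun δ : Γ => R δ.1 q) ⬝ᵥ (fun δ : Γ => mon δ.1 q.1)
          = Matrix.vecMul (fun δ : Γ => R δ.1 q) (N q) ⬝ᵥ
            Matrix.mulVec (1 + Matrix.of fun γ δ : Γ => A γ.1 δ.1 q) fun δ : Γ => mon δ.1 q.1 := by
        rw [Matrix.dotProduct_mulVec, Matrix.vecMul_vecMul, h3, Matrix.vecMul_one]
      exact e4

end Field

/-! ### Factorizations of a polynomial in the plane -/

section Newton

open MvPolynomial (weightedHomogeneousComponent IsWeightedHomogeneous idealOfVars monomial aeval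
  constantCoeff)

theorem aeval_scale_of_isWeightedHomogeneous {σ k A : Type*} [CommSemiring k] [CommSemiring A]
    [Algebra k A] {W : σ → ℕ} {P : MvPolynomial σ k} {e : ℕ} (hP : IsWeightedHomogeneous W P e)
    (a : A) (x : σ → A) : aeval (fun i => a ^ W i * x i) P = a ^ e * aeval x P := by
  rw [MvPolynomial.aeval_def, MvPolynomial.aeval_def, MvPolynomial.eval₂_eq, MvPolynomial.eval₂_eq,
    Finset.mul_sum]
  refine Finset.sum_congr rfl fun β hβ => ?_
  have h := hP (MvPolynomial.mem_support_iff.1 hβ)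
  rw [← h, Finsupp.weight_apply, Finsupp.sum, ← Finset.prod_pow_eq_pow_sum]
  simp only [mul_pow, Finset.prod_mul_distrib, smul_eq_mul, ← pow_mul]
  simp only [mul_comm]
  ac_rfl

/-- Separation of the weighted homogeneous components by a new variable. -/
noncomputable def gradingHom {σ k : Type*} [CommRing k] (W : σ → ℕ) :
    MvPolynomial σ k →ₐ[k] Polynomial (MvPolynomial σ k) :=
  aeval fun i => Polynomial.monomial (W i) (MvPolynomial.X i)

theorem gradingHom_monomial {σ k : Type*} [CommRing k] (W : σ → ℕ) (β : σ →₀ ℕ) (a : k) :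
    gradingHom W (monomial β a) = Polynomial.monomial (Finsupp.weight W β) (monomial β a) := by
  induction β using Finsupp.induction_linear generalizing a with
  | zero =>
    rw [map_zero, ← MvPolynomial.C_apply, gradingHom, MvPolynomial.aeval_C]
    rfl
  | add β γ hβ hγ =>
    have h1 : monomial (β + γ) a = monomial β a * monomial γ 1 := by
      rw [MvPolynomial.monomial_mul, mul_one]
    rw [h1, map_mul, hβ, hγ, Polynomial.monomial_mul_monomial, map_add]
  | single i b =>
    have h1 : monomial (Finsupp.single i b) a = MvPolynomial.C a * MvPolynomial.X i ^ b :=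
      MvPolynomial.monomial_eq.trans (by simp)
    rw [h1, map_mul, map_pow, gradingHom, MvPolynomial.aeval_C, MvPolynomial.aeval_X,
      Polynomial.monomial_pow, Finsupp.weight_single, smul_eq_mul, mul_comm b]
    change Polynomial.C (MvPolynomial.C a) * _ = _
    rw [Polynomial.C_mul_monomial]

theorem coeff_gradingHom {σ k : Type*} [CommRing k] (W : σ → ℕ) (P : MvPolynomial σ k) (e : ℕ) :
    (gradingHom W P).coeff e = weightedHomogeneousComponent W e P := by
  classical
  induction P using MvPolynomial.induction_on' with
  | monomial β a =>
    rw [gradingHom_monomial, Polynomial.coeff_monomial]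
    ext γ
    rw [MvPolynomial.coeff_weightedHomogeneousComponent]
    split_ifs with h1 h2 h2
    · rfl
    · rw [MvPolynomial.coeff_monomial, if_neg]
      rintro rfl
      exact h2 h1
    · rw [MvPolynomial.coeff_monomial, if_neg, MvPolynomial.coeff_zero]
      rintro rfl
      exact h1 h2
    · rfl
  | add p q hp hq => rw [map_add, Polynomial.coeff_add, hp, hq, map_add]

/-- The two lowest coefficients of a product. -/
theorem exists_lowest_coeff {R : Type*} [CommRing R] [IsDomain R] {g h : Polynomial R} {K : ℕ}
    (h0 : ∀ k < K, (g * h).coeff k = 0) (h1 : (g * h).coeff K ≠ 0) :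
    ∃ a b, a + b = K ∧ g.coeff a * h.coeff b = (g * h).coeff K ∧
      g.coeff a * h.coeff (b + 1) + g.coeff (a + 1) * h.coeff b = (g * h).coeff (K + 1) := by
  have hgh : g * h ≠ 0 := fun h => h1 (by rw [h, Polynomial.coeff_zero])
  have hg : g ≠ 0 := left_ne_zero_of_mul hgh
  have hh : h ≠ 0 := right_ne_zero_of_mul hgh
  obtain ⟨g', hg'⟩ := Polynomial.X_pow_dvd_iff.2 fun k (hk : k < g.natTrailingDegree) =>
    Polynomial.coeff_eq_zero_of_lt_natTrailingDegree hk
  obtain ⟨h', hh'⟩ := Polynomial.X_pow_dvd_iff.2 fun k (hk : k < h.natTrailingDegree) =>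
    Polynomial.coeff_eq_zero_of_lt_natTrailingDegree hk
  have hK : g.natTrailingDegree + h.natTrailingDegree = K := by
    rw [← Polynomial.natTrailingDegree_mul hg hh]
    refine le_antisymm (Polynomial.natTrailingDegree_le_of_ne_zero h1) ?_
    by_contra hlt
    have := h0 _ (not_le.1 hlt)
    rw [← Polynomial.trailingCoeff, Polynomial.trailingCoeff_eq_zero] at this
    exact hgh this
  refine ⟨g.natTrailingDegree, h.natTrailingDegree, hK, ?_, ?_⟩
  · rw [← hK]
    exact Polynomial.coeff_mul_natTrailingDegree_add_natTrailingDegree.symm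
  · generalize g.natTrailingDegree = a at *
    generalize h.natTrailingDegree = b at *
    subst hK
    subst hg' hh'
    have e1 : (Polynomial.X ^ a * g' * (Polynomial.X ^ b * h')) =
      Polynomial.X ^ (a + b) * (g' * h') := by ring
    have e2 : ∀ (f : Polynomial R) (a : ℕ), (Polynomial.X ^ a * f).coeff a = f.coeff 0 := fun f a => by
      simpa using Polynomial.coeff_X_pow_mul f a 0
    have e3 : ∀ (f : Polynomial R) (a : ℕ), (Polynomial.X ^ a * f).coeff (a + 1) = f.coeff 1 :=
      fun f a => by rw [add_comm, Polynomial.coeff_X_pow_mul]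
    rw [e1, e2, e2, e3, e3, e3, Polynomial.mul_coeff_one]

variable {p q m u v : ℕ}

/-- A weighted homogeneous factor of `(x ^ (2p) + y ^ (2q)) ^ m` which does not vanish at one point
`(ζ, 1)` with `ζ ^ p = i` does not vanish at any `(z, 1)`, by the symmetries of the zero set
`x ^ (2p) + y ^ (2q) = 0`, and therefore has degree zero. -/
theorem eq_zero_of_dvd_pow (hp : 0 < p) (hq : 0 < q) (huv : q * u + p * v = p * q * m + 1)
    {W : Fin 2 → ℕ} (hW0 : W 0 = q) (hW1 : W 1 = p) {a : ℕ} {G H : MvPolynomial (Fin 2) ℝ}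
    (hG : IsWeightedHomogeneous W G a)
    (hGH : G * H = (MvPolynomial.X 0 ^ (2 * p) + MvPolynomial.X 1 ^ (2 * q)) ^ m) {ζ : ℂ}
    (hζ : ζ ^ p = Complex.I) (hGζ : aeval ![ζ, 1] G ≠ 0) : a = 0 := by
  have hζ0 : ζ ≠ 0 := by
    rintro rfl
    rw [zero_pow hp.ne'] at hζ
    exact Complex.I_ne_zero hζ.symm
  have hscale : ∀ s x y : ℂ, aeval ![s ^ q * x, s ^ p * y] G = s ^ a * aeval ![x, y] G := by
    intro s x y
    rw [← aeval_scale_of_isWeightedHomogeneous hG]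
    congr 2
    funext i
    fin_cases i <;> simp [hW0, hW1]
  have hprod : ∀ x y : ℂ, aeval ![x, y] G * aeval ![x, y] H = (x ^ (2 * p) + y ^ (2 * q)) ^ m := by
    intro x y
    rw [← map_mul, hGH]
    simp
  have hconj : ∀ z : ℂ, aeval ![(starRingEnd ℂ) z, 1] G = (starRingEnd ℂ) (aeval ![z, 1] G) := by
    intro z
    have := MvPolynomial.comp_aeval_apply (f := ![z, 1]) (Complex.conjAe.toAlgHom) G
    refine Eq.trans ?_ this.symm
    congr 2
    funext i
    fin_cases i <;> simp
  -- the rotations by `p`-th roots of unity act transitively on the solutions of `z ^ p = i`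
  have hrot : ∀ z : ℂ, z ^ p = Complex.I → aeval ![z, 1] G ≠ 0 := by
    intro z hz
    have hω : (z / ζ) ^ p = 1 := by rw [div_pow, hz, hζ, div_self Complex.I_ne_zero]
    have h1 : (z / ζ) ^ (q * u) = z / ζ := by
      have h2 : (z / ζ) ^ (q * u + p * v) = (z / ζ) ^ (p * q * m + 1) := by rw [huv]
      rwa [pow_add, pow_mul _ p v, hω, one_pow, mul_one, pow_add, mul_assoc, pow_mul _ p, hω,
        one_pow, one_mul, pow_one] at h2
    have h3 := hscale ((z / ζ) ^ u) ζ 1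
    rw [← pow_mul, mul_comm u q, h1, div_mul_cancel₀ _ hζ0, ← pow_mul, mul_comm u p, pow_mul, hω,
      one_pow, one_mul] at h3
    rw [h3]
    refine mul_ne_zero (pow_ne_zero _ (pow_ne_zero _ (div_ne_zero ?_ hζ0))) hGζ
    rintro rfl
    rw [zero_pow hp.ne'] at hz
    exact Complex.I_ne_zero hz.symm
  have hnz : ∀ z : ℂ, aeval ![z, 1] G ≠ 0 := by
    intro z hz
    have h1 := hprod z 1
    rw [hz, zero_mul, one_pow, mul_comm 2 p, pow_mul] at h1
    have h2 : (z ^ p) ^ 2 + 1 = 0 := by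
      by_contra hne
      exact pow_ne_zero m hne h1.symm
    have h3 : (z ^ p - Complex.I) * (z ^ p + Complex.I) = 0 := by
      ring_nf
      rw [Complex.I_sq]
      linear_combination h2
    rcases mul_eq_zero.1 h3 with h4 | h4
    · exact hrot z (sub_eq_zero.1 h4) hz
    · refine hrot ((starRingEnd ℂ) z) ?_ (by rw [hconj, hz, map_zero])
      rw [← map_pow, eq_neg_of_add_eq_zero_left h4, map_neg, Complex.conj_I, neg_neg]
  -- So `G (z, 1)` has no zeros and is constant; by homogeneity `G` is a multiple of a power of `y`,
  -- and this contradicts `G (1, 0) ≠ 0` unless the power is zero.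
  let g : Polynomial ℂ := aeval ![Polynomial.X, 1] G
  have hg : ∀ z, g.eval z = aeval ![z, 1] G := by
    intro z
    have := MvPolynomial.comp_aeval_apply (f := ![Polynomial.X, 1])
      ((Polynomial.aeval z : Polynomial ℂ →ₐ[ℂ] ℂ).restrictScalars ℝ) G
    rw [AlgHom.restrictScalars_apply, Polynomial.coe_aeval_eq_eval] at this
    refine this.trans ?_
    congr 2
    funext i
    fin_cases i <;> simp
  have hgdeg : g.degree = 0 := by
    by_contra hne
    obtain ⟨z, hz⟩ := IsAlgClosed.exists_root g hne
    exact hnz z (by rw [← hg]; exact hz)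
  have hconst : ∀ z : ℂ, aeval ![z, 1] G = aeval ![ζ, 1] G := by
    intro z
    rw [← hg, ← hg, Polynomial.eq_C_of_degree_eq_zero hgdeg, Polynomial.eval_C, Polynomial.eval_C]
  by_contra ha
  have h10 : aeval ![(1 : ℂ), 0] G ≠ 0 := by
    intro h0
    have := hprod 1 0
    rw [h0, zero_mul, one_pow, zero_pow (by omega), add_zero, one_pow] at this
    exact zero_ne_one this
  let f : Polynomial ℂ := aeval ![1, Polynomial.X ^ p] G
  have hf : ∀ s, f.eval s = aeval ![1, s ^ p] G := by
    intro s
    have := MvPolynomial.comp_aeval_apply (f := ![1, Polynomial.X ^ p])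
      ((Polynomial.aeval s : Polynomial ℂ →ₐ[ℂ] ℂ).restrictScalars ℝ) G
    rw [AlgHom.restrictScalars_apply, Polynomial.coe_aeval_eq_eval] at this
    refine this.trans ?_
    congr 2
    funext i
    fin_cases i <;> simp
  have hfX : f = Polynomial.C (aeval ![ζ, 1] G) * Polynomial.X ^ a := by
    refine Polynomial.eq_of_infinite_eval_eq _ _ (Set.Infinite.mono ?_
      (Set.finite_singleton (0 : ℂ)).infinite_compl)
    intro s hs
    have hs0 : s ≠ 0 := hs
    have h1 := hscale s (s ^ q)⁻¹ 1
    rw [mul_inv_cancel₀ (pow_ne_zero _ hs0), mul_one, hconst] at h1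
    change f.eval s = _
    rw [hf, h1, Polynomial.eval_mul, Polynomial.eval_C, Polynomial.eval_pow, Polynomial.eval_X,
      mul_comm]
  have h2 := hf 0
  rw [hfX, Polynomial.eval_mul, Polynomial.eval_pow, Polynomial.eval_X, zero_pow ha, mul_zero,
    zero_pow hp.ne'] at h2
  exact h10 h2.symm

/-- The real polynomial `(x ^ (2p) + y ^ (2q)) ^ m + x ^ (pm + u) y ^ v + x ^ (2u) y ^ (2v)`.  The
middle term is there for irreducibility, the last one for positivity. -/
noncomputable def planePoly (p q m u v : ℕ) : MvPolynomial (Fin 2) ℝ :=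
  (MvPolynomial.X 0 ^ (2 * p) + MvPolynomial.X 1 ^ (2 * q)) ^ m
    + MvPolynomial.X 0 ^ (p * m + u) * MvPolynomial.X 1 ^ v
    + MvPolynomial.X 0 ^ (2 * u) * MvPolynomial.X 1 ^ (2 * v)

/-- For the weights `q, p` the lowest component of `planePoly` is `(x ^ (2p) + y ^ (2q)) ^ m`, and
the next one does not vanish on the zero set of `x ^ (2p) + y ^ (2q)`; so at most one of the lowest
components of two factors vanishes there, and the other one is a constant. -/
theorem constantCoeff_ne_zero_of_factorization (hp : 0 < p) (hq : 0 < q)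
    (huv : q * u + p * v = p * q * m + 1) {G H : MvPolynomial (Fin 2) ℝ}
    (hGH : planePoly p q m u v - G * H ∈ idealOfVars (Fin 2) ℝ ^ (2 * (p * q * m) + 2)) :
    constantCoeff G ≠ 0 ∨ constantCoeff H ≠ 0 := by
  let W : Fin 2 → ℕ := ![q, p]
  have hW : ∀ i, 0 < W i := by
    intro i
    fin_cases i
    · exact hq
    · exact hp
  have hX : ∀ i, IsWeightedHomogeneous W (MvPolynomial.X i : MvPolynomial (Fin 2) ℝ) (W i) :=
    fun i => MvPolynomial.isWeightedHomogeneous_X _ _ _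
  have hQ : IsWeightedHomogeneous W
      ((MvPolynomial.X 0 ^ (2 * p) + MvPolynomial.X 1 ^ (2 * q) : MvPolynomial (Fin 2) ℝ) ^ m)
      (2 * (p * q * m)) := by
    have h1 := (hX 0).pow (2 * p)
    have h2 := (hX 1).pow (2 * q)
    have e1 : (2 * p) • W 0 = 2 * p * q := rfl
    have e2 : (2 * q) • W 1 = 2 * p * q := by
      change 2 * q * p = _
      ring
    rw [e1] at h1
    rw [e2] at h2
    have h3 := (h1.add h2).pow m
    rwa [smul_eq_mul, show m * (2 * p * q) = 2 * (p * q * m) by ring] at h3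
  have h2nd : IsWeightedHomogeneous W
      (MvPolynomial.X 0 ^ (p * m + u) * MvPolynomial.X 1 ^ v : MvPolynomial (Fin 2) ℝ)
      (2 * (p * q * m) + 1) := by
    have h3 := ((hX 0).pow (p * m + u)).mul ((hX 1).pow v)
    have e1 : (p * m + u) • W 0 + v • W 1 = 2 * (p * q * m) + 1 := by
      change (p * m + u) * q + v * p = _
      linear_combination huv
    rwa [e1] at h3
  have h3rd : IsWeightedHomogeneous W
      (MvPolynomial.X 0 ^ (2 * u) * MvPolynomial.X 1 ^ (2 * v) : MvPolynomial (Fin 2) ℝ)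
      (2 * (p * q * m) + 2) := by
    have h3 := ((hX 0).pow (2 * u)).mul ((hX 1).pow (2 * v))
    have e1 : (2 * u) • W 0 + (2 * v) • W 1 = 2 * (p * q * m) + 2 := by
      change (2 * u) * q + 2 * v * p = _
      linear_combination 2 * huv
    rwa [e1] at h3
  have hcomp : ∀ e < 2 * (p * q * m) + 2, weightedHomogeneousComponent W e (G * H)
      = weightedHomogeneousComponent W e (planePoly p q m u v) := by
    intro e he
    have h1 : weightedHomogeneousComponent W e (planePoly p q m u v - G * H) = 0 := by
      refine MvPolynomial.weightedHomogeneousComponent_eq_zero' _ _ fun β hβ hβe => ?_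
      have h2 := (MvPolynomial.mem_pow_idealOfVars_iff _ _).1 hGH β hβ
      have h3 := degree_le_weight hW β
      omega
    rw [map_sub, sub_eq_zero] at h1
    exact h1.symm
  have hlow : ∀ e < 2 * (p * q * m), weightedHomogeneousComponent W e (planePoly p q m u v) = 0 := by
    intro e he
    rw [planePoly, map_add, map_add, hQ.weightedHomogeneousComponent_ne _ (by omega),
      h2nd.weightedHomogeneousComponent_ne _ (by omega),
      h3rd.weightedHomogeneousComponent_ne _ (by omega)]
    simp
  have hK : weightedHomogeneousComponent W (2 * (p * q * m)) (planePoly p q m u v)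
      = (MvPolynomial.X 0 ^ (2 * p) + MvPolynomial.X 1 ^ (2 * q)) ^ m := by
    rw [planePoly, map_add, map_add, hQ.weightedHomogeneousComponent_same,
      h2nd.weightedHomogeneousComponent_ne _ (by omega),
      h3rd.weightedHomogeneousComponent_ne _ (by omega)]
    simp
  have hK1 : weightedHomogeneousComponent W (2 * (p * q * m) + 1) (planePoly p q m u v)
      = MvPolynomial.X 0 ^ (p * m + u) * MvPolynomial.X 1 ^ v := by
    rw [planePoly, map_add, map_add, hQ.weightedHomogeneousComponent_ne _ (by omega),
      h2nd.weightedHomogeneousComponent_same,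
      h3rd.weightedHomogeneousComponent_ne _ (by omega)]
    simp
  have hmul : ∀ e, (gradingHom W G * gradingHom W H).coeff e
      = weightedHomogeneousComponent W e (G * H) := fun e => by
    rw [← map_mul, coeff_gradingHom]
  have hQ0 : ((MvPolynomial.X 0 ^ (2 * p) + MvPolynomial.X 1 ^ (2 * q) : MvPolynomial (Fin 2) ℝ) ^ m)
      ≠ 0 := by
    intro h0
    have h1 := congrArg (aeval ![(1 : ℝ), 0]) h0
    have h2 : 2 * q ≠ 0 := by omega
    simp [h2] at h1
  obtain ⟨a, b, hab, h1, h2⟩ := exists_lowest_coeff (K := 2 * (p * q * m))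
    (g := gradingHom W G) (h := gradingHom W H)
    (fun e he => by rw [hmul, hcomp e (by omega), hlow e he])
    (by rw [hmul, hcomp _ (by omega), hK]; exact hQ0)
  rw [hmul, hcomp _ (by omega), hK] at h1
  rw [hmul, hcomp _ (by omega), hK1] at h2
  simp only [coeff_gradingHom] at h1 h2
  -- A point `(ζ, 1)` with `ζ ^ (2p) + 1 = 0`, where the second lowest component is not zero.
  obtain ⟨ζ, hζ⟩ := IsAlgClosed.exists_pow_nat_eq Complex.I hp
  have hζ0 : ζ ≠ 0 := by
    rintro rfl
    rw [zero_pow hp.ne'] at hζ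
    exact Complex.I_ne_zero hζ.symm
  have hconst : ∀ P : MvPolynomial (Fin 2) ℝ,
      aeval ![ζ, 1] (weightedHomogeneousComponent W 0 P) ≠ 0 → constantCoeff P ≠ 0 := by
    intro P hP h0
    refine hP ?_
    rw [MvPolynomial.weightedHomogeneousComponent_zero _ fun i => (hW i).ne']
    rw [MvPolynomial.constantCoeff_eq] at h0
    rw [h0, map_zero, map_zero]
  have hne : aeval ![ζ, 1] (weightedHomogeneousComponent W a G) ≠ 0 ∨
      aeval ![ζ, 1] (weightedHomogeneousComponent W b H) ≠ 0 := by
    by_contra hcon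
    push Not at hcon
    have h3 := congrArg (aeval ![ζ, 1]) h2
    rw [map_add, map_mul, map_mul, hcon.1, hcon.2, zero_mul, mul_zero, add_zero] at h3
    simp only [map_mul, map_pow, MvPolynomial.aeval_X, Matrix.cons_val_zero, Matrix.cons_val_one,
      one_pow, mul_one] at h3
    exact pow_ne_zero _ hζ0 h3.symm
  have hwh : ∀ e (P : MvPolynomial (Fin 2) ℝ),
      IsWeightedHomogeneous W (weightedHomogeneousComponent W e P) e := fun e P =>
    MvPolynomial.weightedHomogeneousComponent_isWeightedHomogeneous e P
  rcases hne with hne | hne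
  · left
    have ha := eq_zero_of_dvd_pow hp hq huv rfl rfl (hwh a G) h1 hζ hne
    rw [ha] at hne
    exact hconst G hne
  · right
    rw [mul_comm] at h1
    have hb := eq_zero_of_dvd_pow hp hq huv rfl rfl (hwh b H) h1 hζ hne
    rw [hb] at hne
    exact hconst H hne

end Newton

/-! ### Irreducibility of analytic germs -/

section Irreducible

open MvPolynomial (eval idealOfVars constantCoeff)
open Asymptotics

/-- A function whose restriction to a real plane is `planePoly` is irreducible: the jets of two factors
multiply to `planePoly` up to an order beyond its two lowest components. -/
theorem ne_zero_or_ne_zero_of_plane {E : Type*} [NormedAddCommGroup E] [NormedSpace ℝ E]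
    {ρ : E → ℝ} (ι : (Fin 2 → ℝ) →L[ℝ] E) {p q m u v : ℕ} (hp : 0 < p) (hq : 0 < q)
    (huv : q * u + p * v = p * q * m + 1) (hρ : ∀ y, ρ (ι y) = eval y (planePoly p q m u v))
    (g h : E → ℝ) (hg : AnalyticAt ℝ g 0) (hh : AnalyticAt ℝ h 0)
    (hgh : ∀ᶠ x in 𝓝 (0 : E), ρ x = g x * h x) : g 0 ≠ 0 ∨ h 0 ≠ 0 := by
  let M := 2 * (p * q * m) + 2
  have hι : Tendsto ι (𝓝 0) (𝓝 0) := by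
    have := ι.continuous.tendsto 0
    rwa [map_zero] at this
  have hgι : AnalyticAt ℝ (fun y => g (ι y)) 0 := hg.fun_comp_of_eq (ι.analyticAt 0) (map_zero ι)
  have hhι : AnalyticAt ℝ (fun y => h (ι y)) 0 := hh.fun_comp_of_eq (ι.analyticAt 0) (map_zero ι)
  obtain ⟨G, -, hG⟩ := exists_polynomial_isBigO hgι M
  obtain ⟨H, -, hH⟩ := exists_polynomial_isBigO hhι M
  have hmem : planePoly p q m u v - G * H ∈ idealOfVars (Fin 2) ℝ ^ M := by
    refine mem_pow_idealOfVars_of_isBigO ?_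
    have h1 : (fun y => h (ι y)) =O[𝓝 0] fun _ => (1 : ℝ) := hhι.continuousAt.isBigO_one ℝ
    have h2 : (fun y => eval y G) =O[𝓝 0] fun _ => (1 : ℝ) :=
      (analyticAt_eval G (0 : Fin 2 → ℝ)).continuousAt.isBigO_one ℝ
    have h3 := (hG.mul h1).add (h2.mul hH |>.congr_right fun y => mul_comm _ _)
    refine IsBigO.congr' h3 ?_ (.of_forall fun y => mul_one _)
    filter_upwards [hι.eventually hgh] with y hy
    rw [map_sub, map_mul, ← hρ, hy]
    ring
  have hval : ∀ {f : E → ℝ} {P : MvPolynomial (Fin 2) ℝ},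
      ((fun y => f (ι y) - eval y P) =O[𝓝 0] fun y => ‖y‖ ^ M) → f 0 = constantCoeff P := by
    intro f P hf
    have h4 := hf.eq_zero_imp.self_of_nhds (by simp [M])
    rwa [map_zero, MvPolynomial.eval_zero, sub_eq_zero] at h4
  rw [hval hG, hval hH]
  exact constantCoeff_ne_zero_of_factorization hp hq huv hmem

end Irreducible

/-! ### Control functions in at least two variables -/

section Control

variable {𝕂 : Type*} [RCLike 𝕂] {n : ℕ}

theorem analyticAt_conj {E : Type*} [NormedAddCommGroup E] [NormedSpace ℝ E] {f : E → 𝕂} {x : E}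
    (hf : AnalyticAt ℝ f x) : AnalyticAt ℝ (fun y => (starRingEnd 𝕂) (f y)) x :=
  ((RCLike.conjCLE (K := 𝕂) : 𝕂 →L[ℝ] 𝕂).analyticAt _).fun_comp_of_eq hf rfl

theorem analyticAt_mon (β : Fin n →₀ ℕ) (x : Fin n → 𝕂) : AnalyticAt ℝ (mon (𝕂 := 𝕂) β) x := by
  have h := (analyticAt_eval (MvPolynomial.monomial β (1 : 𝕂)) x).restrictScalars (𝕜 := ℝ)
  simpa only [eval_monomial_one] using h

/-- `f` is a combination of the monomials of `Γ` with real analytic coefficients of order at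
least `c`. -/
def HasExpansion (W : Fin n → ℕ) (w₁ c : ℕ) (Γ : Finset (Fin n →₀ ℕ)) (f : (Fin n → 𝕂) → 𝕂) :
    Prop :=
  ∃ r : (Fin n →₀ ℕ) → (Fin n → 𝕂) → 𝕂, (∀ γ x, AnalyticAt ℝ (r γ) x) ∧ (∀ γ, r γ 0 = 0) ∧
    (∀ γ, HasOrder W w₁ c (fun q : (Fin n → 𝕂) × 𝕂 => r γ q.1)) ∧
    ∀ x, f x = ∑ γ ∈ Γ, r γ x * mon γ x

variable {W : Fin n → ℕ} {w₁ c : ℕ} {Γ : Finset (Fin n →₀ ℕ)}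

theorem HasExpansion.add {f g : (Fin n → 𝕂) → 𝕂} (hf : HasExpansion W w₁ c Γ f)
    (hg : HasExpansion W w₁ c Γ g) : HasExpansion W w₁ c Γ fun x => f x + g x := by
  obtain ⟨r, h1, h2, h3, h4⟩ := hf
  obtain ⟨s, k1, k2, k3, k4⟩ := hg
  refine ⟨fun γ x => r γ x + s γ x, fun γ x => (h1 γ x).add (k1 γ x), fun γ => ?_,
    fun γ => (h3 γ).add (k3 γ), fun x => ?_⟩
  · dsimp only
    rw [h2, k2, add_zero]
  · simp only [h4, k4, add_mul, Finset.sum_add_distrib]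

theorem HasExpansion.sum {ι : Type*} {s : Finset ι} {f : ι → (Fin n → 𝕂) → 𝕂}
    (hf : ∀ i ∈ s, HasExpansion W w₁ c Γ (f i)) : HasExpansion W w₁ c Γ fun x => ∑ i ∈ s, f i x := by
  classical
  induction s using Finset.induction_on with
  | empty => exact ⟨fun _ _ => 0, fun _ _ => analyticAt_const, fun _ => rfl, fun _ => .zero _,
      fun x => by simp⟩
  | insert i s hi ih =>
    simp only [Finset.sum_insert hi]
    exact (hf i (Finset.mem_insert_self _ _)).add
      (ih fun j hj => hf j (Finset.mem_insert_of_mem hj))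

/-- One of the monomials is divisible by an element of `Γ`, the conjugate of the other one is part of the
coefficient. -/
theorem HasExpansion.mon_mul_mon (hW : ∀ i, 0 < W i) (hw₁ : ∀ i, W i ≤ w₁) (hc : 0 < c)
    (hΓ : ∀ β, c ≤ Finsupp.weight W β → ∃ γ ∈ Γ, γ ≤ β) (C : 𝕂) {a b : Fin n →₀ ℕ}
    (ha : c ≤ Finsupp.weight W a) (hb : c ≤ Finsupp.weight W b) :
    HasExpansion W w₁ c Γ fun x : Fin n → 𝕂 => C * (starRingEnd 𝕂) (mon a x) * mon b x := by
  classical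
  obtain ⟨γ, hγ, hγb⟩ := hΓ b hb
  have ha0 : a ≠ 0 := by
    rintro rfl
    rw [map_zero] at ha
    omega
  have h0 : HasOrder W w₁ c (fun q : (Fin n → 𝕂) × 𝕂 =>
      C * (starRingEnd 𝕂) (mon a q.1) * mon (b - γ) q.1) := by
    have h1 := (((HasOrder.const hW C).mul hW (HasOrder.mon hW hw₁ a).conj).mul hW
      (HasOrder.mon hW hw₁ (b - γ)))
    exact h1.mono hW (by omega)
  refine ⟨fun δ x => if δ = γ then C * (starRingEnd 𝕂) (mon a x) * mon (b - γ) x else 0,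
    fun δ x => ?_, fun δ => ?_, fun δ => ?_, fun x => ?_⟩
  · by_cases h : δ = γ
    · simp only [if_pos h]
      exact (analyticAt_const.mul (analyticAt_conj (analyticAt_mon a x))).mul (analyticAt_mon _ x)
    · simp only [if_neg h]
      exact analyticAt_const
  · simp [mon_apply_zero ha0]
  · by_cases h : δ = γ
    · simpa only [if_pos h] using h0
    · simpa only [if_neg h] using HasOrder.zero _
  · rw [Finset.sum_eq_single γ (fun δ _ h => by simp only [if_neg h, zero_mul])
      (fun h => absurd hγ h)]
    dsimp only
    rw [if_pos rfl, mul_assoc _ (mon (b - γ) x), ← mon_add, tsub_add_cancel_of_le hγb]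

theorem HasExpansion.hasOrder (hW : ∀ i, 0 < W i) (hw₁ : ∀ i, W i ≤ w₁)
    (hΓc : ∀ γ ∈ Γ, c ≤ Finsupp.weight W γ) {f : (Fin n → 𝕂) → 𝕂} (hf : HasExpansion W w₁ c Γ f) :
    HasOrder W w₁ (2 * c : ℕ) (fun q : (Fin n → 𝕂) × 𝕂 => f q.1) := by
  obtain ⟨r, h1, h2, h3, h4⟩ := hf
  simp only [h4]
  refine HasOrder.sum fun γ hγ => ((h3 γ).mul hW (HasOrder.mon hW hw₁ γ)).mono hW ?_
  have := hΓc γ hγ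
  omega

theorem HasExpansion.analyticAt {f : (Fin n → 𝕂) → 𝕂} (hf : HasExpansion W w₁ c Γ f)
    (x : Fin n → 𝕂) : AnalyticAt ℝ f x := by
  obtain ⟨r, h1, h2, h3, h4⟩ := hf
  rw [funext h4]
  exact Finset.analyticAt_fun_sum _ fun γ _ => (h1 γ x).mul (analyticAt_mon γ x)

theorem HasExpansion.apply_zero {f : (Fin n → 𝕂) → 𝕂} (hf : HasExpansion W w₁ c Γ f) : f 0 = 0 := by
  obtain ⟨r, h1, h2, h3, h4⟩ := hf
  simp [h4, h2]

/-- A lower bound by a weighted norm makes a real analytic function positive away from the origin. -/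
theorem isControlFunction_of_le (hW : ∀ i, 0 < W i) {ρ : (Fin n → 𝕂) → ℝ}
    (hρ : ∀ x, AnalyticAt ℝ (fun x => ((ρ x : ℝ) : 𝕂)) x) (hρ0 : ρ 0 = 0) {r : ℕ} {c₀ : ℝ}
    (hc₀ : 0 < c₀) (hlow : ∀ x, c₀ * wnorm W x ^ r ≤ ρ x)
    (hirr : ∀ g h : (Fin n → 𝕂) → ℝ, AnalyticAt ℝ g 0 → AnalyticAt ℝ h 0 →
      (∀ᶠ x in 𝓝 (0 : Fin n → 𝕂), ρ x = g x * h x) → g 0 ≠ 0 ∨ h 0 ≠ 0) :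
    IsControlFunction ρ where
  analytic x := by
    have h : AnalyticAt ℝ (fun x => RCLike.re ((ρ x : ℝ) : 𝕂)) x :=
      ((RCLike.reCLM (K := 𝕂)).analyticAt _).fun_comp_of_eq (hρ x) rfl
    simpa only [RCLike.ofReal_re] using h
  nonneg x := le_trans (mul_nonneg hc₀.le (pow_nonneg (wnorm_nonneg W x) r)) (hlow x)
  eq_zero_iff x := by
    refine ⟨fun h => ?_, fun h => h ▸ hρ0⟩
    by_contra hx
    have h1 := hlow x
    rw [h] at h1
    exact absurd h1 (not_le.2 (mul_pos hc₀ (pow_pos (wnorm_pos hW hx) r)))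
  irreducible := hirr

/-- For the weights `q, p` there is a monomial `x ^ u y ^ v` of weight `p q m + 1`. -/
theorem exists_mul_add_mul_eq {p q : ℕ} (hpq : p.Coprime q) (hp : 0 < p) {m : ℕ} (hm : 0 < m) :
    ∃ u v, q * u + p * v = p * q * m + 1 := by
  rcases Nat.eq_or_lt_of_le (show 1 ≤ p from hp) with h1 | h1
  · subst h1
    exact ⟨0, q * m + 1, by ring⟩
  · obtain ⟨u, hu, h2⟩ := Nat.exists_mul_mod_eq_one_of_coprime hpq.symm h1
    have h3 : q * u ≤ p * q * m := by
      calc q * u ≤ q * p := Nat.mul_le_mul_left _ hu.le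
        _ = p * q := mul_comm _ _
        _ ≤ p * q * m := Nat.le_mul_of_pos_right _ hm
    have h4 : p ∣ p * q * m + 1 - q * u := by
      refine (Nat.modEq_iff_dvd' (by omega)).1 ?_
      rw [Nat.ModEq, h2, mul_assoc, Nat.mul_add_mod, Nat.mod_eq_of_lt h1]
    obtain ⟨v, hv⟩ := h4
    exact ⟨u, v, by omega⟩

/-- The control function in the coordinates `i₀, i₁` and the remaining ones.  For weights
`W i₀ = g q`, `W i₁ = g p`, it is a perturbation of higher order of a weighted homogeneous function;
the perturbation makes it irreducible. -/
noncomputable def controlFun (i₀ i₁ : Fin n) (p q m u v : ℕ) (N : Fin n → ℕ) (x : Fin n → 𝕂) : ℝ :=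
  (‖x i₀‖ ^ (2 * p) + ‖x i₁‖ ^ (2 * q)) ^ m
    + RCLike.re ((starRingEnd 𝕂) (x i₀ ^ (p * m)) * (x i₀ ^ u * x i₁ ^ v))
    + ‖x i₀ ^ u * x i₁ ^ v‖ ^ 2 + ∑ i with i ≠ i₀ ∧ i ≠ i₁, ‖x i‖ ^ (2 * N i)

/-- Every term of the control function is a combination of products of a monomial and the conjugate of
a monomial, both of weight at least `c`. -/
theorem hasExpansion_controlFun (hW : ∀ i, 0 < W i) (hw₁ : ∀ i, W i ≤ w₁) (hc : 0 < c)
    (hΓ : ∀ β, c ≤ Finsupp.weight W β → ∃ γ ∈ Γ, γ ≤ β) {i₀ i₁ : Fin n} {g p q m u v : ℕ}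
    (h0 : W i₀ = q * g) (h1 : W i₁ = p * g) (hcm : c = p * q * m * g)
    (huv : q * u + p * v = p * q * m + 1) {N : Fin n → ℕ} (hN : ∀ i, N i * W i = c) :
    HasExpansion W w₁ c Γ fun x : Fin n → 𝕂 => ((controlFun i₀ i₁ p q m u v N x : ℝ) : 𝕂) := by
  have hsq : ∀ a : Fin n →₀ ℕ, c ≤ Finsupp.weight W a → ∀ C : ℝ,
      HasExpansion W w₁ c Γ fun x : Fin n → 𝕂 => ((C * ‖mon a x‖ ^ 2 : ℝ) : 𝕂) := by
    intro a ha C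
    have h2 := HasExpansion.mon_mul_mon hW hw₁ hc hΓ (C : 𝕂) ha ha
    convert h2 using 2 with x
    rw [mul_assoc, RCLike.conj_mul]
    push_cast
    rfl
  have e1 : ∀ x : Fin n → 𝕂, ((‖x i₀‖ ^ (2 * p) + ‖x i₁‖ ^ (2 * q)) ^ m : ℝ)
      = ∑ k ∈ Finset.range (m + 1), (m.choose k : ℝ)
        * ‖mon (Finsupp.single i₀ (p * k) + Finsupp.single i₁ (q * (m - k))) x‖ ^ 2 := by
    intro x
    rw [add_pow]
    refine Finset.sum_congr rfl fun k _ => ?_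
    rw [mon_add, mon_single, mon_single, norm_mul, norm_pow, norm_pow]
    ring
  have hA : c ≤ Finsupp.weight W (Finsupp.single i₀ (p * m)) := by
    rw [Finsupp.weight_single, smul_eq_mul, h0, hcm]
    exact le_of_eq (by ring)
  have hB : c ≤ Finsupp.weight W (Finsupp.single i₀ u + Finsupp.single i₁ v) := by
    rw [map_add, Finsupp.weight_single, Finsupp.weight_single, smul_eq_mul, smul_eq_mul, h0, h1, hcm]
    calc p * q * m * g ≤ (p * q * m + 1) * g := Nat.mul_le_mul_right _ (Nat.le_succ _)
      _ = _ := by rw [← huv]; ring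
  have H1 : HasExpansion W w₁ c Γ fun x : Fin n → 𝕂 =>
      (((‖x i₀‖ ^ (2 * p) + ‖x i₁‖ ^ (2 * q)) ^ m : ℝ) : 𝕂) := by
    simp only [e1, RCLike.ofReal_sum]
    refine HasExpansion.sum fun k hk => hsq _ ?_ _
    rw [map_add, Finsupp.weight_single, Finsupp.weight_single, smul_eq_mul, smul_eq_mul, h0, h1, hcm]
    obtain ⟨l, hl⟩ := Nat.exists_eq_add_of_le (Nat.lt_succ_iff.1 (Finset.mem_range.1 hk))
    rw [hl, Nat.add_sub_cancel_left]
    exact le_of_eq (by ring)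
  have H2 : HasExpansion W w₁ c Γ fun x : Fin n → 𝕂 =>
      ((RCLike.re ((starRingEnd 𝕂) (x i₀ ^ (p * m)) * (x i₀ ^ u * x i₁ ^ v)) : ℝ) : 𝕂) := by
    have h2 := (HasExpansion.mon_mul_mon hW hw₁ hc hΓ (1 / 2 : 𝕂) hA hB).add
      (HasExpansion.mon_mul_mon hW hw₁ hc hΓ (1 / 2 : 𝕂) hB hA)
    convert h2 using 2 with x
    rw [RCLike.re_eq_add_conj, mon_add, mon_single, mon_single, mon_single, map_mul, RCLike.conj_conj]
    ring
  have H3 : HasExpansion W w₁ c Γ fun x : Fin n → 𝕂 => ((‖x i₀ ^ u * x i₁ ^ v‖ ^ 2 : ℝ) : 𝕂) := by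
    have h2 := hsq _ hB 1
    simpa only [mon_add, mon_single, one_mul] using h2
  have H4 : ∀ i, HasExpansion W w₁ c Γ fun x : Fin n → 𝕂 => ((‖x i‖ ^ (2 * N i) : ℝ) : 𝕂) := by
    intro i
    have h2 := hsq (Finsupp.single i (N i)) (by
      rw [Finsupp.weight_single, smul_eq_mul, hN]) 1
    simpa only [mon_single, one_mul, norm_pow, ← pow_mul, mul_comm (N i) 2] using h2
  simp only [controlFun, RCLike.ofReal_add, RCLike.ofReal_sum]
  exact ((H1.add H2).add H3).add (HasExpansion.sum fun i _ => H4 i)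

/-- The term with the real part is not less than `- |a b|`, with `|a| ^ 2 ≤ S ^ m` for the leading part
`S ^ m` and `|b| ^ 2` the term after it; so it costs at most half of these two. -/
theorem le_controlFun (hW : ∀ i, 0 < W i) (hn : 0 < n) {i₀ i₁ : Fin n} {g p q m u v : ℕ}
    (h0 : W i₀ = q * g) (h1 : W i₁ = p * g) (hcm : c = p * q * m * g) {N : Fin n → ℕ}
    (hN : ∀ i, N i * W i = c) (x : Fin n → 𝕂) :
    1 / 2 * wnorm W x ^ (2 * c) ≤ controlFun i₀ i₁ p q m u v N x := by
  let S := ‖x i₀‖ ^ (2 * p) + ‖x i₁‖ ^ (2 * q)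
  let b := ‖x i₀ ^ u * x i₁ ^ v‖
  let T := ∑ i with i ≠ i₀ ∧ i ≠ i₁, ‖x i‖ ^ (2 * N i)
  have hT : 0 ≤ T := Finset.sum_nonneg fun i _ => by positivity
  have hS0 : ‖x i₀‖ ^ (2 * (p * m)) ≤ S ^ m := by
    rw [← mul_assoc, pow_mul]
    exact pow_le_pow_left₀ (by positivity) (le_add_of_nonneg_right (by positivity)) m
  have hS1 : ‖x i₁‖ ^ (2 * (q * m)) ≤ S ^ m := by
    rw [← mul_assoc, pow_mul]
    exact pow_le_pow_left₀ (by positivity) (le_add_of_nonneg_left (by positivity)) m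
  have hSm : 0 ≤ S ^ m := by positivity
  have hre : -(‖x i₀‖ ^ (p * m) * b)
      ≤ RCLike.re ((starRingEnd 𝕂) (x i₀ ^ (p * m)) * (x i₀ ^ u * x i₁ ^ v)) := by
    have h2 := RCLike.abs_re_le_norm ((starRingEnd 𝕂) (x i₀ ^ (p * m)) * (x i₀ ^ u * x i₁ ^ v))
    rw [norm_mul, RCLike.norm_conj, norm_pow] at h2
    exact (abs_le.1 h2).1
  have hab : ‖x i₀‖ ^ (p * m) * b ≤ (S ^ m + b ^ 2) / 2 := by
    have h2 := two_mul_le_add_sq (‖x i₀‖ ^ (p * m)) b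
    rw [← pow_mul, mul_comm (p * m) 2] at h2
    linarith
  have hlow : 1 / 2 * (S ^ m + T) ≤ controlFun i₀ i₁ p q m u v N x := by
    change _ ≤ S ^ m + _ + b ^ 2 + T
    nlinarith [sq_nonneg b]
  refine le_trans (mul_le_mul_of_nonneg_left ?_ (by norm_num)) hlow
  obtain ⟨i, hi⟩ := exists_wnorm_pow_eq hW hn x
  have hpow : ∀ k, k * W i = c → wnorm W x ^ (2 * c) = ‖x i‖ ^ (2 * k) := by
    intro k hk
    rw [← hi, ← pow_mul, ← hk]
    congr 1
    ring
  by_cases hi0 : i = i₀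
  · subst hi0
    rw [hpow (p * m) (by rw [h0, hcm]; ring)]
    linarith
  by_cases hi1 : i = i₁
  · subst hi1
    rw [hpow (q * m) (by rw [h1, hcm]; ring)]
    linarith
  · rw [hpow (N i) (hN i)]
    have h2 : ‖x i‖ ^ (2 * N i) ≤ T :=
      Finset.single_le_sum (f := fun i => ‖x i‖ ^ (2 * N i)) (fun _ _ => by positivity)
        (Finset.mem_filter.2 ⟨Finset.mem_univ i, hi0, hi1⟩)
    linarith

/-- On the plane of the real points in the coordinates `i₀, i₁` the control function is `planePoly`. -/
theorem exists_plane_controlFun {i₀ i₁ : Fin n} (hi : i₀ ≠ i₁) {p q m u v : ℕ} {N : Fin n → ℕ}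
    (hN : ∀ i, 0 < N i) : ∃ ι : (Fin 2 → ℝ) →L[ℝ] (Fin n → 𝕂),
      ∀ y, controlFun i₀ i₁ p q m u v N (ι y) = MvPolynomial.eval y (planePoly p q m u v) := by
  classical
  refine ⟨ContinuousLinearMap.pi fun i =>
    if i = i₀ then (RCLike.ofRealCLM (K := 𝕂)).comp (ContinuousLinearMap.proj 0)
    else if i = i₁ then (RCLike.ofRealCLM (K := 𝕂)).comp (ContinuousLinearMap.proj 1) else 0,
    fun y => ?_⟩
  set x : Fin n → 𝕂 := ContinuousLinearMap.pi (fun i =>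
    if i = i₀ then (RCLike.ofRealCLM (K := 𝕂)).comp (ContinuousLinearMap.proj 0)
    else if i = i₁ then (RCLike.ofRealCLM (K := 𝕂)).comp (ContinuousLinearMap.proj 1) else 0) y
    with hx
  have h0 : x i₀ = ((y 0 : ℝ) : 𝕂) := by simp [hx]
  have h1 : x i₁ = ((y 1 : ℝ) : 𝕂) := by simp [hx, hi.symm]
  have h2 : ∀ i, i ≠ i₀ ∧ i ≠ i₁ → x i = 0 := fun i h => by simp [hx, h.1, h.2]
  have h3 : ∑ i with i ≠ i₀ ∧ i ≠ i₁, ‖x i‖ ^ (2 * N i) = 0 := by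
    refine Finset.sum_eq_zero fun i h => ?_
    rw [h2 i (Finset.mem_filter.1 h).2, norm_zero, zero_pow]
    have := hN i
    omega
  rw [controlFun, h3, h0, h1, RCLike.norm_ofReal, RCLike.norm_ofReal, pow_mul, pow_mul, sq_abs,
    sq_abs]
  have h4 : (starRingEnd 𝕂) (((y 0 : ℝ) : 𝕂) ^ (p * m)) * (((y 0 : ℝ) : 𝕂) ^ u * ((y 1 : ℝ) : 𝕂) ^ v)
      = ((y 0 ^ (p * m) * (y 0 ^ u * y 1 ^ v) : ℝ) : 𝕂) := by
    rw [map_pow, RCLike.conj_ofReal]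
    push_cast
    rfl
  have h5 : ((y 0 : ℝ) : 𝕂) ^ u * ((y 1 : ℝ) : 𝕂) ^ v = ((y 0 ^ u * y 1 ^ v : ℝ) : 𝕂) := by
    push_cast
    rfl
  rw [h4, h5, RCLike.ofReal_re, RCLike.norm_ofReal, sq_abs]
  simp only [planePoly, map_add, map_mul, map_pow, MvPolynomial.eval_X]
  ring

/-- Control functions of arbitrarily large order, for at least two variables. -/
theorem exists_controlFunction (hW : ∀ i, 0 < W i) (hw₁ : ∀ i, W i ≤ w₁) (hn : 2 ≤ n) (L : ℕ) :
    ∃ c, L ≤ c ∧ ∀ Γ : Finset (Fin n →₀ ℕ), (∀ β, c ≤ Finsupp.weight W β → ∃ γ ∈ Γ, γ ≤ β) →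
      ∃ ρ : (Fin n → 𝕂) → ℝ, IsControlFunction ρ ∧
        HasExpansion W w₁ c Γ (fun x => ((ρ x : ℝ) : 𝕂)) ∧
        ∀ x, 1 / 2 * wnorm W x ^ (2 * c) ≤ ρ x := by
  let i₀ : Fin n := ⟨0, by omega⟩
  let i₁ : Fin n := ⟨1, by omega⟩
  have hi : i₀ ≠ i₁ := by simp [i₀, i₁]
  obtain ⟨q, p, hpq, h0, h1⟩ := Nat.exists_coprime (W i₀) (W i₁)
  set g := Nat.gcd (W i₀) (W i₁)
  have hq : 0 < q := Nat.pos_of_ne_zero fun h => by have := hW i₀; simp [h0, h] at this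
  have hp : 0 < p := Nat.pos_of_ne_zero fun h => by have := hW i₁; simp [h1, h] at this
  have hg : 0 < g := Nat.gcd_pos_of_pos_left _ (hW i₀)
  -- All weights divide `m`, and hence `c`, and `c` is at least `L`.
  let m := (∏ i, W i) * (L + 1)
  have hP : 0 < ∏ i, W i := Finset.prod_pos fun i _ => hW i
  have hm : 0 < m := Nat.mul_pos hP (Nat.succ_pos L)
  let c := p * q * m * g
  have hc : 0 < c := by positivity
  have hmc : m ≤ c := by
    calc m ≤ (p * q) * m := Nat.le_mul_of_pos_left _ (Nat.mul_pos hp hq)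
      _ ≤ c := Nat.le_mul_of_pos_right _ hg
  have hdvd : ∀ i, W i ∣ c := fun i =>
    ((((Finset.dvd_prod_of_mem W (Finset.mem_univ i)).mul_right (L + 1)).mul_left (p * q)).mul_right g)
  have hN : ∀ i, c / W i * W i = c := fun i => Nat.div_mul_cancel (hdvd i)
  have hN0 : ∀ i, 0 < c / W i := fun i => Nat.div_pos (Nat.le_of_dvd hc (hdvd i)) (hW i)
  obtain ⟨u, v, huv⟩ := exists_mul_add_mul_eq hpq.symm hp hm
  refine ⟨c, ?_, fun Γ hΓ => ?_⟩
  · calc L ≤ (∏ i, W i) * (L + 1) := (Nat.le_succ L).trans (Nat.le_mul_of_pos_left _ hP)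
      _ ≤ c := hmc
  have hexp := hasExpansion_controlFun (𝕂 := 𝕂) hW hw₁ hc hΓ h0 h1 rfl huv hN
  have hlow := le_controlFun (𝕂 := 𝕂) hW (by omega) h0 h1 (rfl : c = _) hN (u := u) (v := v)
  obtain ⟨ι, hι⟩ := exists_plane_controlFun (𝕂 := 𝕂) hi (p := p) (q := q) (m := m) (u := u) (v := v)
    hN0
  refine ⟨controlFun i₀ i₁ p q m u v fun i => c / W i, ?_, hexp, hlow⟩
  refine isControlFunction_of_le hW hexp.analyticAt ?_ (by norm_num) hlow
    (ne_zero_or_ne_zero_of_plane ι hp hq huv hι)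
  have := hexp.apply_zero
  exact_mod_cast this

end Control

/-! ### Triviality for natural weights -/

section NaturalWeights

open MvPolynomial (eval pderiv monomial IsWeightedHomogeneous weightedHomogeneousComponent
  vanishingIdeal)

variable {𝕂 : Type*} [RCLike 𝕂] {n : ℕ} {W : Fin n → ℕ} {w₁ w₂ : ℕ}

/-- The exponents whose weight is at least `c`, but not much larger. -/
noncomputable def expBetween (W : Fin n → ℕ) (w₁ c : ℕ) : Finset (Fin n →₀ ℕ) :=
  (expLE n (c + w₁)).filter fun γ => c ≤ Finsupp.weight W γ

/-- Variables can be removed one at a time from a monomial until its weight is between `c` and `c + w₁`. -/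
theorem exists_expBetween_le (hW : ∀ i, 0 < W i) (hw₁ : ∀ i, W i ≤ w₁) (c : ℕ) (β : Fin n →₀ ℕ)
    (hβ : c ≤ Finsupp.weight W β) : ∃ γ ∈ expBetween W w₁ c, γ ≤ β := by
  induction hk : Finsupp.weight W β using Nat.strong_induction_on generalizing β with
  | _ k ih =>
    by_cases hle : Finsupp.weight W β ≤ c + w₁
    · refine ⟨β, Finset.mem_filter.2 ⟨?_, hβ⟩, le_rfl⟩
      rw [mem_expLE]
      exact (degree_le_weight hW β).trans hle
    · have hβ0 : β ≠ 0 := by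
        rintro rfl
        rw [map_zero] at hle
        omega
      obtain ⟨i, hi⟩ := Finsupp.ne_iff.1 hβ0
      have h1 : Finsupp.single i 1 ≤ β := by
        rw [Finsupp.single_le_iff]
        exact Nat.one_le_iff_ne_zero.2 hi
      have h2 : Finsupp.weight W β = Finsupp.weight W (β - Finsupp.single i 1) + W i := by
        conv_lhs => rw [← tsub_add_cancel_of_le h1, map_add]
        simp [Finsupp.weight_single]
      have h3 := hw₁ i
      have h4 := hW i
      obtain ⟨γ, hγ, hγβ⟩ := ih _ (by omega) (β - Finsupp.single i 1) (by omega) rfl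
      exact ⟨γ, hγ, hγβ.trans tsub_le_self⟩

/-- The Euler field of the weights preserves the ideal of a cone: it multiplies the weighted components
by their weights. -/
theorem sum_pderiv_mul_weight_mul_X_mem {X' : Set (Fin n → 𝕂)}
    (hX' : ∀ c : ℝ, 0 < c → ∀ x ∈ X', scale W c x ∈ X') {u : MvPolynomial (Fin n) 𝕂}
    (hu : u ∈ vanishingIdeal 𝕂 X') :
    ∑ j, pderiv j u * (MvPolynomial.C (W j : 𝕂) * MvPolynomial.X j) ∈ vanishingIdeal 𝕂 X' := by
  obtain ⟨M, hM⟩ := exists_weight_bound W u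
  have h1 : ∀ e, ∑ j, pderiv j (weightedHomogeneousComponent W e u)
      * (MvPolynomial.C (W j : 𝕂) * MvPolynomial.X j) = e • weightedHomogeneousComponent W e u := by
    intro e
    rw [← (MvPolynomial.weightedHomogeneousComponent_isWeightedHomogeneous
      (w := W) e u).sum_weight_X_mul_pderiv]
    refine Finset.sum_congr rfl fun j _ => ?_
    rw [nsmul_eq_mul, map_natCast]
    ring
  rw [← sum_range_weightedHomogeneousComponent W u hM]
  simp only [map_sum, Finset.sum_mul]
  rw [Finset.sum_comm]
  simp only [h1]
  exact Ideal.sum_mem _ fun e _ => nsmul_mem (component_mem_vanishingIdeal hX' hu e) e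

variable {B : Finset (Fin n →₀ ℕ)} {h : (Fin n →₀ ℕ) → (Fin n → 𝕂) × 𝕂 → 𝕂}

theorem analyticAt_fderiv_snd {u : (Fin n → 𝕂) × 𝕂 → 𝕂} (hu : AnalyticAt 𝕂 u 0) :
    AnalyticAt ℝ (fun q => fderiv 𝕂 u q (0, 1)) 0 :=
  (analyticAt_fderiv_apply hu analyticAt_const).restrictScalars

theorem analyticAt_mon_fst (β : Fin n →₀ ℕ) :
    AnalyticAt ℝ (fun q : (Fin n → 𝕂) × 𝕂 => mon β q.1) 0 :=
  (analyticAt_mon β 0).fun_comp_of_eq analyticAt_fst rfl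

/-- The zero germ is not finitely determined: no large power of a coordinate is the derivative of
zero along a vector field. -/
theorem RXFinitelyDetermined.ne_zero (hn : 0 < n) (hW : ∀ i, 0 < W i) {X X' : Set (Fin n → 𝕂)}
    (hXX' : ∀ᶠ x in 𝓝 (0 : Fin n → 𝕂), x ∈ X ↔ x ∈ X')
    (hX' : ∀ c : ℝ, 0 < c → ∀ x ∈ X', scale W c x ∈ X') {f : MvPolynomial (Fin n) 𝕂}
    (hf : RXFinitelyDetermined X (fun x => eval x f)) : f ≠ 0 := by
  rintro rfl
  obtain ⟨N, hN⟩ := hf.exists_homogeneous_tangentField hW hXX' hX'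
    (MvPolynomial.isWeightedHomogeneous_zero 𝕂 W 0)
  obtain ⟨η, hη, -⟩ := hN (Finsupp.single ⟨0, hn⟩ (N + 1)) (by
    rw [Finsupp.degree_single]
    omega) (Nat.zero_le _)
  have h1 := congrArg (MvPolynomial.coeff (Finsupp.single ⟨0, hn⟩ (N + 1))) hη
  simp at h1

/-- The result for natural weights in at least two variables. -/
theorem stronglyRational_of_two_le (hn : 2 ≤ n) (hW : ∀ i, 0 < W i) (hw₁ : ∀ i, W i ≤ w₁)
    (hw₂ : ∀ i, w₂ ≤ W i) {X X' : Set (Fin n → 𝕂)}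
    (hXX' : ∀ᶠ x in 𝓝 (0 : Fin n → 𝕂), x ∈ X ↔ x ∈ X')
    (hX' : ∀ c : ℝ, 0 < c → ∀ x ∈ X', scale W c x ∈ X') {f : MvPolynomial (Fin n) 𝕂} {d D : ℕ}
    (hd : 0 < d) (hfd : IsWeightedHomogeneous W f d)
    (hf : RXFinitelyDetermined X (fun x => eval x f)) (hD : D + w₂ = d + w₁)
    {F : (Fin n → 𝕂) × 𝕂 → 𝕂} (hB : ∀ β ∈ B, D ≤ Finsupp.weight W β)
    (hh : ∀ β, AnalyticAt 𝕂 (h β) 0) (hh0 : ∀ β x, h β (x, 0) = 0)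
    (hF : ∀ᶠ q in 𝓝 (0 : (Fin n → 𝕂) × 𝕂), F q = eval q.1 f + ∑ β ∈ B, mon β q.1 * h β q) :
    StronglyRationalBiLipschitzTrivial X F := by
  obtain ⟨N, hN⟩ := hf.exists_homogeneous_tangentField hW hXX' hX' hfd
  -- Monomials of weight at least `(N + 1) w₁` have degree greater than `N`.
  obtain ⟨c, hLc, hc⟩ := exists_controlFunction (𝕂 := 𝕂) hW hw₁ hn ((N + 1) * w₁ + d)
  have hΓ := exists_expBetween_le hW hw₁ c
  have hΓc : ∀ γ ∈ expBetween W w₁ c, c ≤ Finsupp.weight W γ := fun γ hγ =>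
    (Finset.mem_filter.1 hγ).2
  have hw₁0 : 0 < w₁ := (hW ⟨0, by omega⟩).trans_le (hw₁ _)
  have hη : ∀ γ ∈ expBetween W w₁ c, ∃ η : Fin n → MvPolynomial (Fin n) 𝕂,
      ∑ j, pderiv j f * η j = monomial γ 1 ∧ IsTangentField X (fun x i => eval x (η i)) ∧
      ∀ j, IsWeightedHomogeneous W (η j) (Finsupp.weight W γ - d + W j) := by
    intro γ hγ
    have h1 := hΓc γ hγ
    refine hN γ ?_ (by omega)
    have h2 := weight_le_degree_mul hw₁ γ
    have h3 : (N + 1) * w₁ ≤ γ.degree * w₁ := by omega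
    exact Nat.le_of_mul_le_mul_right h3 hw₁0
  choose! η hη1 hη2 hη3 using hη
  obtain ⟨ρ, hρ, hexp, hlow⟩ := hc _ hΓ
  have hρr := hexp.hasOrder hW hw₁ hΓc
  obtain ⟨r, hr1, hr2, hr3, hr4⟩ := hexp
  have hS : HasOrder W w₁ D fun q => ∑ β ∈ B, mon β q.1 * fderiv 𝕂 (h β) q (0, 1) := by
    refine HasOrder.sum fun β hβ => ((HasOrder.mon hW hw₁ β).mul hW
      (HasOrder.of_analyticAt hW (analyticAt_fderiv_snd (hh β)))).mono hW ?_
    have := hB β hβ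
    omega
  refine stronglyRationalBiLipschitzTrivial_of_control (by omega) hW hw₁ hw₂ hd hD hΓ hΓc (by omega)
    hB hh hh0 hF hη1 hη2 hη3 hρ hρr (c₀ := 1 / 2) (by norm_num) (.of_forall hlow)
    (R := fun γ q => r γ q.1 * ∑ β ∈ B, mon β q.1 * fderiv 𝕂 (h β) q (0, 1)) (fun γ => ?_)
    (fun γ t => ?_) (fun γ => ?_) (.of_forall fun q => ?_)
  · exact ((hr1 γ 0).fun_comp_of_eq analyticAt_fst rfl).mul
      (Finset.analyticAt_fun_sum _ fun β _ => (analyticAt_mon_fst β).mul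
        (analyticAt_fderiv_snd (hh β)))
  · dsimp only
    rw [hr2, zero_mul]
  · refine ((hr3 γ).mul hW hS).mono hW ?_
    push_cast
    omega
  · rw [show ((ρ q.1 : ℝ) : 𝕂) = _ from hr4 q.1, Finset.sum_mul]
    exact Finset.sum_congr rfl fun γ _ => by ring

end NaturalWeights

/-! ### One complex variable -/

section OneVariable

open MvPolynomial (eval pderiv monomial IsWeightedHomogeneous weightedHomogeneousComponent
  vanishingIdeal)

variable {𝕂 : Type*} [RCLike 𝕂]

/-- The control function in one complex variable.  The term `|z| ^ 2` is a sum of two real squares, and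
irreducible for real germs; the terms of higher order bring it into the form of `planePoly`. -/
noncomputable def controlFunOne (x : Fin 1 → 𝕂) : ℝ :=
  ‖x 0‖ ^ 2 + RCLike.re (x 0) * RCLike.im (x 0) ^ 2 + RCLike.im (x 0) ^ 4

theorem le_controlFunOne (x : Fin 1 → 𝕂) : 1 / 2 * ‖x 0‖ ^ 2 ≤ controlFunOne x := by
  rw [controlFunOne, RCLike.norm_sq_eq_def]
  nlinarith [sq_nonneg (RCLike.re (x 0) + RCLike.im (x 0) ^ 2), sq_nonneg (RCLike.im (x 0))]

theorem coe_controlFunOne (x : Fin 1 → 𝕂) : ((controlFunOne x : ℝ) : 𝕂)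
    = (starRingEnd 𝕂) (x 0) * x 0
      + ((RCLike.re (x 0) : ℝ) : 𝕂) * ((RCLike.im (x 0) : ℝ) : 𝕂) ^ 2
      + ((RCLike.im (x 0) : ℝ) : 𝕂) ^ 4 := by
  rw [controlFunOne, RCLike.conj_mul]
  push_cast
  rfl

/-- If the scalars have real dimension at least two, they are complex. -/
theorem im_I_eq_one (hdim : 2 ≤ Module.finrank ℝ 𝕂) : RCLike.im (RCLike.I : 𝕂) = 1 := by
  refine RCLike.I_eq_zero_or_im_I_eq_one.resolve_left fun h => ?_
  have h4 := (RCLike.realLinearIsometryEquiv h).toLinearEquiv.finrank_eq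
  rw [Module.finrank_self] at h4
  omega

/-- In the coordinates `z = x + i y` the function is `planePoly 1 1 1 0 2`. -/
theorem isControlFunction_controlFunOne (hdim : 2 ≤ Module.finrank ℝ 𝕂) {W : Fin 1 → ℕ}
    (hW : ∀ i, 0 < W i) : IsControlFunction (controlFunOne (𝕂 := 𝕂)) ∧
      (∀ x : Fin 1 → 𝕂, 1 / 2 * wnorm W x ^ (2 * W 0) ≤ controlFunOne x) ∧
      ∀ x, AnalyticAt ℝ (fun x : Fin 1 → 𝕂 => ((controlFunOne x : ℝ) : 𝕂)) x := by
  have hlow : ∀ x : Fin 1 → 𝕂, 1 / 2 * wnorm W x ^ (2 * W 0) ≤ controlFunOne x := by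
    intro x
    obtain ⟨i, hi⟩ := exists_wnorm_pow_eq hW one_pos x
    rw [Subsingleton.elim i 0] at hi
    rw [mul_comm 2, pow_mul, hi]
    exact le_controlFunOne x
  have ha : ∀ x, AnalyticAt ℝ (fun x : Fin 1 → 𝕂 => ((controlFunOne x : ℝ) : 𝕂)) x := by
    intro x
    have h0 : AnalyticAt ℝ (fun x : Fin 1 → 𝕂 => x 0) x :=
      (ContinuousLinearMap.proj (R := ℝ) (φ := fun _ : Fin 1 => 𝕂) 0).analyticAt x
    have hre : AnalyticAt ℝ (fun x : Fin 1 → 𝕂 => ((RCLike.re (x 0) : ℝ) : 𝕂)) x :=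
      (((RCLike.ofRealCLM (K := 𝕂)).comp (RCLike.reCLM (K := 𝕂))).analyticAt _).fun_comp_of_eq h0 rfl
    have him : AnalyticAt ℝ (fun x : Fin 1 → 𝕂 => ((RCLike.im (x 0) : ℝ) : 𝕂)) x :=
      (((RCLike.ofRealCLM (K := 𝕂)).comp (RCLike.imCLM (K := 𝕂))).analyticAt _).fun_comp_of_eq h0 rfl
    simp only [coe_controlFunOne]
    exact (((analyticAt_conj h0).mul h0).add (hre.mul (him.pow 2))).add (him.pow 4)
  refine ⟨isControlFunction_of_le hW ha (by simp [controlFunOne]) (by norm_num) hlow ?_, hlow, ha⟩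
  let ι : (Fin 2 → ℝ) →L[ℝ] (Fin 1 → 𝕂) := ContinuousLinearMap.pi fun _ =>
    (RCLike.ofRealCLM (K := 𝕂)).comp (ContinuousLinearMap.proj 0)
      + ((RCLike.ofRealCLM (K := 𝕂)).comp (ContinuousLinearMap.proj 1)).smulRight (RCLike.I : 𝕂)
  have hI := im_I_eq_one hdim
  have hι : ∀ y, controlFunOne (ι y) = MvPolynomial.eval y (planePoly 1 1 1 0 2) := by
    intro y
    have h0 : ι y 0 = ((y 0 : ℝ) : 𝕂) + ((y 1 : ℝ) : 𝕂) * RCLike.I := by simp [ι]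
    have hre : RCLike.re (ι y 0) = y 0 := by simp [h0]
    have him : RCLike.im (ι y 0) = y 1 := by simp [h0, hI]
    rw [controlFunOne, RCLike.norm_sq_eq_def, hre, him]
    simp only [planePoly, map_add, map_mul, map_pow, MvPolynomial.eval_X]
    ring
  exact ne_zero_or_ne_zero_of_plane ι one_pos one_pos rfl hι

theorem hasOrder_controlFunOne {W : Fin 1 → ℕ} {w₁ : ℕ} (hW : ∀ i, 0 < W i) (hw₁ : ∀ i, W i ≤ w₁) :
    HasOrder W w₁ (2 * W 0 : ℕ) fun q : (Fin 1 → 𝕂) × 𝕂 => ((controlFunOne q.1 : ℝ) : 𝕂) := by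
  have h0 : HasOrder W w₁ (W 0) fun q : (Fin 1 → 𝕂) × 𝕂 => q.1 0 := HasOrder.coord hW hw₁ 0
  have hre : HasOrder W w₁ (W 0) fun q : (Fin 1 → 𝕂) × 𝕂 => ((RCLike.re (q.1 0) : ℝ) : 𝕂) := by
    have h1 := (h0.add h0.conj).mul hW (HasOrder.const hW (1 / 2 : 𝕂))
    rw [add_zero] at h1
    convert h1 using 2 with q
    rw [RCLike.re_eq_add_conj]
    ring
  have him : HasOrder W w₁ (W 0) fun q : (Fin 1 → 𝕂) × 𝕂 => ((RCLike.im (q.1 0) : ℝ) : 𝕂) := by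
    have h1 := (h0.conj.add ((HasOrder.const hW (-1 : 𝕂)).mul hW h0 |>.mono hW (by omega))).mul hW
      (HasOrder.const hW (RCLike.I / 2 : 𝕂))
    rw [add_zero] at h1
    convert h1 using 2 with q
    rw [RCLike.im_eq_conj_sub]
    ring
  have h1 := (h0.conj.mul hW h0).mono hW (e' := (2 * W 0 : ℕ)) (by omega)
  have h2 := (hre.mul hW (him.mul hW him)).mono hW (e' := (2 * W 0 : ℕ)) (by omega)
  have h3 := ((him.mul hW him).mul hW (him.mul hW him)).mono hW (e' := (2 * W 0 : ℕ)) (by omega)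
  convert (h1.add h2).add h3 using 2 with q
  rw [coe_controlFunOne]
  ring

/-- The result for natural weights in one complex variable. -/
theorem stronglyRational_of_eq_one (hdim : 2 ≤ Module.finrank ℝ 𝕂) {W : Fin 1 → ℕ} {w₁ w₂ : ℕ}
    (hW : ∀ i, 0 < W i) (hw₁ : ∀ i, W i ≤ w₁)
    (hw₂ : ∀ i, w₂ ≤ W i) {X X' : Set (Fin 1 → 𝕂)}
    (hXX' : ∀ᶠ x in 𝓝 (0 : Fin 1 → 𝕂), x ∈ X ↔ x ∈ X')
    (hX' : ∀ c : ℝ, 0 < c → ∀ x ∈ X', scale W c x ∈ X') {f : MvPolynomial (Fin 1) 𝕂} {d D : ℕ}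
    (hd : 0 < d) (hfd : IsWeightedHomogeneous W f d)
    (hf : RXFinitelyDetermined X (fun x => eval x f)) (hD : D + w₂ = d + w₁)
    {B : Finset (Fin 1 →₀ ℕ)} {h : (Fin 1 →₀ ℕ) → (Fin 1 → 𝕂) × 𝕂 → 𝕂}
    {F : (Fin 1 → 𝕂) × 𝕂 → 𝕂} (hB : ∀ β ∈ B, D ≤ Finsupp.weight W β)
    (hh : ∀ β, AnalyticAt 𝕂 (h β) 0) (hh0 : ∀ β x, h β (x, 0) = 0)
    (hF : ∀ᶠ q in 𝓝 (0 : (Fin 1 → 𝕂) × 𝕂), F q = eval q.1 f + ∑ β ∈ B, mon β q.1 * h β q) :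
    StronglyRationalBiLipschitzTrivial X F := by
  have hwt : ∀ β : Fin 1 →₀ ℕ, Finsupp.weight W β = β 0 * W 0 := by
    intro β
    rw [Finsupp.weight_apply, Finsupp.sum_fintype _ _ (by simp)]
    simp
  have hf0 := hf.ne_zero one_pos hW hXX' hX'
  obtain ⟨γ₀, hγ₀⟩ := MvPolynomial.ne_zero_iff.1 hf0
  have hγd : Finsupp.weight W γ₀ = d := hfd hγ₀
  -- In one variable `f` is a multiple of the monomial `γ₀`, which divides all others of weight `≥ d`.
  have hle : ∀ β, d ≤ Finsupp.weight W β → γ₀ ≤ β := by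
    intro β hβ i
    rw [← hγd, hwt, hwt] at hβ
    rw [Subsingleton.elim i 0]
    exact Nat.le_of_mul_le_mul_right hβ (hW 0)
  have hfm : f = monomial γ₀ (f.coeff γ₀) := by
    ext β
    rw [MvPolynomial.coeff_monomial]
    split_ifs with h1
    · rw [h1]
    · by_contra h2
      have h3 : Finsupp.weight W β = d := hfd h2
      rw [← hγd, hwt, hwt] at h3
      refine h1 (Finsupp.ext fun i => ?_)
      rw [Subsingleton.elim i 0]
      exact (Nat.eq_of_mul_eq_mul_right (hW 0) h3).symm
  have hda : (d : 𝕂) * f.coeff γ₀ ≠ 0 := mul_ne_zero (Nat.cast_ne_zero.2 hd.ne') hγ₀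
  -- a multiple of the Euler field
  let η : Fin 1 → MvPolynomial (Fin 1) 𝕂 := fun j =>
    MvPolynomial.C ((d : 𝕂) * f.coeff γ₀)⁻¹ * (MvPolynomial.C (W j : 𝕂) * MvPolynomial.X j)
  have hηsum : ∀ u : MvPolynomial (Fin 1) 𝕂, ∑ j, pderiv j u * η j
      = MvPolynomial.C ((d : 𝕂) * f.coeff γ₀)⁻¹
        * ∑ j, pderiv j u * (MvPolynomial.C (W j : 𝕂) * MvPolynomial.X j) := by
    intro u
    rw [Finset.mul_sum]
    exact Finset.sum_congr rfl fun j _ => by simp only [η]; ring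
  have hηf : ∑ j, pderiv j f * η j = monomial γ₀ 1 := by
    have h1 : ∑ j, pderiv j f * (MvPolynomial.C (W j : 𝕂) * MvPolynomial.X j) = d • f := by
      rw [← hfd.sum_weight_X_mul_pderiv]
      refine Finset.sum_congr rfl fun j _ => ?_
      rw [nsmul_eq_mul, map_natCast]
      ring
    rw [hηsum, h1, hfm, MvPolynomial.coeff_monomial, if_pos rfl, nsmul_eq_mul, ← map_natCast
      (MvPolynomial.C : 𝕂 →+* MvPolynomial (Fin 1) 𝕂), MvPolynomial.C_mul_monomial,
      MvPolynomial.C_mul_monomial, inv_mul_cancel₀ hda]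
  have hηX : IsTangentField X fun x i => eval x (η i) := by
    refine isTangentField_of_polynomial hW hXX' hX' η fun u hu => ?_
    rw [hηsum]
    exact Ideal.mul_mem_left _ _ (sum_pderiv_mul_weight_mul_X_mem hX' hu)
  have hηW : ∀ j, IsWeightedHomogeneous W (η j) (Finsupp.weight W γ₀ - d + W j) := by
    intro j
    rw [hγd, Nat.sub_self, zero_add]
    have h1 := (MvPolynomial.isWeightedHomogeneous_C W ((d : 𝕂) * f.coeff γ₀)⁻¹).mul
      ((MvPolynomial.isWeightedHomogeneous_C W (W j : 𝕂)).mul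
        (MvPolynomial.isWeightedHomogeneous_X 𝕂 W j))
    rwa [zero_add, zero_add] at h1
  obtain ⟨hρ, hlow, hρa⟩ := isControlFunction_controlFunOne (𝕂 := 𝕂) hdim hW
  have hρr := hasOrder_controlFunOne (𝕂 := 𝕂) hW hw₁
  have hdD : d ≤ D := by
    have := hw₁ 0
    have := hw₂ 0
    omega
  have hS : HasOrder W w₁ ((D : ℤ) - d)
      fun q => ∑ β ∈ B, mon (β - γ₀) q.1 * fderiv 𝕂 (h β) q (0, 1) := by
    refine HasOrder.sum fun β hβ => ((HasOrder.mon hW hw₁ (β - γ₀)).mul hW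
      (HasOrder.of_analyticAt hW (analyticAt_fderiv_snd (hh β)))).mono hW ?_
    have h1 := hB β hβ
    have h2 : Finsupp.weight W β = Finsupp.weight W (β - γ₀) + Finsupp.weight W γ₀ := by
      rw [← map_add, tsub_add_cancel_of_le (hle β (by omega))]
    omega
  refine stronglyRationalBiLipschitzTrivial_of_control one_pos hW hw₁ hw₂ hd hD (c := d) (Γ := {γ₀})
    (fun β hβ => ⟨γ₀, Finset.mem_singleton_self _, hle β hβ⟩)
    (fun γ hγ => by rw [Finset.mem_singleton.1 hγ, hγd]) le_rfl hB hh hh0 hF (η := fun _ => η)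
    (fun γ hγ => by rw [Finset.mem_singleton.1 hγ, hηf]) (fun _ _ => hηX)
    (fun γ hγ => by rw [Finset.mem_singleton.1 hγ]; exact hηW) hρ hρr (c₀ := 1 / 2) (by norm_num)
    (.of_forall hlow) (R := fun _ q => ((controlFunOne q.1 : ℝ) : 𝕂)
      * ∑ β ∈ B, mon (β - γ₀) q.1 * fderiv 𝕂 (h β) q (0, 1)) (fun γ => ?_)
    (fun γ t => ?_) (fun γ => ?_) (.of_forall fun q => ?_)
  · exact ((hρa 0).fun_comp_of_eq analyticAt_fst rfl).mul
      (Finset.analyticAt_fun_sum _ fun β _ => (analyticAt_mon_fst _).mul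
        (analyticAt_fderiv_snd (hh β)))
  · simp [controlFunOne]
  · refine (hρr.mul hW hS).mono hW ?_
    omega
  · rw [Finset.sum_singleton, mul_assoc, Finset.sum_mul]
    congr 1
    refine Finset.sum_congr rfl fun β hβ => ?_
    have h1 := hB β hβ
    have h2 : mon β q.1 = mon (β - γ₀) q.1 * mon γ₀ q.1 := by
      rw [← mon_add, tsub_add_cancel_of_le (hle β (by omega))]
    rw [h2]
    ring

end OneVariable

/-! ### Rational weights -/

section RationalWeights

open MvPolynomial (eval IsWeightedHomogeneous)

variable {𝕂 : Type*} [RCLike 𝕂] {n : ℕ}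

theorem exists_natural_weights {w : Fin n → ℚ} (hw : ∀ i, 0 < w i) :
    ∃ (M : ℕ) (W : Fin n → ℕ), 0 < M ∧ (∀ i, 0 < W i) ∧ ∀ i, (W i : ℚ) = M * w i := by
  let M := ∏ i, (w i).den
  have hM : 0 < M := Finset.prod_pos fun i _ => (w i).pos
  have h1 : ∀ i, ∃ k : ℕ, (k : ℚ) = M * w i := by
    intro i
    obtain ⟨c, hc⟩ : (w i).den ∣ M := Finset.dvd_prod_of_mem (fun i => (w i).den) (Finset.mem_univ i)
    refine ⟨c * (w i).num.toNat, ?_⟩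
    have h2 : (((w i).num.toNat : ℤ) : ℚ) = (w i).num := by
      rw [Int.toNat_of_nonneg (Rat.num_nonneg.2 (hw i).le)]
    rw [Int.cast_natCast] at h2
    rw [hc, Nat.cast_mul, Nat.cast_mul, h2, mul_comm ((w i).den : ℚ), mul_assoc, Rat.den_mul_eq_num]
  choose W hW using h1
  refine ⟨M, W, hM, fun i => ?_, hW⟩
  have h3 : (0 : ℚ) < W i := by
    rw [hW]
    have := hw i
    positivity
  exact_mod_cast h3

theorem weight_natCast {w : Fin n → ℚ} {W : Fin n → ℕ} {M : ℕ} (hW : ∀ i, (W i : ℚ) = M * w i)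
    (β : Fin n →₀ ℕ) : (Finsupp.weight W β : ℚ) = M * Finsupp.weight w β := by
  rw [Finsupp.weight_apply, Finsupp.weight_apply, Finsupp.sum, Finsupp.sum, Nat.cast_sum,
    Finset.mul_sum]
  refine Finset.sum_congr rfl fun i _ => ?_
  rw [smul_eq_mul, Nat.cast_mul, hW, nsmul_eq_mul]
  ring

/-- The zero polynomial is homogeneous of every rational degree, so its natural degree is arbitrary. -/
theorem exists_isWeightedHomogeneous_natural {w : Fin n → ℚ} {W : Fin n → ℕ} {M : ℕ}
    (hW : ∀ i, (W i : ℚ) = M * w i) {P : MvPolynomial (Fin n) 𝕂} {d : ℚ}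
    (hP : IsWeightedHomogeneous w P d) :
    ∃ e : ℕ, IsWeightedHomogeneous W P e ∧ (P ≠ 0 → (e : ℚ) = M * d) := by
  by_cases h0 : P = 0
  · exact ⟨0, h0 ▸ MvPolynomial.isWeightedHomogeneous_zero 𝕂 W 0, fun h => absurd h0 h⟩
  · obtain ⟨γ, hγ⟩ := MvPolynomial.ne_zero_iff.1 h0
    refine ⟨Finsupp.weight W γ, fun β hβ => ?_, fun _ => ?_⟩
    · have h1 : (Finsupp.weight W β : ℚ) = Finsupp.weight W γ := by
        rw [weight_natCast hW, weight_natCast hW, hP hβ, hP hγ]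
      exact_mod_cast h1
    · rw [weight_natCast hW, hP hγ]

/-- The reduction of rational to natural weights: weights, degrees and filtrations are multiplied by a
common denominator.  The degree of `f` is determined by the weights because `f` is not zero. -/
theorem stronglyRational_of_isWeightedHomogeneous (hn : 0 < n)
    (hdim : 2 ≤ Module.finrank ℝ (Fin n → 𝕂)) {w : Fin n → ℚ} {X : Set (Fin n → 𝕂)}
    {f : MvPolynomial (Fin n) 𝕂} {d : ℚ} {F : (Fin n → 𝕂) × 𝕂 → 𝕂} (hw : ∀ i, 0 < w i)
    (hanti : Antitone w) (hX : IsWeightedHomogeneousGerm w X) (hd : 0 < d)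
    (hfd : IsWeightedHomogeneous w f d) (hf : RXFinitelyDetermined X (fun x => eval x f))
    (hF : IsDeformationOfFiltrationGE w (d + w ⟨0, hn⟩ - w ⟨n - 1, Nat.sub_lt hn one_pos⟩)
      (fun x => eval x f) F) : StronglyRationalBiLipschitzTrivial X F := by
  obtain ⟨M, W, hM, hW, hWw⟩ := exists_natural_weights hw
  have hMQ : (0 : ℚ) < M := by exact_mod_cast hM
  have hWanti : Antitone W := by
    intro i j hij
    have h1 : (W j : ℚ) ≤ W i := by
      rw [hWw, hWw]
      exact mul_le_mul_of_nonneg_left (hanti hij) hMQ.le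
    exact_mod_cast h1
  have hw₁ : ∀ i, W i ≤ W ⟨0, hn⟩ := fun i => hWanti (Fin.mk_le_of_le_val (Nat.zero_le _))
  have hw₂ : ∀ i, W ⟨n - 1, Nat.sub_lt hn one_pos⟩ ≤ W i := fun i =>
    hWanti (Fin.le_def.2 (Nat.le_sub_one_of_lt i.2))
  obtain ⟨k, φ, e, -, hφ, hXφ⟩ := hX
  let X' : Set (Fin n → 𝕂) := {x | ∀ j, eval x (φ j) = 0}
  have hX' : ∀ c : ℝ, 0 < c → ∀ x ∈ X', scale W c x ∈ X' := by
    intro c _ x hx j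
    obtain ⟨e', he', -⟩ := exists_isWeightedHomogeneous_natural hWw (hφ j)
    rw [eval_scale_of_isWeightedHomogeneous he', hx j, mul_zero]
  have hf0 := hf.ne_zero hn hW (X' := X') hXφ hX'
  obtain ⟨d', hfd', hd'⟩ := exists_isWeightedHomogeneous_natural hWw hfd
  specialize hd' hf0
  have hd'0 : 0 < d' := by
    have h1 : (0 : ℚ) < d' := by
      rw [hd']
      positivity
    exact_mod_cast h1
  let D := d' + W ⟨0, hn⟩ - W ⟨n - 1, Nat.sub_lt hn one_pos⟩
  have hD : D + W ⟨n - 1, Nat.sub_lt hn one_pos⟩ = d' + W ⟨0, hn⟩ := by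
    have := hw₁ ⟨n - 1, Nat.sub_lt hn one_pos⟩
    omega
  have hDQ : (D : ℚ) = M * (d + w ⟨0, hn⟩ - w ⟨n - 1, Nat.sub_lt hn one_pos⟩) := by
    have h1 : (D : ℚ) + W ⟨n - 1, Nat.sub_lt hn one_pos⟩ = d' + W ⟨0, hn⟩ := by exact_mod_cast hD
    rw [hd', hWw, hWw] at h1
    linear_combination h1
  obtain ⟨hFa, hF0, hFD⟩ := hF
  obtain ⟨B, h, hB, hh, hh0, hG⟩ := exists_deformation_expansion hW
    (G := fun q => F q - eval q.1 f) (D := D)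
    (hFa.sub ((analyticAt_eval f 0).fun_comp_of_eq analyticAt_fst rfl)) (by
      filter_upwards [hF0] with x hx
      rw [hx, sub_self]) (by
      filter_upwards [hFD] with t ht m s hs
      have h1 := ht.trans (sInf_le ⟨m, s, hs, rfl⟩)
      rw [EReal.coe_le_coe_iff, Rat.cast_le] at h1
      have h2 : (D : ℚ) ≤ ((∑ l, W (s l) : ℕ) : ℚ) := by
        rw [hDQ, Nat.cast_sum]
        simp only [hWw]
        rw [← Finset.mul_sum]
        exact mul_le_mul_of_nonneg_left h1 hMQ.le
      exact_mod_cast h2)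
  have hFexp : ∀ᶠ q in 𝓝 (0 : (Fin n → 𝕂) × 𝕂), F q = eval q.1 f + ∑ β ∈ B, mon β q.1 * h β q := by
    filter_upwards [hG] with q hq
    rw [← hq]
    ring
  rcases Nat.eq_or_lt_of_le (show 1 ≤ n from hn) with h1 | h2
  · subst h1
    rw [Module.finrank_pi_fintype, Fin.sum_univ_one] at hdim
    exact stronglyRational_of_eq_one hdim hW hw₁ hw₂ (X' := X') hXφ hX' hd'0 hfd' hf hD hB hh hh0 hFexp
  · exact stronglyRational_of_two_le h2 hW hw₁ hw₂ (X' := X') hXφ hX' hd'0 hfd' hf hD hB hh hh0 hFexp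

theorem isWeightedHomogeneous_one {P : MvPolynomial (Fin n) 𝕂} {d : ℕ} (hP : P.IsHomogeneous d) :
    IsWeightedHomogeneous (fun _ : Fin n => (1 : ℚ)) P d := by
  intro β hβ
  have h1 := weight_natCast (W := fun _ : Fin n => 1) (w := fun _ => (1 : ℚ)) (M := 1)
    (fun i => by simp) β
  rw [Nat.cast_one, one_mul] at h1
  rw [← h1]
  exact_mod_cast hP hβ

end RationalWeights

end BiLipRX

theorem mainTheorem3 {𝕜 : Type*} [RCLike 𝕜] {n : ℕ} (hn : 0 < n)
    (hdim : 2 ≤ Module.finrank ℝ (Fin n → 𝕜)) :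
    (∀ (w : Fin n → ℚ) (X : Set (Fin n → 𝕜)) (f₀ : MvPolynomial (Fin n) 𝕜) (d : ℚ)
        (F : (Fin n → 𝕜) × 𝕜 → 𝕜),
      (∀ i, 0 < w i) → Antitone w → BiLipRX.IsWeightedHomogeneousGerm w X →
      0 < d → MvPolynomial.IsWeightedHomogeneous w f₀ d →
      BiLipRX.RXFinitelyDetermined X (fun x => MvPolynomial.eval x f₀) →
      BiLipRX.IsDeformationOfFiltrationGE w (d + w ⟨0, hn⟩ - w ⟨n - 1, Nat.sub_lt hn one_pos⟩)
        (fun x => MvPolynomial.eval x f₀) F →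
      BiLipRX.StronglyRationalBiLipschitzTrivial X F) ∧
    (∀ (X : Set (Fin n → 𝕜)) (f₀ : MvPolynomial (Fin n) 𝕜) (d : ℕ) (F : (Fin n → 𝕜) × 𝕜 → 𝕜),
      BiLipRX.IsHomogeneousGerm X → 0 < d → f₀.IsHomogeneous d →
      BiLipRX.RXFinitelyDetermined X (fun x => MvPolynomial.eval x f₀) →
      BiLipRX.IsDeformationOfFiltrationGE (fun _ => 1) d (fun x => MvPolynomial.eval x f₀) F →
      BiLipRX.StronglyRationalBiLipschitzTrivial X F) := by
  refine ⟨fun w X f₀ d F hw hanti hX hd hf hfd hF =>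
    BiLipRX.stronglyRational_of_isWeightedHomogeneous hn hdim hw hanti hX hd hf hfd hF,
    fun X f₀ d F hX hd hf hfd hF => ?_⟩
  obtain ⟨p, φ, D, hD, hφ, hXφ⟩ := hX
  refine BiLipRX.stronglyRational_of_isWeightedHomogeneous (w := fun _ => 1) hn hdim
    (fun _ => one_pos) antitone_const
    ⟨p, φ, fun j => D j, fun j => Nat.cast_pos.2 (hD j),
      fun j => BiLipRX.isWeightedHomogeneous_one (hφ j), hXφ⟩
    (Nat.cast_pos.2 hd) (BiLipRX.isWeightedHomogeneous_one hf) hfd ?_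
  rwa [add_sub_cancel_right]
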